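/- Work in $L^2=L^2(0,\infty)$, with $C_c^\infty=C_c^\infty(0,\infty)$ and $H_0^1=H_0^1(0,\infty)$ the closure of $C_c^\infty$ in the Sobolev space $H^1(0,\infty)$. For real $\alpha$ let $\widetilde A_\alpha=-i\partial_x+i\alpha/x$, and for real $m$ let $\widetilde L_m=-\partial_x^2+(m^2-\tfrac14)x^{-2}$, acting on distributions on $(0,\infty)$. The maximal operators $A_\alpha^{\max}$, $L_m^{\max}$ are the restrictions of these expressions to $\{f\in L^2: \widetilde A_\alpha f\in L^2\}$ and $\{f\in L^2:\widetilde L_m f\in L^2\}$; the minimal operators $A_\alpha^{\min}$, $L_m^{\min}$ are the closures of their restrictions to $C_c^\infty$. If $A_\alpha^{\min}=A_\alpha^{\max}$ we write $A_\alpha$ for this operator. Let $\zeta_m(x)=x^{1/2+m}$ and let $\xi$ be a smooth function with $\xi=1$ on $(0,1]$ and $\xi=0$ on $[2,\infty)$. For $m>-1$ let $H_m$ be the restriction of $L_m^{\max}$ to $\mathcal D(L_m^{\min})+\mathbb C\,\xi\zeta_m$. Let $(U_\tau f)(x)=e^{\tau/2}f(e^\tau x)$. For a positive self-adjoint operator $H$,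 $\mathcal Q(H)=\mathcal D(H^{1/2})$ is its form domain, with the norm $(\|f\|^2+\|H^{1/2}f\|^2)^{1/2}$. The Friedrichs (respectively Krein) extension of a positive hermitian operator $S$ is the positive self-adjoint extension $F$ (respectively $K$) of $S$ such that $H\le F$ (respectively $K\le H$), in the sense of quadratic forms, for every positive self-adjoint extension $H$ of $S$. **Theorem.** Let $m>-1$. Then $H_m$ is positive, self-adjoint, homogeneous of degree $-2$ (that is, $U_\tau H_mU_\tau^{-1}=e^{-2\tau}H_m$ for all real $\tau$), and its spectrum is $[0,\infty)$. Moreover: * If $m\ge 1$: $A_{1/2\pm m}^{\min}=A_{1/2\pm m}^{\max}$, $H_m=A_{1/2+m}^*A_{1/2+m}=A_{1/2-m}^*A_{1/2-m}$, $\mathcal Q(H_m)=H_0^1$, and $H_m=L_m^{\min}=L_m^{\max}$. * If $0<m<1$: $A_{1/2+m}^{\min}=A_{1/2+m}^{\max}$, $H_m=A_{1/2+m}^*A_{1/2+m}=(A_{1/2-m}^{\min})^*A_{1/2-m}^{\min}$, $\mathcal Q(H_m)=H_0^1$, and $H_m$ is the Friedrichs extension of $L_m^{\min}$. * If $m=0$: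 $A_{1/2}^{\min}=A_{1/2}^{\max}$, $H_0=A_{1/2}^*A_{1/2}$, $H_0^1+\mathbb C\,\xi\zeta_0$ is a dense subspace of $\mathcal Q(H_0)$, and $H_0$ is both the Friedrichs and the Krein extension of $L_0^{\min}$. * If $-1<m<0$: $H_m=(A_{1/2+m}^{\max})^*A_{1/2+m}^{\max}$, $\mathcal Q(H_m)=H_0^1+\mathbb C\,\xi\zeta_m$, and $H_m$ is the Krein extension of $L_m^{\min}$. This is the only one of the factorizations: $A_{1/2-m}^{\min}=A_{1/2-m}^{\max}$, $H_m\ne A_{1/2-m}^*A_{1/2-m}$ and $H_m\ne(A_{1/2+m}^{\min})^*A_{1/2+m}^{\min}$. -/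

import Mathlib

open MeasureTheory Set Topology
open scoped Distributions ContDiff ENNReal

noncomputable section

namespace BesselOp

/-! ### Unbounded operators on a complex Hilbert space -/

section Abstract

variable {E : Type*} [NormedAddCommGroup E] [InnerProductSpace ℂ E]

/-- The product `S T` of two unbounded operators, with its natural domain
`{f ∈ D(T) | T f ∈ D(S)}`. -/
def prodOp (S T : E →ₗ.[ℂ] E) : E →ₗ.[ℂ] E :=
  S.comp (T.domRestrict ((S.domain.comap T.toFun).map T.domain.subtype)) (by
    rintro ⟨x, hx⟩
    obtain ⟨⟨y, hy, hyx⟩, hxT⟩ := hx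
    have h : (T.domRestrict ((S.domain.comap T.toFun).map T.domain.subtype)) ⟨x, ⟨⟨y, hy, hyx⟩, hxT⟩⟩
        = T y := LinearPMap.domRestrict_apply (by simpa using hyx.symm)
    rw [h]
    exact hy)

/-- A positive operator: `⟨f, T f⟩ ≥ 0` for all `f ∈ D(T)`. -/
def IsPositiveOp (T : E →ₗ.[ℂ] E) : Prop :=
  ∀ f : T.domain, (inner ℂ (f : E) (T f)).im = 0 ∧ 0 ≤ (inner ℂ (f : E) (T f)).re

/-- `z` is in the resolvent set of `T`: the operator `T - z` is a bijection from `D(T)` onto the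
whole space and its inverse `R` is bounded. -/
def InResolventSet (T : E →ₗ.[ℂ] E) (z : ℂ) : Prop :=
  ∃ R : E →L[ℂ] E, (∀ f : T.domain, R (T f - z • (f : E)) = f) ∧
    ∀ g : E, ∃ h : R g ∈ T.domain, T ⟨R g, h⟩ - z • R g = g

/-- The spectrum of an unbounded operator. -/
def spec (T : E →ₗ.[ℂ] E) : Set ℂ := {z | ¬ InResolventSet T z}

/-- `T` is homogeneous of degree `ν` with respect to the one-parameter group `U`:
`U_τ T U_τ⁻¹ = e^{ντ} T`, with `U_τ⁻¹ = U_{-τ}`. -/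
def IsHomogeneousOp (U : ℝ → E →ₗ[ℂ] E) (T : E →ₗ.[ℂ] E) (ν : ℝ) : Prop :=
  ∀ (τ : ℝ) (f : T.domain), ∃ h : U (-τ) (f : E) ∈ T.domain,
    U τ (T ⟨U (-τ) f, h⟩) = (Real.exp (ν * τ) : ℂ) • T f

variable [CompleteSpace E]

/-- `S = H^{1/2}`: the operator `S` is positive, self-adjoint and `S² = H`.
(For a positive self-adjoint `H` one has `|H|^{1/2} = H^{1/2}`.) -/
def IsPosSqrt (S H : E →ₗ.[ℂ] E) : Prop :=
  IsSelfAdjoint S ∧ IsPositiveOp S ∧ prodOp S S = H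

/-- The form domain `Q(H) = D(H^{1/2})` of a positive self-adjoint operator `H`. -/
def formDomain (H : E →ₗ.[ℂ] E) : Set E :=
  {f | ∃ S : E →ₗ.[ℂ] E, IsPosSqrt S H ∧ f ∈ S.domain}

/-- The subspace `D` is contained in `Q(H)` and dense in it, for the norm
`(‖f‖² + ‖H^{1/2} f‖²)^{1/2}` of `Q(H)`; in other words `D` is a core of `H^{1/2}`. -/
def IsDenseInFormDomain (D : Submodule ℂ E) (H : E →ₗ.[ℂ] E) : Prop :=
  ∃ S : E →ₗ.[ℂ] E, IsPosSqrt S H ∧ S.HasCore D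

/-- `H₁ ≤ H₂` in the sense of quadratic forms, for positive self-adjoint operators:
`Q(H₂) ⊆ Q(H₁)` and `‖H₁^{1/2} f‖ ≤ ‖H₂^{1/2} f‖` for `f ∈ Q(H₂)`. -/
def FormLE (H₁ H₂ : E →ₗ.[ℂ] E) : Prop :=
  ∃ S₁ S₂ : E →ₗ.[ℂ] E, IsPosSqrt S₁ H₁ ∧ IsPosSqrt S₂ H₂ ∧
    ∀ f : S₂.domain, ∃ h : (f : E) ∈ S₁.domain, ‖S₁ ⟨f, h⟩‖ ≤ ‖S₂ f‖

/-- `H` is a positive self-adjoint extension of `S`. -/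
def IsPosSelfAdjointExt (S H : E →ₗ.[ℂ] E) : Prop :=
  S ≤ H ∧ IsSelfAdjoint H ∧ IsPositiveOp H

/-- The Friedrichs extension of `S`: the largest positive self-adjoint extension. -/
def IsFriedrichsExt (S F : E →ₗ.[ℂ] E) : Prop :=
  IsPosSelfAdjointExt S F ∧ ∀ H, IsPosSelfAdjointExt S H → FormLE H F

/-- The Krein extension of `S`: the smallest positive self-adjoint extension. -/
def IsKreinExt (S K : E →ₗ.[ℂ] E) : Prop :=
  IsPosSelfAdjointExt S K ∧ ∀ H, IsPosSelfAdjointExt S H → FormLE K H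

end Abstract

/-! ### The space `L²(0,∞)`, test functions and dilations -/

/-- Lebesgue measure on the open half-line `(0,∞)`. -/
abbrev halfLine : Measure ℝ := volume.restrict (Ioi 0)

/-- The Hilbert space `L² = L²(0,∞)`. -/
abbrev L2 : Type := Lp ℂ 2 halfLine

/-- `(0,∞)` as an open subset of `ℝ`. -/
def posReals : TopologicalSpace.Opens ℝ := ⟨Ioi 0, isOpen_Ioi⟩

/-- The space `C_c^∞ = C_c^∞(0,∞)`. -/
abbrev Test : Type := 𝓓(posReals, ℂ)

/-- `C_c^∞` as a subspace of `L²`. -/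
def testSubspace : Submodule ℂ L2 where
  carrier := {f | ∃ φ : Test, (f : ℝ → ℂ) =ᵐ[halfLine] φ}
  zero_mem' := ⟨0, Lp.coeFn_zero ℂ 2 halfLine⟩
  add_mem' := by
    rintro f g ⟨φ, hφ⟩ ⟨ψ, hψ⟩
    exact ⟨φ + ψ, (Lp.coeFn_add f g).trans (hφ.add hψ)⟩
  smul_mem' := by
    rintro c f ⟨φ, hφ⟩
    exact ⟨c • φ, (Lp.coeFn_smul c f).trans (hφ.const_smul c)⟩

/-- The subspace `ℂ u` of `L²` spanned by a function `u` that is square integrable on `(0,∞)`. -/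
def spanFun (u : ℝ → ℂ) : Submodule ℂ L2 where
  carrier := {f | ∃ c : ℂ, (f : ℝ → ℂ) =ᵐ[halfLine] fun x => c * u x}
  zero_mem' := ⟨0, by
    filter_upwards [Lp.coeFn_zero ℂ 2 halfLine] with x hx
    rw [hx]; simp⟩
  add_mem' := by
    rintro f g ⟨c, hc⟩ ⟨d, hd⟩
    refine ⟨c + d, ?_⟩
    filter_upwards [Lp.coeFn_add f g, hc, hd] with x h1 h2 h3
    rw [h1, Pi.add_apply, h2, h3]; ring
  smul_mem' := by
    rintro a f ⟨c, hc⟩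
    refine ⟨a * c, ?_⟩
    filter_upwards [Lp.coeFn_smul a f, hc] with x h1 h2
    rw [h1, Pi.smul_apply, h2, smul_eq_mul]; ring

theorem map_mul_halfLine {a : ℝ} (ha : 0 < a) :
    Measure.map (a * ·) halfLine = ENNReal.ofReal |a⁻¹| • halfLine := by
  have h1 : (a * ·) ⁻¹' (Ioi (0 : ℝ)) = Ioi 0 := by
    ext x; simp [ha]
  have h2 := Measure.restrict_map (μ := (volume : Measure ℝ)) (measurable_const_mul a)
    (measurableSet_Ioi (a := (0 : ℝ)))
  rw [h1, Real.map_volume_mul_left ha.ne', Measure.restrict_smul] at h2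
  exact h2.symm

theorem quasi_mul {a : ℝ} (ha : 0 < a) :
    Measure.QuasiMeasurePreserving (a * ·) halfLine halfLine := by
  refine ⟨measurable_const_mul a, ?_⟩
  rw [map_mul_halfLine ha]
  exact Measure.smul_absolutelyContinuous

theorem memLp_dilate (τ : ℝ) (f : L2) :
    MemLp (fun x => (Real.exp (τ / 2) : ℂ) * f (Real.exp τ * x)) 2 halfLine := by
  refine MemLp.const_mul ?_ _
  refine MemLp.comp_of_map (f := (Real.exp τ * ·)) (g := (f : ℝ → ℂ)) ?_
    (measurable_const_mul _).aemeasurable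
  rw [map_mul_halfLine (Real.exp_pos τ)]
  exact (Lp.memLp f).smul_measure ENNReal.ofReal_ne_top

/-- The group of dilations `(U_τ f)(x) = e^{τ/2} f(e^τ x)` on `L²`. -/
def dilation (τ : ℝ) : L2 →ₗ[ℂ] L2 where
  toFun f := (memLp_dilate τ f).toLp _
  map_add' f g := by
    rw [← MemLp.toLp_add]
    apply MemLp.toLp_congr
    filter_upwards [(quasi_mul (Real.exp_pos τ)).ae_eq (Lp.coeFn_add f g)] with x hx
    simp only [Function.comp_apply, Pi.add_apply] at hx ⊢
    rw [hx]; ring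
  map_smul' c f := by
    rw [RingHom.id_apply, ← MemLp.toLp_const_smul]
    apply MemLp.toLp_congr
    filter_upwards [(quasi_mul (Real.exp_pos τ)).ae_eq (Lp.coeFn_smul c f)] with x hx
    simp only [Function.comp_apply, Pi.smul_apply, smul_eq_mul] at hx ⊢
    rw [hx]; ring

/-! ### Differential expressions in the sense of distributions -/

theorem memLp_coef_mul {c : ℝ → ℂ} (hc : ContinuousOn c (Ioi 0)) {ψ : ℝ → ℂ} (hψ : Continuous ψ)
    (hs : HasCompactSupport ψ) (ht : tsupport ψ ⊆ Ioi 0) :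
    MemLp (fun x => c x * ψ x) 2 halfLine := by
  have h : Continuous (fun x => c x * ψ x) :=
    (hc.mul hψ.continuousOn).continuous_of_tsupport_subset isOpen_Ioi
      ((tsupport_mul_subset_right (f := c) (g := ψ)).trans ht)
  exact h.memLp_of_hasCompactSupport hs.mul_left

theorem test_deriv_props (φ : Test) :
    (Continuous φ ∧ HasCompactSupport φ ∧ tsupport φ ⊆ Ioi 0) ∧
    (Continuous (deriv φ) ∧ HasCompactSupport (deriv φ) ∧ tsupport (deriv φ) ⊆ Ioi 0) ∧
    (Continuous (deriv (deriv φ)) ∧ HasCompactSupport (deriv (deriv φ)) ∧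
      tsupport (deriv (deriv φ)) ⊆ Ioi 0) := by
  have h0 : ContDiff ℝ ∞ φ := φ.contDiff
  have h1 : ContDiff ℝ ∞ (deriv φ) := (contDiff_infty_iff_deriv.1 h0).2
  have h2 : ContDiff ℝ ∞ (deriv (deriv φ)) := (contDiff_infty_iff_deriv.1 h1).2
  have t0 : tsupport φ ⊆ Ioi 0 := φ.tsupport_subset
  have t1 : tsupport (deriv φ) ⊆ Ioi 0 := (tsupport_deriv_subset).trans t0
  have t2 : tsupport (deriv (deriv φ)) ⊆ Ioi 0 := (tsupport_deriv_subset).trans t1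
  exact ⟨⟨h0.continuous, φ.hasCompactSupport, t0⟩,
    ⟨h1.continuous, φ.hasCompactSupport.deriv, t1⟩,
    ⟨h2.continuous, φ.hasCompactSupport.deriv.deriv, t2⟩⟩

/-- Let `Tᵗ` be the transpose of a differential expression `T`. This is the set of pairs `(f, g)` in
`L² × L²` with `T f = g` in the sense of distributions on `(0,∞)`, that is,
`∫ g φ = ∫ f (Tᵗ φ)` for all test functions `φ`. -/
def distGraph (Tt : Test → ℝ → ℂ) (hT : ∀ φ, MemLp (Tt φ) 2 halfLine) :
    Submodule ℂ (L2 × L2) where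
  carrier := {p | ∀ φ : Test, ∫ x in Ioi 0, p.2 x * φ x = ∫ x in Ioi 0, p.1 x * Tt φ x}
  zero_mem' := by
    intro φ
    have h : ∀ ψ : ℝ → ℂ, ∫ x in Ioi 0, (0 : L2) x * ψ x = 0 := fun ψ => by
      rw [← integral_zero ℝ ℂ (μ := halfLine)]
      refine integral_congr_ae ?_
      filter_upwards [Lp.coeFn_zero ℂ 2 halfLine] with x hx
      rw [hx]; simp
    exact (h _).trans (h _).symm
  add_mem' := by
    intro p q hp hq φ
    have hφ : MemLp φ 2 halfLine :=
      (test_deriv_props φ).1.1.memLp_of_hasCompactSupport (test_deriv_props φ).1.2.1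
    have h : ∀ (u v : L2) (ψ : ℝ → ℂ), MemLp ψ 2 halfLine →
        ∫ x in Ioi 0, (u + v) x * ψ x = (∫ x in Ioi 0, u x * ψ x) + ∫ x in Ioi 0, v x * ψ x := by
      intro u v ψ hψ
      refine Eq.trans ?_
        (integral_add ((Lp.memLp u).integrable_mul hψ) ((Lp.memLp v).integrable_mul hψ))
      refine integral_congr_ae ?_
      filter_upwards [Lp.coeFn_add u v] with x hx
      simp only [hx, Pi.add_apply]; ring
    rw [Prod.snd_add, Prod.fst_add, h _ _ _ hφ, h _ _ _ (hT φ), hp φ, hq φ]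
  smul_mem' := by
    intro c p hp φ
    have h : ∀ (u : L2) (ψ : ℝ → ℂ),
        ∫ x in Ioi 0, (c • u) x * ψ x = c * ∫ x in Ioi 0, u x * ψ x := by
      intro u ψ
      rw [← integral_const_mul]
      refine integral_congr_ae ?_
      filter_upwards [Lp.coeFn_smul c u] with x hx
      rw [hx, Pi.smul_apply, smul_eq_mul]; ring
    rw [Prod.smul_snd, Prod.smul_fst, h, h, hp φ]

/-- The restriction of the differential expression `T` with transpose `Tᵗ` to
`{f ∈ L² | T f ∈ L²}`, as an operator in `L²`. -/
def distOp (Tt : Test → ℝ → ℂ) (hT : ∀ φ, MemLp (Tt φ) 2 halfLine) : L2 →ₗ.[ℂ] L2 :=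
  (distGraph Tt hT).toLinearPMap

/-- `distGraph` is single-valued, so that it is indeed the graph of `distOp`. -/
theorem distOp_graph (Tt : Test → ℝ → ℂ) (hT : ∀ φ, MemLp (Tt φ) 2 halfLine) :
    (distOp Tt hT).graph = distGraph Tt hT := by
  refine Submodule.toLinearPMap_graph_eq _ ?_
  rintro ⟨f, g⟩ hp (hf : f = 0)
  subst hf
  have hg : LocallyIntegrableOn (g : ℝ → ℂ) (Ioi 0) volume := by
    exact locallyIntegrableOn_of_locallyIntegrable_restrict
      ((Lp.memLp g).locallyIntegrable (by norm_num))
  have key := isOpen_Ioi.ae_eq_zero_of_integral_contDiff_smul_eq_zero hg (fun r hr hrc hrs => by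
    have hcs : HasCompactSupport (fun x => (r x : ℂ)) := hrc.comp_left Complex.ofReal_zero
    have hts : tsupport (fun x => (r x : ℂ)) ⊆ (posReals : Set ℝ) :=
      (closure_mono (fun x hx => by
        simpa [Function.mem_support] using hx)).trans hrs
    have := hp ⟨fun x => (r x : ℂ), Complex.ofRealCLM.contDiff.comp hr, hcs, hts⟩
    have h0 : ∀ ψ : ℝ → ℂ, ∫ x in Ioi 0, (0 : L2) x * ψ x = 0 := fun ψ => by
      rw [← integral_zero ℝ ℂ (μ := halfLine)]
      refine integral_congr_ae ?_
      filter_upwards [Lp.coeFn_zero ℂ 2 halfLine] with x hx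
      rw [hx]; simp
    rw [h0] at this
    rw [← this]
    symm
    refine (setIntegral_eq_integral_of_forall_compl_eq_zero (s := Ioi 0) ?_).trans ?_
    · intro x hx
      have : r x = 0 := by
        by_contra hne
        exact hx (hrs (subset_tsupport _ hne))
      change (g x : ℂ) * (r x : ℂ) = 0
      simp [this]
    · refine integral_congr_ae (Filter.Eventually.of_forall fun x => ?_)
      change (g x : ℂ) * (r x : ℂ) = r x • g x
      rw [Complex.real_smul, mul_comm])
  refine Lp.ext ?_
  have h3 : ∀ᵐ x ∂halfLine, g x = 0 := (ae_restrict_iff' measurableSet_Ioi).2 key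
  filter_upwards [h3, Lp.coeFn_zero ℂ 2 halfLine] with x hx h0
  rw [h0]; exact hx

theorem memLp_transpose_deriv (φ : Test) : MemLp (fun x => -deriv φ x) 2 halfLine := by
  obtain ⟨-, ⟨h1, h2, -⟩, -⟩ := test_deriv_props φ
  exact (h1.memLp_of_hasCompactSupport h2).neg

/-- The weak derivative `f ↦ f'` in `L²`; its domain is the Sobolev space `H¹(0,∞)`. -/
def weakDeriv : L2 →ₗ.[ℂ] L2 :=
  distOp (fun φ x => -deriv φ x) memLp_transpose_deriv

/-- The Sobolev space `H_0^1 = H_0^1(0,∞)`, the closure of `C_c^∞` in `H¹(0,∞)`. -/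
def H01 : Submodule ℂ L2 :=
  (weakDeriv.domRestrict testSubspace).closure.domain

/-! ### First order operators -/

theorem memLp_transpose_first (α : ℝ) (φ : Test) :
    MemLp (fun x => Complex.I * deriv φ x + Complex.I * (α / x) * φ x) 2 halfLine := by
  obtain ⟨⟨a1, a2, a3⟩, ⟨b1, b2, b3⟩, -⟩ := test_deriv_props φ
  refine (memLp_coef_mul continuousOn_const b1 b2 b3).add (memLp_coef_mul ?_ a1 a2 a3)
  refine continuousOn_const.mul (continuousOn_const.div (by fun_prop) ?_)
  intro x hx
  exact_mod_cast (ne_of_gt hx)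

/-- The maximal operator `A_α^max` of the expression `-i ∂ₓ + i α / x`. -/
def Amax (α : ℝ) : L2 →ₗ.[ℂ] L2 :=
  distOp (fun φ x => Complex.I * deriv φ x + Complex.I * (α / x) * φ x) (memLp_transpose_first α)

/-- The minimal operator `A_α^min`: the closure of the restriction of `-i ∂ₓ + i α / x` to
`C_c^∞`. -/
def Amin (α : ℝ) : L2 →ₗ.[ℂ] L2 :=
  ((Amax α).domRestrict testSubspace).closure

/-! ### Second order operators -/

theorem memLp_transpose_second (m : ℝ) (φ : Test) :
    MemLp (fun x => -deriv (deriv φ) x + ((m ^ 2 - 1 / 4) / x ^ 2 : ℝ) * φ x) 2 halfLine := by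
  obtain ⟨⟨a1, a2, a3⟩, -, ⟨b1, b2, b3⟩⟩ := test_deriv_props φ
  refine (b1.memLp_of_hasCompactSupport b2).neg.add (memLp_coef_mul ?_ a1 a2 a3)
  refine Complex.continuous_ofReal.comp_continuousOn (continuousOn_const.div (by fun_prop) ?_)
  intro x hx
  exact pow_ne_zero 2 (ne_of_gt hx)

/-- The maximal operator `L_m^max` of the expression `-∂ₓ² + (m² - 1/4) / x²`. -/
def Lmax (m : ℝ) : L2 →ₗ.[ℂ] L2 :=
  distOp (fun φ x => -deriv (deriv φ) x + ((m ^ 2 - 1 / 4) / x ^ 2 : ℝ) * φ x)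
    (memLp_transpose_second m)

/-- The minimal operator `L_m^min`: the closure of the restriction of `-∂ₓ² + (m² - 1/4) / x²` to
`C_c^∞`. -/
def Lmin (m : ℝ) : L2 →ₗ.[ℂ] L2 :=
  ((Lmax m).domRestrict testSubspace).closure

/-- A smooth cutoff function `ξ` near the origin. -/
structure IsCutoff (ξ : ℝ → ℂ) : Prop where
  smooth : ContDiff ℝ ∞ ξ
  eq_one : ∀ x ≤ 1, ξ x = 1
  eq_zero : ∀ x, 2 ≤ x → ξ x = 0

/-- The function `ζ_m(x) = x^{1/2 + m}` on `(0,∞)`. -/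
def zeta (m : ℝ) (x : ℝ) : ℂ := ((x ^ (1 / 2 + m) : ℝ) : ℂ)

/-- The line `ℂ ξ ζ_m` in `L²`. -/
def cutoffLine (m : ℝ) (ξ : ℝ → ℂ) : Submodule ℂ L2 := spanFun (fun x => ξ x * zeta m x)

/-- The operator `H_m` for `m > -1`: the restriction of `L_m^max` to `D(L_m^min) + ℂ ξ ζ_m`. -/
def hamiltonian (m : ℝ) (ξ : ℝ → ℂ) : L2 →ₗ.[ℂ] L2 :=
  (Lmax m).domRestrict ((Lmin m).domain ⊔ cutoffLine m ξ)

end BesselOp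

end

namespace BesselOp

/-! ### Abstract operator theory -/

section Abstract

open LinearPMap Filter

variable {E : Type*} [NormedAddCommGroup E] [InnerProductSpace ℂ E]

/-! For β = 1/2 ± m one has β² - β = m² - 1/4, so L_m factors formally as A_{-β} A_β, where A_{-β}
is the formal adjoint of A_β. Exactly, the adjoint of `Amin β` is `Amax (-β)` and the adjoint of
`Amax β` is `Amin (-β)`. For every closed T between `Amin β` and `Amax β`, von Neumann's theorem
therefore makes T*T a positive self-adjoint operator between `Lmin m` and `Lmax m`, with form domain
D(T). What remains is to recognize which T produces H_m and to describe D(T).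

The substitution f = x^α F turns A_α f = g into F' = i x^{-α} g, so regularity questions become
questions about primitives. By Cauchy–Schwarz, f = c x^α + O(√x) at the origin when α < 1/2, and an
element of the maximal domain that is O(√x) there lies in the minimal domain (`mem_Amin_of_bound`).
Since x^α is not square integrable near 0 for α ≤ -1/2, the two operators coincide there, and by
taking adjoints also for α ≥ 1/2; in between, the domains differ by the line spanned by ξ x^α.
Hardy's inequality identifies D(`Amin α`) with H_0^1 when α ≠ 1/2.

The central identity is H_m = T*T with T = `Amax (1/2 + m)`, for all m > -1 (`hamiltonian_eq`). One
inclusion holds because A_{1/2+m} annihilates x^{1/2+m}. For the other, take u in the domain of the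
adjoint of H_m and write A_{1/2+m} u = x^{-1/2-m} K. Pairing with ξ ζ_m forces K(0) = 0, which makes
A_{1/2+m} u of size O(√x) at the origin; a growth argument makes it square integrable at infinity.
For m ≥ 1 the condition K(0) = 0 is automatic, so H_m is the maximal operator. For m > 0, H_m is
also contained in, hence equal to, the product built from `Amin (1/2 - m)`.

Test functions are a core of `Amin β`, which makes its product the Friedrichs extension. For β ≤ 1/2
the image of the test functions under A_β is a core of the adjoint of `Amax β`, which makes that
product the Krein extension. At β = 1/2 the two products agree. Forms are defined through square
roots; these come from the resolvent at -1 and the continuous functional calculus, and T has the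
same domain and norms as the square root of T*T (`exists_graph_of_adjoint_mul_eq`). Positivity
confines the spectrum to [0,∞), and plane waves with slowly spreading envelopes fill that half-line.
-/

theorem inner_self_ofReal (x : E) : (inner ℂ x x : ℂ) = ((‖x‖ ^ 2 : ℝ) : ℂ) := by
  rw [inner_self_eq_norm_sq_to_K]; norm_cast

/-- In graph form the product is plain composition of relations, free of nested subtypes. Unbounded
operators are handled through their graphs from here on. -/
theorem mem_prodOp_graph {S T : E →ₗ.[ℂ] E} {f h : E} :
    (f, h) ∈ (prodOp S T).graph ↔ ∃ g, (f, g) ∈ T.graph ∧ (g, h) ∈ S.graph := by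
  constructor
  · intro hf
    obtain ⟨⟨x, hx⟩, hxf, hxh⟩ := (LinearPMap.mem_graph_iff _).1 hf
    obtain ⟨⟨y, hy, hyx⟩, hxT⟩ := id hx
    have hval : (T.domRestrict ((S.domain.comap T.toFun).map T.domain.subtype)) ⟨x, hx⟩ = T y :=
      LinearPMap.domRestrict_apply (by simpa using hyx.symm)
    refine ⟨T y, ?_, ?_⟩
    · have : (y : E) = f := hyx.trans hxf
      rw [← this]; exact T.mem_graph y
    · have h2 : (prodOp S T) ⟨x, hx⟩ = S ⟨T y, hy⟩ := by
        change S ⟨_, _⟩ = _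
        congr 1
        exact Subtype.ext hval
      have h3 : h = S ⟨T y, hy⟩ := hxh.symm.trans h2
      rw [h3]
      exact S.mem_graph ⟨T y, hy⟩
  · rintro ⟨g, hfg, hgh⟩
    obtain ⟨y, hy, rfl⟩ := (LinearPMap.mem_graph_iff _).1 hfg
    obtain ⟨z, hz, rfl⟩ := (LinearPMap.mem_graph_iff _).1 hgh
    subst hy
    have hyS : T y ∈ S.domain := by
      have hz' : (z : E) = T y := hz
      exact hz' ▸ z.2
    have hx : (y : E) ∈ ((S.domain.comap T.toFun).map T.domain.subtype) ⊓ T.domain :=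
      ⟨⟨y, hyS, rfl⟩, y.2⟩
    have hval : (T.domRestrict ((S.domain.comap T.toFun).map T.domain.subtype)) ⟨y, hx⟩ = T y :=
      LinearPMap.domRestrict_apply rfl
    refine (LinearPMap.mem_graph_iff _).2 ⟨⟨y, hx⟩, rfl, ?_⟩
    change S ⟨_, _⟩ = _
    congr 1
    exact Subtype.ext (hval.trans hz.symm)

theorem mem_domRestrict_graph {T : E →ₗ.[ℂ] E} {D : Submodule ℂ E} {f g : E} :
    (f, g) ∈ (T.domRestrict D).graph ↔ f ∈ D ∧ (f, g) ∈ T.graph := by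
  constructor
  · intro h
    obtain ⟨x, rfl, rfl⟩ := (LinearPMap.mem_graph_iff _).1 h
    exact ⟨x.2.1, LinearPMap.le_graph_of_le LinearPMap.domRestrict_le h⟩
  · rintro ⟨hD, h⟩
    obtain ⟨x, rfl, rfl⟩ := (LinearPMap.mem_graph_iff _).1 h
    exact (LinearPMap.mem_graph_iff _).2 ⟨⟨x, hD, x.2⟩, rfl, LinearPMap.domRestrict_apply rfl⟩

theorem mem_domain_iff_graph {T : E →ₗ.[ℂ] E} {f : E} :
    f ∈ T.domain ↔ ∃ g, (f, g) ∈ T.graph := LinearPMap.mem_domain_iff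

theorem ext_of_graph {S T : E →ₗ.[ℂ] E} (h : ∀ f g, (f, g) ∈ S.graph ↔ (f, g) ∈ T.graph) :
    S = T :=
  LinearPMap.eq_of_eq_graph (by ext ⟨f, g⟩; exact h f g)

theorem le_of_graph {S T : E →ₗ.[ℂ] E} (h : ∀ f g, (f, g) ∈ S.graph → (f, g) ∈ T.graph) :
    S ≤ T :=
  LinearPMap.le_of_le_graph (by rintro ⟨f, g⟩ hfg; exact h f g hfg)

theorem graph_of_le {S T : E →ₗ.[ℂ] E} (h : S ≤ T) {f g : E} (hf : (f, g) ∈ S.graph) :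
    (f, g) ∈ T.graph := LinearPMap.le_graph_of_le h hf

theorem isPositiveOp_iff {T : E →ₗ.[ℂ] E} :
    IsPositiveOp T ↔ ∀ f g, (f, g) ∈ T.graph →
      (inner ℂ f g : ℂ).im = 0 ∧ 0 ≤ (inner ℂ f g : ℂ).re := by
  constructor
  · intro h f g hfg
    obtain ⟨x, rfl, rfl⟩ := (LinearPMap.mem_graph_iff _).1 hfg
    exact h x
  · intro h x
    exact h _ _ (T.mem_graph x)

theorem closure_graph_of_le {S T : E →ₗ.[ℂ] E} (hT : T.IsClosed) (h : S ≤ T) :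
    S.closure.graph = S.graph.topologicalClosure :=
  ((hT.isClosable.leIsClosable h).graph_closure_eq_closure_graph).symm

theorem closure_le_of_le {S T : E →ₗ.[ℂ] E} (hT : T.IsClosed) (h : S ≤ T) : S.closure ≤ T := by
  refine LinearPMap.le_of_le_graph ?_
  rw [closure_graph_of_le hT h]
  exact Submodule.topologicalClosure_minimal _ (LinearPMap.le_graph_of_le h) hT

/-- A bound between two linear relations passes to their closures. -/
theorem exists_mem_closure_of_bound [CompleteSpace E] {G G' : Submodule ℂ (E × E)} {C : ℝ}
    (h : ∀ a b, (a, b) ∈ G → ∃ b', (a, b') ∈ G')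
    (hC : ∀ a b b', (a, b) ∈ G → (a, b') ∈ G' → ‖b'‖ ≤ C * ‖b‖) {f g : E}
    (hfg : (f, g) ∈ G.topologicalClosure) :
    ∃ g', (f, g') ∈ G'.topologicalClosure ∧ ‖g'‖ ≤ C * ‖g‖ := by
  obtain ⟨x, hx, hlim⟩ := mem_closure_iff_seq_limit.1
    (show (f, g) ∈ closure (G : Set (E × E)) from hfg)
  have h1 : Tendsto (fun n => (x n).1) atTop (𝓝 f) := (continuous_fst.tendsto _).comp hlim
  have h2 : Tendsto (fun n => (x n).2) atTop (𝓝 g) := (continuous_snd.tendsto _).comp hlim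
  choose y hy using fun n => h (x n).1 (x n).2 (hx n)
  have hcau : CauchySeq y := by
    have hc2 := h2.cauchySeq
    rw [Metric.cauchySeq_iff] at hc2 ⊢
    intro ε hε
    -- The sign of C is not known, so |C| + 1 serves as a positive divisor.
    obtain ⟨N, hN⟩ := hc2 (ε / (|C| + 1)) (by positivity)
    refine ⟨N, fun m hm n hn => ?_⟩
    have hb := hC ((x m).1 - (x n).1) ((x m).2 - (x n).2) (y m - y n)
      (G.sub_mem (hx m) (hx n)) (G'.sub_mem (hy m) (hy n))
    have hd := hN m hm n hn
    rw [dist_eq_norm] at hd ⊢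
    have hp : 0 < |C| + 1 := by positivity
    rw [lt_div_iff₀ hp] at hd
    have : C * ‖(x m).2 - (x n).2‖ ≤ |C| * ‖(x m).2 - (x n).2‖ := by
      gcongr; exact le_abs_self C
    nlinarith [norm_nonneg ((x m).2 - (x n).2)]
  obtain ⟨g', hg'⟩ := cauchySeq_tendsto_of_complete hcau
  refine ⟨g', ?_, ?_⟩
  · refine mem_closure_of_tendsto (f := fun n => ((x n).1, y n)) (b := atTop) (h1.prodMk_nhds hg')
      (Eventually.of_forall hy)
  · exact le_of_tendsto_of_tendsto' hg'.norm (h2.norm.const_mul C)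
      fun n => hC _ _ _ (hx n) (hy n)

/-- Criterion for density in a closed linear relation. -/
theorem mem_closure_of_orthogonal [CompleteSpace E] {G K : Submodule ℂ (E × E)} (hGK : G ≤ K)
    (hK : IsClosed (K : Set (E × E)))
    (h : ∀ f g, (f, g) ∈ K → (∀ a b, (a, b) ∈ G → (inner ℂ a f : ℂ) + inner ℂ b g = 0) →
      f = 0 ∧ g = 0) : K ≤ G.topologicalClosure := by
  -- The product E × E carries the sup norm; orthogonal projections need its Hilbert space version.
  let e : WithLp 2 (E × E) ≃L[ℂ] E × E := WithLp.prodContinuousLinearEquiv 2 ℂ E E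
  let G₁ : Submodule ℂ (WithLp 2 (E × E)) := G.comap (e : WithLp 2 (E × E) →ₗ[ℂ] E × E)
  have hcl : ∀ p : E × E, e.symm p ∈ G₁.topologicalClosure → p ∈ G.topologicalClosure := by
    intro p hp
    have hp' : e.symm p ∈ closure (e ⁻¹' (G : Set (E × E))) := hp
    have h2 := e.continuous.closure_preimage_subset (G : Set (E × E)) hp'
    rwa [mem_preimage, ContinuousLinearEquiv.apply_symm_apply] at h2
  rintro ⟨f, g⟩ hfg
  apply hcl
  let P := G₁.topologicalClosure
  have : CompleteSpace P := (Submodule.isClosed_topologicalClosure G₁).completeSpace_coe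
  obtain ⟨p, hp, q, hq, hpq⟩ := Submodule.exists_add_mem_mem_orthogonal (K := P) (e.symm (f, g))
  have hPK : ∀ w ∈ P, e w ∈ K := by
    intro w hw
    have : w ∈ closure (e ⁻¹' (G : Set (E × E))) := hw
    have h2 := e.continuous.closure_preimage_subset (G : Set (E × E)) this
    exact (Submodule.topologicalClosure_minimal G hGK hK) h2
  have hqK : e q ∈ K := by
    have : e q = (f, g) - e p := by
      have := congrArg e hpq
      rw [_root_.map_add, ContinuousLinearEquiv.apply_symm_apply] at this
      rw [this]; abel
    rw [this]
    exact K.sub_mem hfg (hPK p hp)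
  have hq0 := h (e q).1 (e q).2 hqK (fun a b hab => by
    have := (Submodule.mem_orthogonal P q).1 hq (e.symm (a, b))
      (G₁.le_topologicalClosure (by
        change e (e.symm (a, b)) ∈ G
        simpa using hab))
    rw [WithLp.prod_inner_apply] at this
    exact this)
  have : q = 0 := by
    apply e.injective
    rw [_root_.map_zero]
    exact Prod.ext hq0.1 hq0.2
  rw [hpq, this, add_zero]
  exact hp

variable [CompleteSpace E]

theorem mem_adjoint_graph {A : E →ₗ.[ℂ] E} (hA : Dense (A.domain : Set E)) {f g : E} :
    (f, g) ∈ A†.graph ↔ ∀ a b, (a, b) ∈ A.graph → (inner ℂ b f : ℂ) = inner ℂ a g := by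
  rw [LinearPMap.adjoint_graph_eq_graph_adjoint hA, Submodule.mem_adjoint_iff]
  simp only [sub_eq_zero]

theorem adjoint_isClosed' {A : E →ₗ.[ℂ] E} (hA : Dense (A.domain : Set E)) : A†.IsClosed :=
  LinearPMap.adjoint_isClosed hA

theorem mem_adjoint_graph' {A : E →ₗ.[ℂ] E} (hA : Dense (A.domain : Set E)) {f g : E} :
    (f, g) ∈ A†.graph ↔ ∀ a b, (a, b) ∈ A.graph → (inner ℂ f b : ℂ) = inner ℂ g a := by
  rw [mem_adjoint_graph hA]
  refine forall_congr' fun a => forall_congr' fun b => forall_congr' fun _ => ?_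
  rw [← inner_conj_symm b f, ← inner_conj_symm a g]
  exact (starRingEnd ℂ).injective.eq_iff

/-- A closed operator is determined by its adjoint relation. -/
theorem mem_graph_of_adjoint {A : E →ₗ.[ℂ] E} (hd : Dense (A.domain : Set E)) (hA : A.IsClosed)
    {f g : E} (h : ∀ a b, (a, b) ∈ A†.graph → (inner ℂ b f : ℂ) = inner ℂ a g) :
    (f, g) ∈ A.graph := by
  have hA' : _root_.IsClosed (A.graph : Set (E × E)) := hA
  -- Adjoin the candidate pair to the graph; the sum stays closed because only one dimension is
  -- added. A vector (u, v) of K orthogonal to the graph has (v, -u) in the graph of the adjoint, so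
  -- by hypothesis it is also orthogonal to (f, g), hence to itself.
  let K : Submodule ℂ (E × E) := A.graph ⊔ ℂ ∙ (f, g)
  have hK : _root_.IsClosed (K : Set (E × E)) :=
    Submodule.isClosed_sup_finiteDimensional _ _ hA'
  have hle : K ≤ A.graph.topologicalClosure := by
    refine mem_closure_of_orthogonal le_sup_left hK ?_
    intro u v huv horth
    have hadj : (v, -u) ∈ A†.graph := by
      rw [mem_adjoint_graph hd]
      intro a b hab
      rw [inner_neg_right, eq_neg_iff_add_eq_zero, add_comm]
      exact horth a b hab
    obtain ⟨p, hp, q, hq, hpq⟩ := Submodule.mem_sup.1 huv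
    obtain ⟨c, rfl⟩ := Submodule.mem_span_singleton.1 hq
    have hu : u = p.1 + c • f := (Prod.ext_iff.1 hpq).1.symm
    have hv : v = p.2 + c • g := (Prod.ext_iff.1 hpq).2.symm
    have e1 := horth p.1 p.2 hp
    have e2 := h _ _ hadj
    have e3 : (inner ℂ u u : ℂ) + inner ℂ v v = 0 := by
      have e4 : (inner ℂ f u : ℂ) + inner ℂ g v = 0 := by
        have := congrArg (starRingEnd ℂ) e2
        rw [inner_conj_symm, inner_conj_symm, inner_neg_right] at this
        rw [← this]; ring
      conv_lhs => rw [show (inner ℂ u u : ℂ) = inner ℂ (p.1 + c • f) u by rw [← hu],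
        show (inner ℂ v v : ℂ) = inner ℂ (p.2 + c • g) v by rw [← hv]]
      rw [inner_add_left, inner_add_left, inner_smul_left, inner_smul_left]
      linear_combination e1 + (starRingEnd ℂ c) * e4
    rw [inner_self_ofReal, inner_self_ofReal] at e3
    have e5 : ‖u‖ ^ 2 + ‖v‖ ^ 2 = 0 := by exact_mod_cast e3
    constructor
    · rw [← norm_eq_zero]; nlinarith [sq_nonneg ‖u‖, sq_nonneg ‖v‖]
    · rw [← norm_eq_zero]; nlinarith [sq_nonneg ‖u‖, sq_nonneg ‖v‖]
  have hmem : (f, g) ∈ K := le_sup_right (α := Submodule ℂ (E × E)) (Submodule.mem_span_singleton_self _)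
  have := hle hmem
  rwa [hA'.submodule_topologicalClosure_eq] at this

/-- For closed, densely defined `T`, the operator `1 + T* T` is onto. -/
theorem exists_one_add_adjoint_mul {T : E →ₗ.[ℂ] E} (hd : Dense (T.domain : Set E))
    (hT : T.IsClosed) (h : E) : ∃ f g, (f, g) ∈ T.graph ∧ (g, h - f) ∈ T†.graph := by
  let e : WithLp 2 (E × E) ≃L[ℂ] E × E := WithLp.prodContinuousLinearEquiv 2 ℂ E E
  let P : Submodule ℂ (WithLp 2 (E × E)) := T.graph.comap (e : WithLp 2 (E × E) →ₗ[ℂ] E × E)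
  have hP : _root_.IsClosed (P : Set (WithLp 2 (E × E))) := IsClosed.preimage e.continuous hT
  have : CompleteSpace P := hP.completeSpace_coe
  -- Von Neumann's argument: the projection of (h, 0) onto the graph is some (f, g), and
  -- orthogonality of the remainder (h - f, -g) to the graph says exactly that T* g = h - f.
  obtain ⟨p, hp, q, hq, hpq⟩ := Submodule.exists_add_mem_mem_orthogonal (K := P) (e.symm (h, 0))
  have hep : e p + e q = (h, 0) := by
    rw [← _root_.map_add, ← hpq, ContinuousLinearEquiv.apply_symm_apply]
  have h1 : (e q).1 = h - (e p).1 := by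
    have := (Prod.ext_iff.1 hep).1
    exact eq_sub_of_add_eq' this
  have h2 : (e q).2 = -(e p).2 := by
    have := (Prod.ext_iff.1 hep).2
    exact eq_neg_of_add_eq_zero_right this
  refine ⟨(e p).1, (e p).2, hp, ?_⟩
  rw [mem_adjoint_graph hd]
  intro a b hab
  have := (Submodule.mem_orthogonal P q).1 hq (e.symm (a, b)) (by
        change e (e.symm (a, b)) ∈ T.graph
        simpa using hab)
  rw [WithLp.prod_inner_apply] at this
  have h3 : (inner ℂ a (e q).1 : ℂ) + inner ℂ b (e q).2 = 0 := this
  rw [h1, h2, inner_neg_right] at h3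
  linear_combination -h3

theorem inner_of_adjoint {T : E →ₗ.[ℂ] E} (hd : Dense (T.domain : Set E)) {f g a b : E}
    (hf : (f, g) ∈ T†.graph) (ha : (a, b) ∈ T.graph) : (inner ℂ b f : ℂ) = inner ℂ a g :=
  (mem_adjoint_graph hd).1 hf a b ha

theorem inner_of_adjoint' {T : E →ₗ.[ℂ] E} (hd : Dense (T.domain : Set E)) {f g a b : E}
    (hf : (f, g) ∈ T†.graph) (ha : (a, b) ∈ T.graph) : (inner ℂ f b : ℂ) = inner ℂ g a :=
  (mem_adjoint_graph' hd).1 hf a b ha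

theorem dense_of_forall_inner {D : Submodule ℂ E} (h : ∀ x, (∀ y ∈ D, (inner ℂ y x : ℂ) = 0) → x = 0) :
    Dense (D : Set E) := by
  rw [Submodule.dense_iff_topologicalClosure_eq_top, Submodule.topologicalClosure_eq_top_iff,
    Submodule.eq_bot_iff]
  intro x hx
  exact h x ((Submodule.mem_orthogonal _ _).1 hx)

theorem inner_adjoint_mul_self {T : E →ₗ.[ℂ] E} (hd : Dense (T.domain : Set E)) {f g k : E}
    (h1 : (f, g) ∈ T.graph) (h2 : (g, k) ∈ T†.graph) :
    (inner ℂ f k : ℂ) = ((‖g‖ ^ 2 : ℝ) : ℂ) := by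
  rw [← inner_of_adjoint hd h2 h1, inner_self_ofReal]

/-- If x is orthogonal to D(T*T), solve f + T*T f = x; pairing with f gives ‖f‖² + ‖T f‖² = 0, so x
= 0. -/
theorem dense_adjoint_mul {T : E →ₗ.[ℂ] E} (hd : Dense (T.domain : Set E)) (hT : T.IsClosed) :
    Dense ((prodOp T† T).domain : Set E) := by
  refine dense_of_forall_inner fun x hx => ?_
  obtain ⟨f, g, hfg, hgk⟩ := exists_one_add_adjoint_mul hd hT x
  have h1 := hx f (mem_domain_iff_graph.2 ⟨_, mem_prodOp_graph.2 ⟨g, hfg, hgk⟩⟩)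
  have h2 := inner_adjoint_mul_self hd hfg hgk
  rw [inner_sub_right, h1, inner_self_ofReal] at h2
  have h3 : ‖f‖ ^ 2 + ‖g‖ ^ 2 = 0 := by
    have : ((‖f‖ ^ 2 + ‖g‖ ^ 2 : ℝ) : ℂ) = 0 := by
      push_cast at h2 ⊢
      linear_combination -h2
    exact_mod_cast this
  have hf : f = 0 := by rw [← norm_eq_zero]; nlinarith [sq_nonneg ‖f‖, sq_nonneg ‖g‖]
  have hg : g = 0 := by rw [← norm_eq_zero]; nlinarith [sq_nonneg ‖f‖, sq_nonneg ‖g‖]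
  subst hf hg
  have := (T†).graph_fst_eq_zero_snd hgk rfl
  simpa using this

theorem isPositiveOp_adjoint_mul {T : E →ₗ.[ℂ] E} (hd : Dense (T.domain : Set E)) :
    IsPositiveOp (prodOp T† T) := by
  rw [isPositiveOp_iff]
  intro f k hfk
  obtain ⟨g, h1, h2⟩ := mem_prodOp_graph.1 hfk
  rw [inner_adjoint_mul_self hd h1 h2]
  refine ⟨Complex.ofReal_im _, ?_⟩
  rw [Complex.ofReal_re]
  positivity

/-- A densely defined symmetric operator `A` with `1 + A` onto is self-adjoint. -/
theorem isSelfAdjoint_of_surjective {A : E →ₗ.[ℂ] E} (hd : Dense (A.domain : Set E))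
    (hsymm : ∀ a b c d, (a, b) ∈ A.graph → (c, d) ∈ A.graph → (inner ℂ b c : ℂ) = inner ℂ a d)
    (hsurj : ∀ h, ∃ f g, (f, g) ∈ A.graph ∧ f + g = h) : IsSelfAdjoint A := by
  rw [LinearPMap.isSelfAdjoint_def]
  refine ext_of_graph fun f g => ⟨fun hfg => ?_, fun hfg => ?_⟩
  · obtain ⟨a, b, hab, heq⟩ := hsurj (f + g)
    have hab' : (a, b) ∈ A†.graph :=
      (mem_adjoint_graph hd).2 fun c d hcd => hsymm c d a b hcd hab
    have hk := (A†).graph.sub_mem hfg hab'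
    obtain ⟨c, d, hcd, hcd'⟩ := hsurj (f - a)
    have e1 : (inner ℂ d (f - a) : ℂ) = inner ℂ c (g - b) := inner_of_adjoint hd hk hcd
    have e2 : g - b = -(f - a) := by
      have : f + g - (a + b) = 0 := by rw [heq, sub_self]
      rw [eq_neg_iff_add_eq_zero, ← this]; abel
    have e3 : (inner ℂ (f - a) (f - a) : ℂ) = 0 := by
      nth_rw 1 [← hcd']
      rw [inner_add_left, e1, e2, inner_neg_right]; ring
    have e4 : f - a = 0 := inner_self_eq_zero.1 e3
    rw [e4, neg_zero] at e2
    rw [sub_eq_zero.1 e4, sub_eq_zero.1 e2]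
    exact hab
  · exact (mem_adjoint_graph hd).2 fun c d hcd => hsymm c d f g hcd hfg

theorem isSelfAdjoint_adjoint_mul {T : E →ₗ.[ℂ] E} (hd : Dense (T.domain : Set E))
    (hT : T.IsClosed) : IsSelfAdjoint (prodOp T† T) := by
  refine isSelfAdjoint_of_surjective (dense_adjoint_mul hd hT) ?_ ?_
  · intro a b c d hab hcd
    obtain ⟨p, hp1, hp2⟩ := mem_prodOp_graph.1 hab
    obtain ⟨q, hq1, hq2⟩ := mem_prodOp_graph.1 hcd
    rw [← inner_of_adjoint hd hq2 hp1, inner_of_adjoint' hd hp2 hq1]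
  · intro h
    obtain ⟨f, g, hfg, hgk⟩ := exists_one_add_adjoint_mul hd hT h
    exact ⟨f, h - f, mem_prodOp_graph.2 ⟨g, hfg, hgk⟩, by abel⟩

theorem IsSelfAdjoint.mem_graph_iff {A : E →ₗ.[ℂ] E} (hA : IsSelfAdjoint A) {f g : E} :
    (f, g) ∈ A.graph ↔ ∀ a b, (a, b) ∈ A.graph → (inner ℂ b f : ℂ) = inner ℂ a g := by
  conv_lhs => rw [← LinearPMap.isSelfAdjoint_def.1 hA]
  exact mem_adjoint_graph hA.dense_domain

theorem eq_of_le_of_isSelfAdjoint {A B : E →ₗ.[ℂ] E} (hA : IsSelfAdjoint A)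
    (hB : IsSelfAdjoint B) (h : A ≤ B) : A = B := by
  refine le_antisymm h (le_of_graph fun f g hfg => ?_)
  rw [IsSelfAdjoint.mem_graph_iff hA]
  exact fun a b hab => (IsSelfAdjoint.mem_graph_iff hB).1 hfg a b (graph_of_le h hab)

/-- The domain of `T* T` is a core of `T`. -/
theorem graph_le_closure_adjoint_mul {T : E →ₗ.[ℂ] E} (hd : Dense (T.domain : Set E))
    (hT : T.IsClosed) :
    T.graph ≤ (T.domRestrict (prodOp T† T).domain).graph.topologicalClosure := by
  refine mem_closure_of_orthogonal (LinearPMap.le_graph_of_le LinearPMap.domRestrict_le) hT ?_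
  intro f g hfg horth
  have hf : f = 0 := by
    -- With a + T*T a = f, the graph inner product of a and f equals ‖f‖².
    obtain ⟨a, b, hab, hbk⟩ := exists_one_add_adjoint_mul hd hT f
    have h1 := horth a b (mem_domRestrict_graph.2
      ⟨mem_domain_iff_graph.2 ⟨_, mem_prodOp_graph.2 ⟨b, hab, hbk⟩⟩, hab⟩)
    rw [inner_of_adjoint' hd hbk hfg, ← inner_add_left, add_sub_cancel] at h1
    exact inner_self_eq_zero.1 h1
  subst hf
  exact ⟨rfl, T.graph_fst_eq_zero_snd hfg rfl⟩

/-- Closed densely defined operators with the same modulus have the same domain and norms. -/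
theorem exists_graph_of_adjoint_mul_eq {T S : E →ₗ.[ℂ] E} (hdT : Dense (T.domain : Set E))
    (hT : T.IsClosed) (hdS : Dense (S.domain : Set E)) (hS : S.IsClosed)
    (h : prodOp T† T = prodOp S† S) {f g : E} (hfg : (f, g) ∈ T.graph) :
    ∃ g', (f, g') ∈ S.graph ∧ ‖g'‖ = ‖g‖ := by
  -- On the common domain of A*A and B*B both squared norms equal the inner product of f with A*A f.
  -- That domain is a core of A, so the bound extends to D(A) by closure. The statement follows by
  -- using this in both directions.
  have key : ∀ {A B : E →ₗ.[ℂ] E}, Dense (A.domain : Set E) → A.IsClosed →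
      Dense (B.domain : Set E) → B.IsClosed → prodOp A† A = prodOp B† B → ∀ {f g : E},
      (f, g) ∈ A.graph → ∃ g', (f, g') ∈ B.graph ∧ ‖g'‖ ≤ 1 * ‖g‖ := by
    intro A B hdA hA hdB hB hAB f g hfg
    have hex : ∀ a b, (a, b) ∈ (A.domRestrict (prodOp A† A).domain).graph →
        ∃ b', (a, b') ∈ B.graph := by
      intro a b hab
      obtain ⟨hD, -⟩ := mem_domRestrict_graph.1 hab
      obtain ⟨k, hk⟩ := mem_domain_iff_graph.1 hD
      rw [hAB] at hk
      obtain ⟨b', hb', -⟩ := mem_prodOp_graph.1 hk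
      exact ⟨b', hb'⟩
    have hle : ∀ a b b', (a, b) ∈ (A.domRestrict (prodOp A† A).domain).graph →
        (a, b') ∈ B.graph → ‖b'‖ ≤ 1 * ‖b‖ := by
      intro a b b' hab hab'
      obtain ⟨hD, hab⟩ := mem_domRestrict_graph.1 hab
      obtain ⟨k, hk⟩ := mem_domain_iff_graph.1 hD
      have hk' := hk
      rw [hAB] at hk'
      obtain ⟨c, hc, hck⟩ := mem_prodOp_graph.1 hk
      obtain ⟨c', hc', hck'⟩ := mem_prodOp_graph.1 hk'
      have e1 : b = c := LinearPMap.mem_graph_snd_inj _ hab hc rfl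
      have e2 : b' = c' := LinearPMap.mem_graph_snd_inj _ hab' hc' rfl
      subst e1 e2
      have e3 := inner_adjoint_mul_self hdA hc hck
      rw [inner_adjoint_mul_self hdB hc' hck'] at e3
      have e4 : ‖b'‖ ^ 2 = ‖b‖ ^ 2 := by exact_mod_cast e3
      rw [one_mul]
      exact (sq_le_sq₀ (norm_nonneg _) (norm_nonneg _)).1 e4.le
    obtain ⟨g', h1, h2⟩ := exists_mem_closure_of_bound hex hle (graph_le_closure_adjoint_mul hdA hA hfg)
    have h1' : (f, g') ∈ _root_.closure (B.graph : Set (E × E)) := h1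
    rw [IsClosed.closure_eq hB] at h1'
    exact ⟨g', h1', h2⟩
  obtain ⟨g', h1, h2⟩ := key hdT hT hdS hS h hfg
  obtain ⟨g'', h3, h4⟩ := key hdS hS hdT hT h.symm h1
  have := LinearPMap.mem_graph_snd_inj _ h3 hfg rfl
  simp only [one_mul] at h2 h4
  exact ⟨g', h1, le_antisymm h2 (this ▸ h4)⟩

end Abstract

/-! ### Resolvents, square roots and form order -/

section AbstractForms

open LinearPMap Filter

variable {E : Type*} [NormedAddCommGroup E] [InnerProductSpace ℂ E] [CompleteSpace E]

/-- The bound at z makes A - z injective with closed range; the bound at the conjugate of z kills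
the orthogonal complement of the range, which is the kernel of A minus that conjugate. -/
theorem inResolventSet_of_bound {A : E →ₗ.[ℂ] E} (hA : IsSelfAdjoint A) {z : ℂ} {d : ℝ}
    (hd : 0 < d) (h1 : ∀ f g, (f, g) ∈ A.graph → d * ‖f‖ ≤ ‖g - z • f‖)
    (h2 : ∀ f g, (f, g) ∈ A.graph → d * ‖f‖ ≤ ‖g - (starRingEnd ℂ z) • f‖) :
    InResolventSet A z := by
  have hcl : _root_.IsClosed (A.graph : Set (E × E)) := _root_.IsSelfAdjoint.isClosed hA
  have : CompleteSpace A.graph := hcl.completeSpace_coe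
  -- On the closed graph, a Banach space, A - z becomes a bounded map, so the open mapping theorem
  -- supplies the bounded inverse.
  let L₀ : E × E →L[ℂ] E := ContinuousLinearMap.snd ℂ E E - z • ContinuousLinearMap.fst ℂ E E
  let L : A.graph →L[ℂ] E := L₀.comp A.graph.subtypeL
  have hL : ∀ p : A.graph, L p = p.1.2 - z • p.1.1 := fun p => rfl
  have hb : ∀ p : A.graph, ‖p‖ ≤ (1 + (1 + ‖z‖) / d) * ‖L p‖ := by
    rintro ⟨⟨f, g⟩, hp⟩
    have e1 := h1 f g hp
    rw [hL]
    change max ‖f‖ ‖g‖ ≤ (1 + (1 + ‖z‖) / d) * ‖g - z • f‖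
    have e2 : ‖f‖ ≤ ‖g - z • f‖ / d := by rw [le_div_iff₀ hd, mul_comm]; exact e1
    have e3 : ‖g‖ ≤ ‖g - z • f‖ + ‖z‖ * ‖f‖ := by
      calc ‖g‖ = ‖(g - z • f) + z • f‖ := by rw [sub_add_cancel]
        _ ≤ _ := (norm_add_le _ _).trans (by rw [norm_smul])
    have e4 : ‖z‖ * ‖f‖ ≤ ‖z‖ * (‖g - z • f‖ / d) := by gcongr
    have e5 : (1 + (1 + ‖z‖) / d) * ‖g - z • f‖
        = ‖g - z • f‖ + ‖g - z • f‖ / d + ‖z‖ * (‖g - z • f‖ / d) := by ring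
    have e6 : 0 ≤ ‖g - z • f‖ / d := by positivity
    have e7 : 0 ≤ ‖z‖ * (‖g - z • f‖ / d) := by positivity
    rw [e5]
    exact max_le (by linarith [norm_nonneg (g - z • f)]) (by linarith)
  have hinj : LinearMap.ker L.toLinearMap = ⊥ := by
    rw [LinearMap.ker_eq_bot']
    intro p hp
    have := hb p
    rw [show L p = 0 from hp, norm_zero, mul_zero] at this
    exact norm_le_zero_iff.1 this
  have hcr : _root_.IsClosed (LinearMap.range L.toLinearMap : Set E) := by
    have hal : AntilipschitzWith (Real.toNNReal (1 + (1 + ‖z‖) / d)) L := by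
      refine AddMonoidHomClass.antilipschitz_of_bound L fun p => ?_
      rw [Real.coe_toNNReal _ (by positivity)]
      exact hb p
    exact hal.isClosed_range L.uniformContinuous
  have hsurj : LinearMap.range L.toLinearMap = ⊤ := by
    rw [← hcr.submodule_topologicalClosure_eq, Submodule.topologicalClosure_eq_top_iff,
      Submodule.eq_bot_iff]
    intro x hx
    have hx' : (x, (starRingEnd ℂ z) • x) ∈ A.graph := by
      rw [IsSelfAdjoint.mem_graph_iff hA]
      intro a b hab
      have := (Submodule.mem_orthogonal _ _).1 hx (b - z • a) ⟨⟨(a, b), hab⟩, rfl⟩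
      rw [inner_sub_left, inner_smul_left, sub_eq_zero] at this
      rw [this, inner_smul_right]
    have := h2 _ _ hx'
    rw [sub_self, norm_zero] at this
    exact norm_le_zero_iff.1 (by nlinarith [norm_nonneg x])
  let e := ContinuousLinearEquiv.ofBijective L hinj hsurj
  have he : ∀ p, e p = L p := fun p => rfl
  refine ⟨(ContinuousLinearMap.fst ℂ E E).comp (A.graph.subtypeL.comp e.symm.toContinuousLinearMap),
    fun f => ?_, fun g => ?_⟩
  · have : A f - z • (f : E) = e ⟨(f, A f), A.mem_graph f⟩ := rfl
    rw [this]
    change ((e.symm (e _)).1).1 = _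
    rw [ContinuousLinearEquiv.symm_apply_apply]
  · change ∃ h : ((e.symm g).1).1 ∈ A.domain, A ⟨((e.symm g).1).1, h⟩ - z • ((e.symm g).1).1 = g
    obtain ⟨y, hy1, hy2⟩ := (LinearPMap.mem_graph_iff _).1 (e.symm g).2
    refine ⟨hy1 ▸ y.2, ?_⟩
    have : (⟨((e.symm g).1).1, hy1 ▸ y.2⟩ : A.domain) = y := Subtype.ext hy1.symm
    rw [this, hy2]
    have : L (e.symm g) = g := e.apply_symm_apply g
    exact this

/-- The numerical range lies in [0,∞). If z stays at distance at least d from this half-line,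
pairing (A - z) f with f bounds ‖(A - z) f‖ below by d ‖f‖; d is -Re z for z negative and |Im z| for
z not real. -/
theorem inResolventSet_of_not_nonneg {A : E →ₗ.[ℂ] E} (hA : IsSelfAdjoint A)
    (hp : IsPositiveOp A) {z : ℂ} (hz : ¬ ∃ t : ℝ, 0 ≤ t ∧ z = t) : InResolventSet A z := by
  rw [isPositiveOp_iff] at hp
  have key : ∀ d : ℝ, 0 < d → ∀ w : ℂ, (∀ t : ℝ, 0 ≤ t → ∀ s : ℝ, 0 ≤ s → d * s ≤ ‖(t : ℂ) - w * s‖) →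
      ∀ f g, (f, g) ∈ A.graph → d * ‖f‖ ≤ ‖g - w • f‖ := by
    intro d hd w hw f g hfg
    obtain ⟨h1, h2⟩ := hp f g hfg
    have h3 : (inner ℂ f (g - w • f) : ℂ) = ((inner ℂ f g : ℂ).re : ℂ) - w * ((‖f‖ ^ 2 : ℝ) : ℂ) := by
      rw [inner_sub_right, inner_smul_right, inner_self_ofReal]
      congr 1
      apply Complex.ext
      · simp
      · simpa using h1
    have h4 := hw _ h2 (‖f‖ ^ 2) (by positivity)
    rw [← h3] at h4
    have h5 := h4.trans (norm_inner_le_norm f (g - w • f))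
    rcases (norm_nonneg f).eq_or_lt with h0 | h0
    · rw [← h0]; simp
    · have : ‖f‖ * (d * ‖f‖) ≤ ‖f‖ * ‖g - w • f‖ := by nlinarith
      exact le_of_mul_le_mul_left this h0
  by_cases him : z.im = 0
  · have hre : z.re < 0 := by
      by_contra hcon
      exact hz ⟨z.re, not_lt.1 hcon, Complex.ext (by simp) (by simp [him])⟩
    have hzr : z = (z.re : ℂ) := Complex.ext (by simp) (by simp [him])
    have hb : ∀ w : ℂ, w = (z.re : ℂ) → ∀ t : ℝ, 0 ≤ t → ∀ s : ℝ, 0 ≤ s →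
        (-z.re) * s ≤ ‖(t : ℂ) - w * s‖ := by
      intro w hw t ht s hs
      refine le_trans ?_ (Complex.re_le_norm _)
      rw [hw]
      simp only [Complex.sub_re, Complex.ofReal_re, Complex.mul_re, Complex.ofReal_im]
      linarith
    exact inResolventSet_of_bound hA (d := -z.re) (by linarith) (key _ (by linarith) _ (hb _ hzr))
      (key _ (by linarith) _ (hb _ (by rw [Complex.conj_eq_iff_im.2 him]; exact hzr)))
  · have hb : ∀ w : ℂ, |w.im| = |z.im| → ∀ t : ℝ, 0 ≤ t → ∀ s : ℝ, 0 ≤ s →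
        |z.im| * s ≤ ‖(t : ℂ) - w * s‖ := by
      intro w hw t ht s hs
      refine le_trans ?_ (Complex.abs_im_le_norm _)
      simp only [Complex.sub_im, Complex.ofReal_re, Complex.mul_im, Complex.ofReal_im]
      rw [← hw, show 0 - (w.re * 0 + w.im * s) = -(w.im * s) by ring, abs_neg, abs_mul,
        abs_of_nonneg hs]
    have h0 : 0 < |z.im| := abs_pos.2 him
    exact inResolventSet_of_bound hA h0 (key _ h0 _ (hb _ rfl))
      (key _ h0 _ (hb _ (by simp)))

/-- The resolvent at -1 is the bounded operator through which the continuous functional calculus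
reaches A. -/
theorem exists_one_add_of_positive {A : E →ₗ.[ℂ] E} (hA : IsSelfAdjoint A)
    (hp : IsPositiveOp A) : ∃ R : E →L[ℂ] E, (∀ f g, (f, g) ∈ A.graph → R (f + g) = f) ∧
      ∀ h, (R h, h - R h) ∈ A.graph := by
  obtain ⟨R, h1, h2⟩ := inResolventSet_of_not_nonneg hA hp (z := -1) (by
    rintro ⟨t, ht, h⟩
    have := congrArg Complex.re h
    simp at this
    linarith)
  refine ⟨R, fun f g hfg => ?_, fun h => ?_⟩
  · obtain ⟨x, rfl, rfl⟩ := (LinearPMap.mem_graph_iff _).1 hfg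
    have := h1 x
    rwa [neg_one_smul, sub_neg_eq_add, add_comm] at this
  · obtain ⟨h3, h4⟩ := h2 h
    have h5 : A ⟨R h, h3⟩ = h - R h := by
      rw [neg_one_smul, sub_neg_eq_add] at h4
      exact eq_sub_of_add_eq h4
    rw [← h5]
    exact A.mem_graph ⟨R h, h3⟩

/-- A bounded operator `0 ≤ R ≤ 1` has commuting positive roots of `R` and `1 - R`. -/
theorem exists_sqrt_pair {R : E →L[ℂ] E} (h0 : 0 ≤ R) (h1 : R ≤ 1) :
    ∃ B C : E →L[ℂ] E, IsSelfAdjoint B ∧ IsSelfAdjoint C ∧ B * B = R ∧ C * C = 1 - R ∧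
      B * C = C * B ∧ 0 ≤ B * C := by
  have hR : IsSelfAdjoint R := IsSelfAdjoint.of_nonneg h0
  have hs0 : ∀ x ∈ spectrum ℝ R, 0 ≤ x := fun x hx => spectrum_nonneg_of_nonneg h0 hx
  have hs1 : ∀ x ∈ spectrum ℝ R, x ≤ 1 := by
    have : R ≤ algebraMap ℝ (E →L[ℂ] E) 1 := by simpa using h1
    exact (le_algebraMap_iff_spectrum_le).1 this
  have c1 : ContinuousOn (fun x : ℝ => √x) (spectrum ℝ R) := by fun_prop
  have c2 : ContinuousOn (fun x : ℝ => √(1 - x)) (spectrum ℝ R) := by fun_prop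
  refine ⟨cfc (fun x : ℝ => √x) R, cfc (fun x : ℝ => √(1 - x)) R, cfc_predicate _ _,
    cfc_predicate _ _, ?_, ?_, ?_, ?_⟩
  · rw [← cfc_mul _ _ R c1 c1]
    conv_rhs => rw [← cfc_id ℝ R]
    exact cfc_congr fun x hx => Real.mul_self_sqrt (hs0 x hx)
  · rw [← cfc_mul _ _ R c2 c2]
    have : (1 : E →L[ℂ] E) - R = cfc (fun x : ℝ => 1 - x) R := by
      rw [cfc_sub (fun _ => (1 : ℝ)) (fun x => x) R]
      rw [cfc_const_one ℝ R, cfc_id' ℝ R]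
    rw [this]
    exact cfc_congr fun x hx => Real.mul_self_sqrt (by linarith [hs1 x hx])
  · exact cfc_commute_cfc _ _ _
  · rw [← cfc_mul _ _ R c1 c2]
    exact cfc_nonneg fun x _ => by positivity

/-- With R = (1 + H)⁻¹ the root should be (1 - R)^{1/2} R^{-1/2}. To avoid inverting, its graph is
defined as all pairs (B k, C k) with B = √R and C = √(1 - R). Positivity of the root is that of B C,
and self-adjointness rests on B² + C² = 1. -/
theorem exists_isPosSqrt {H : E →ₗ.[ℂ] E} (hH : IsSelfAdjoint H) (hp : IsPositiveOp H) :
    ∃ S, IsPosSqrt S H := by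
  obtain ⟨R, hR1, hR2⟩ := exists_one_add_of_positive hH hp
  rw [isPositiveOp_iff] at hp
  have hsym : ∀ x y, (inner ℂ (R x) y : ℂ) = inner ℂ x (R y) := by
    intro x y
    have := (IsSelfAdjoint.mem_graph_iff hH).1 (hR2 y) _ _ (hR2 x)
    rw [inner_sub_left, inner_sub_right] at this
    linear_combination -this
  have hRsa : IsSelfAdjoint R := by
    rw [ContinuousLinearMap.isSelfAdjoint_iff_isSymmetric]
    exact hsym
  have hre : ∀ x, (inner ℂ (R x) x : ℂ).re = ‖R x‖ ^ 2 + (inner ℂ (R x) (x - R x) : ℂ).re := by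
    intro x
    rw [inner_sub_right, inner_self_ofReal, Complex.sub_re, Complex.ofReal_re]; ring
  have h0 : 0 ≤ R := by
    rw [ContinuousLinearMap.nonneg_iff_isPositive, ContinuousLinearMap.isPositive_def']
    refine ⟨hRsa, fun x => ?_⟩
    rw [ContinuousLinearMap.reApplyInnerSelf_apply]
    change 0 ≤ (inner ℂ (R x) x : ℂ).re
    rw [hre]
    have := (hp _ _ (hR2 x)).2
    positivity
  have h1 : R ≤ 1 := by
    rw [ContinuousLinearMap.le_def, ContinuousLinearMap.isPositive_def']
    refine ⟨(IsSelfAdjoint.one _).sub hRsa, fun x => ?_⟩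
    rw [ContinuousLinearMap.reApplyInnerSelf_apply]
    change 0 ≤ (inner ℂ (x - R x) x : ℂ).re
    have e1 : (inner ℂ (x - R x) x : ℂ).re
        = ‖x - R x‖ ^ 2 + (inner ℂ (x - R x) (R x) : ℂ).re := by
      have : (inner ℂ (x - R x) x : ℂ) = inner ℂ (x - R x) ((x - R x) + R x) := by
        rw [sub_add_cancel]
      rw [this, inner_add_right, inner_self_ofReal, Complex.add_re, Complex.ofReal_re]
    have e2 := (hp _ _ (hR2 x)).2
    rw [← inner_conj_symm, Complex.conj_re] at e2
    rw [e1]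
    positivity
  obtain ⟨B, C, hB, hC, hBB, hCC, hBC, hpos⟩ := exists_sqrt_pair h0 h1
  have aBB : ∀ x, B (B x) = R x := fun x => by rw [← hBB]; rfl
  have aCC : ∀ x, C (C x) = x - R x := fun x => by
    have := congrArg (fun T : E →L[ℂ] E => T x) hCC
    exact this
  have aBC : ∀ x, B (C x) = C (B x) := fun x => congrArg (fun T : E →L[ℂ] E => T x) hBC
  have sB : ∀ x y, (inner ℂ (B x) y : ℂ) = inner ℂ x (B y) :=
    (ContinuousLinearMap.isSelfAdjoint_iff_isSymmetric.1 hB)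
  have sC : ∀ x y, (inner ℂ (C x) y : ℂ) = inner ℂ x (C y) :=
    (ContinuousLinearMap.isSelfAdjoint_iff_isSymmetric.1 hC)
  have hRinj : ∀ x, R x = 0 → x = 0 := by
    intro x hx
    have := hR2 x
    rw [hx, sub_zero] at this
    exact H.graph_fst_eq_zero_snd this rfl
  have hBinj : ∀ x, B x = 0 → x = 0 := fun x hx => hRinj x (by rw [← aBB, hx, _root_.map_zero])
  let G : Submodule ℂ (E × E) := LinearMap.range ((B : E →ₗ[ℂ] E).prod (C : E →ₗ[ℂ] E))
  have hG : ∀ f g, (f, g) ∈ G ↔ ∃ k, f = B k ∧ g = C k := by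
    intro f g
    constructor
    · rintro ⟨k, hk⟩
      exact ⟨k, (congrArg Prod.fst hk).symm, (congrArg Prod.snd hk).symm⟩
    · rintro ⟨k, rfl, rfl⟩
      exact ⟨k, rfl⟩
  have hgr : G.toLinearPMap.graph = G := by
    refine Submodule.toLinearPMap_graph_eq _ ?_
    rintro ⟨f, g⟩ hfg (hf : f = 0)
    obtain ⟨k, h1, h2⟩ := (hG f g).1 hfg
    change g = 0
    rw [h2, hBinj k (by rw [← h1, hf]), _root_.map_zero]
  let S := G.toLinearPMap
  have hS : ∀ f g, (f, g) ∈ S.graph ↔ ∃ k, f = B k ∧ g = C k := by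
    intro f g; rw [← hG]; change _ ∈ G.toLinearPMap.graph ↔ _; rw [hgr]
  have hd : Dense (S.domain : Set E) := by
    refine dense_of_forall_inner fun x hx => hBinj x ?_
    have := hx (B (B x)) (mem_domain_iff_graph.2 ⟨_, (hS _ _).2 ⟨B x, rfl, rfl⟩⟩)
    rw [sB] at this
    exact inner_self_eq_zero.1 this
  have hSsa : IsSelfAdjoint S := by
    rw [LinearPMap.isSelfAdjoint_def]
    refine ext_of_graph fun f g => ?_
    rw [mem_adjoint_graph hd, hS]
    constructor
    · intro h
      have h1 : C f = B g := by
        refine ext_inner_left ℂ fun x => ?_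
        rw [← sC, ← sB]
        exact h _ _ ((hS _ _).2 ⟨x, rfl, rfl⟩)
      -- If f = B k and g = C k, then k = (B² + C²) k = B f + C g; this dictates the witness.
      refine ⟨B f + C g, ?_, ?_⟩
      · rw [_root_.map_add, aBB, aBC, ← h1, aCC]; abel
      · rw [_root_.map_add, ← aBC, h1, aBB, aCC]; abel
    · rintro ⟨k, rfl, rfl⟩ a b hab
      obtain ⟨l, rfl, rfl⟩ := (hS _ _).1 hab
      rw [sC, sB, aBC]
  refine ⟨S, hSsa, ?_, ?_⟩
  · rw [isPositiveOp_iff]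
    intro f g hfg
    obtain ⟨k, rfl, rfl⟩ := (hS _ _).1 hfg
    rw [ContinuousLinearMap.nonneg_iff_isPositive] at hpos
    have hsm : (inner ℂ (B k) (C k) : ℂ) = inner ℂ k ((B * C) k) := sB _ _
    have h2 := hpos.inner_nonneg_right k
    rw [← hsm, Complex.nonneg_iff] at h2
    exact ⟨h2.2.symm, h2.1⟩
  · refine ext_of_graph fun f h => ?_
    rw [mem_prodOp_graph]
    constructor
    · rintro ⟨g, h1, h2⟩
      obtain ⟨k, rfl, rfl⟩ := (hS _ _).1 h1
      obtain ⟨l, h3, rfl⟩ := (hS _ _).1 h2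
      -- Here f = B k, S f = C k = B l and S² f = C l; then B (f + S² f) = k, so f = R (f + S² f),
      -- which is what H f = S² f means.
      have e1 : R (B k + C l) = B k := by
        have : B (B k + C l) = k := by
          rw [_root_.map_add, aBB, aBC, ← h3, aCC]; abel
        rw [← aBB, this]
      have e2 := hR2 (B k + C l)
      rw [e1, add_sub_cancel_left] at e2
      exact e2
    · intro hfh
      have e1 := hR1 f h hfh
      refine ⟨C (B (f + h)), (hS _ _).2 ⟨B (f + h), ?_, rfl⟩, (hS _ _).2 ⟨C (f + h), ?_, ?_⟩⟩
      · rw [aBB, e1]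
      · rw [aBC]
      · rw [aCC, e1]; abel

theorem IsPosSqrt.adjoint_mul {S H : E →ₗ.[ℂ] E} (h : IsPosSqrt S H) : prodOp S† S = H := by
  rw [LinearPMap.isSelfAdjoint_def.1 h.1]; exact h.2.2

theorem IsPosSqrt.exists_graph {S T : E →ₗ.[ℂ] E} (hd : Dense (T.domain : Set E))
    (hT : T.IsClosed) (h : IsPosSqrt S (prodOp T† T)) {f g : E} (hfg : (f, g) ∈ T.graph) :
    ∃ g', (f, g') ∈ S.graph ∧ ‖g'‖ = ‖g‖ :=
  exists_graph_of_adjoint_mul_eq hd hT h.1.dense_domain (_root_.IsSelfAdjoint.isClosed h.1)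
    h.adjoint_mul.symm hfg

theorem IsPosSqrt.exists_graph' {S T : E →ₗ.[ℂ] E} (hd : Dense (T.domain : Set E))
    (hT : T.IsClosed) (h : IsPosSqrt S (prodOp T† T)) {f g : E} (hfg : (f, g) ∈ S.graph) :
    ∃ g', (f, g') ∈ T.graph ∧ ‖g'‖ = ‖g‖ :=
  exists_graph_of_adjoint_mul_eq h.1.dense_domain (_root_.IsSelfAdjoint.isClosed h.1) hd hT
    h.adjoint_mul hfg

theorem IsPosSqrt.norm_sq {S H : E →ₗ.[ℂ] E} (h : IsPosSqrt S H) {f k : E}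
    (hfk : (f, k) ∈ H.graph) : ∃ g, (f, g) ∈ S.graph ∧ (g, k) ∈ S.graph ∧
      (inner ℂ f k : ℂ) = ((‖g‖ ^ 2 : ℝ) : ℂ) := by
  rw [← h.2.2] at hfk
  obtain ⟨g, h1, h2⟩ := mem_prodOp_graph.1 hfk
  refine ⟨g, h1, h2, ?_⟩
  have := (IsSelfAdjoint.mem_graph_iff h.1).1 h2 _ _ h1
  rw [← this, inner_self_ofReal]

/-- T and any positive root of T*T have the same modulus, hence the same domain. Since the form
domain quantifies existentially over roots, one inclusion also needs a root to exist. -/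
theorem formDomain_adjoint_mul {T : E →ₗ.[ℂ] E} (hd : Dense (T.domain : Set E))
    (hT : T.IsClosed) : formDomain (prodOp T† T) = (T.domain : Set E) := by
  ext f
  constructor
  · rintro ⟨S, hS, hf⟩
    obtain ⟨g, hg⟩ := mem_domain_iff_graph.1 hf
    obtain ⟨g', hg', -⟩ := hS.exists_graph' hd hT hg
    exact mem_domain_iff_graph.2 ⟨g', hg'⟩
  · intro hf
    obtain ⟨S, hS⟩ := exists_isPosSqrt (isSelfAdjoint_adjoint_mul hd hT) (isPositiveOp_adjoint_mul hd)
    obtain ⟨g, hg⟩ := mem_domain_iff_graph.1 hf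
    obtain ⟨g', hg', -⟩ := hS.exists_graph hd hT hg
    exact ⟨S, hS, mem_domain_iff_graph.2 ⟨g', hg'⟩⟩

/-- The graph norms of T and of the root of T*T coincide, so a core of one is a core of the other.
-/
theorem isDenseInFormDomain_adjoint_mul {T : E →ₗ.[ℂ] E} (hd : Dense (T.domain : Set E))
    (hT : T.IsClosed) {D : Submodule ℂ E} (hD : D ≤ T.domain)
    (hcore : T.graph ≤ (T.domRestrict D).graph.topologicalClosure) :
    IsDenseInFormDomain D (prodOp T† T) := by
  obtain ⟨S, hS⟩ := exists_isPosSqrt (isSelfAdjoint_adjoint_mul hd hT) (isPositiveOp_adjoint_mul hd)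
  have hScl : S.IsClosed := _root_.IsSelfAdjoint.isClosed hS.1
  have hle : D ≤ S.domain := by
    intro f hf
    obtain ⟨g, hg⟩ := mem_domain_iff_graph.1 (hD hf)
    obtain ⟨g', hg', -⟩ := hS.exists_graph hd hT hg
    exact mem_domain_iff_graph.2 ⟨g', hg'⟩
  refine ⟨S, hS, hle, le_antisymm (closure_le_of_le hScl domRestrict_le) ?_⟩
  refine le_of_graph fun f g hfg => ?_
  obtain ⟨g', hg', -⟩ := hS.exists_graph' hd hT hfg
  have hb : ∀ a b b', (a, b) ∈ (T.domRestrict D).graph → (a, b') ∈ (S.domRestrict D).graph →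
      ‖b'‖ ≤ 1 * ‖b‖ := by
    intro a b b' hab hab'
    obtain ⟨b'', hb'', hn⟩ := hS.exists_graph hd hT (mem_domRestrict_graph.1 hab).2
    have := LinearPMap.mem_graph_snd_inj _ hb'' (mem_domRestrict_graph.1 hab').2 rfl
    rw [← this, hn, one_mul]
  have hex : ∀ a b, (a, b) ∈ (T.domRestrict D).graph → ∃ b', (a, b') ∈ (S.domRestrict D).graph := by
    intro a b hab
    obtain ⟨b'', hb'', -⟩ := hS.exists_graph hd hT (mem_domRestrict_graph.1 hab).2
    exact ⟨b'', mem_domRestrict_graph.2 ⟨(mem_domRestrict_graph.1 hab).1, hb''⟩⟩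
  obtain ⟨k, hk, -⟩ := exists_mem_closure_of_bound hex hb (hcore hg')
  rw [← closure_graph_of_le hScl domRestrict_le] at hk
  have hk' := graph_of_le (closure_le_of_le hScl domRestrict_le) hk
  have : k = g := LinearPMap.mem_graph_snd_inj _ hk' hfg rfl
  rwa [← this]

theorem formLE_of_graph {H₁ H₂ S₁ S₂ : E →ₗ.[ℂ] E} (h₁ : IsPosSqrt S₁ H₁) (h₂ : IsPosSqrt S₂ H₂)
    (h : ∀ f g, (f, g) ∈ S₂.graph → ∃ g', (f, g') ∈ S₁.graph ∧ ‖g'‖ ≤ ‖g‖) : FormLE H₁ H₂ := by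
  refine ⟨S₁, S₂, h₁, h₂, fun f => ?_⟩
  obtain ⟨g', hg', hn⟩ := h _ _ (S₂.mem_graph f)
  obtain ⟨y, hy1, hy2⟩ := (LinearPMap.mem_graph_iff _).1 hg'
  have hy1' : (y : E) = f := hy1
  refine ⟨hy1' ▸ y.2, ?_⟩
  have : (⟨f, hy1' ▸ y.2⟩ : S₁.domain) = y := Subtype.ext hy1'.symm
  rw [this, hy2]
  exact hn

/-- If `D ⊆ D(L)` is a core of `T` then `T* T ⊇ L` is the Friedrichs extension of `L`. -/
theorem isFriedrichsExt_adjoint_mul {L T : E →ₗ.[ℂ] E} (hd : Dense (T.domain : Set E))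
    (hT : T.IsClosed) (hL : L ≤ prodOp T† T) {D : Submodule ℂ E} (hD : D ≤ L.domain)
    (hcore : T.graph ≤ (T.domRestrict D).graph.topologicalClosure) :
    IsFriedrichsExt L (prodOp T† T) := by
  have hsa := isSelfAdjoint_adjoint_mul hd hT
  have hpos := isPositiveOp_adjoint_mul hd
  refine ⟨⟨hL, hsa, hpos⟩, ?_⟩
  rintro H ⟨hLH, hH, hHp⟩
  obtain ⟨S₁, hS₁⟩ := exists_isPosSqrt hH hHp
  obtain ⟨S₂, hS₂⟩ := exists_isPosSqrt hsa hpos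
  refine formLE_of_graph hS₁ hS₂ fun f g hfg => ?_
  obtain ⟨g₁, hg₁, hn⟩ := hS₂.exists_graph' hd hT hfg
  -- On D both ‖T a‖² and ‖H^{1/2} a‖² equal the inner product of a with L a, for every positive
  -- self-adjoint extension H. The core property carries this to all of D(T).
  have key : ∀ a b, (a, b) ∈ (T.domRestrict D).graph → ∃ b', (a, b') ∈ S₁.graph ∧ ‖b'‖ = ‖b‖ := by
    intro a b hab
    obtain ⟨haD, hab⟩ := mem_domRestrict_graph.1 hab
    obtain ⟨k, hk⟩ := mem_domain_iff_graph.1 (hD haD)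
    obtain ⟨c, hc, hck⟩ := mem_prodOp_graph.1 (graph_of_le hL hk)
    have hcb : c = b := LinearPMap.mem_graph_snd_inj _ hc hab rfl
    subst hcb
    obtain ⟨b', h1, h2, h3⟩ := hS₁.norm_sq (graph_of_le hLH hk)
    refine ⟨b', h1, ?_⟩
    rw [inner_adjoint_mul_self hd hc hck] at h3
    have e4 : ‖c‖ ^ 2 = ‖b'‖ ^ 2 := by exact_mod_cast h3
    exact ((sq_eq_sq₀ (norm_nonneg _) (norm_nonneg _)).1 e4).symm
  obtain ⟨g', hg', hn'⟩ := exists_mem_closure_of_bound (G' := S₁.graph) (C := 1)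
    (fun a b hab => (key a b hab).imp fun _ h => h.1)
    (fun a b b' hab hab' => by
      obtain ⟨b'', h1, h2⟩ := key a b hab
      rw [LinearPMap.mem_graph_snd_inj _ hab' h1 rfl, h2, one_mul]) (hcore hg₁)
  have hcl : _root_.IsClosed (S₁.graph : Set (E × E)) := _root_.IsSelfAdjoint.isClosed hS₁.1
  rw [hcl.submodule_topologicalClosure_eq] at hg'
  exact ⟨g', hg', by rw [← hn]; simpa using hn'⟩

/-- If `D ⊆ D(L)` and `T D` is a core of `T*` then `T* T ⊇ L` is the Krein extension of `L`. -/
theorem isKreinExt_adjoint_mul {L T : E →ₗ.[ℂ] E} (hd : Dense (T.domain : Set E))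
    (hT : T.IsClosed) (hL : L ≤ prodOp T† T) {D K : Submodule ℂ E} (hD : D ≤ L.domain)
    (hK : ∀ b ∈ K, ∃ a ∈ D, (a, b) ∈ T.graph)
    (hcore : T†.graph ≤ (T†.domRestrict K).graph.topologicalClosure) :
    IsKreinExt L (prodOp T† T) := by
  have hsa := isSelfAdjoint_adjoint_mul hd hT
  have hpos := isPositiveOp_adjoint_mul hd
  refine ⟨⟨hL, hsa, hpos⟩, ?_⟩
  rintro H ⟨hLH, hH, hHp⟩
  obtain ⟨S₁, hS₁⟩ := exists_isPosSqrt hsa hpos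
  obtain ⟨S₂, hS₂⟩ := exists_isPosSqrt hH hHp
  refine formLE_of_graph hS₁ hS₂ fun f g hfg => ?_
  suffices h : ∃ g', (f, g') ∈ T.graph ∧ ‖g'‖ ≤ ‖g‖ by
    obtain ⟨g', h1, h2⟩ := h
    obtain ⟨g'', h3, h4⟩ := hS₁.exists_graph hd hT h1
    exact ⟨g'', h3, h4 ▸ h2⟩
  -- For u = T a with a in D, T* u = L a = H a. Hence the pairing of f with T* u is that of H^{1/2}
  -- f with H^{1/2} a, and ‖H^{1/2} a‖ = ‖u‖. By the core property f then lies in D(T**) = D(T),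
  -- with ‖T f‖ ≤ ‖H^{1/2} f‖.
  have key : ∀ u v, (u, v) ∈ (T†.domRestrict K).graph → ‖(inner ℂ f v : ℂ)‖ ≤ ‖g‖ * ‖u‖ := by
    intro u v huv
    obtain ⟨huK, huv⟩ := mem_domRestrict_graph.1 huv
    obtain ⟨a, haD, hau⟩ := hK u huK
    obtain ⟨k, hk⟩ := mem_domain_iff_graph.1 (hD haD)
    obtain ⟨c, hc, hck⟩ := mem_prodOp_graph.1 (graph_of_le hL hk)
    have hcu : c = u := LinearPMap.mem_graph_snd_inj _ hc hau rfl
    subst hcu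
    have hkv : k = v := LinearPMap.mem_graph_snd_inj _ hck huv rfl
    subst hkv
    obtain ⟨b', h1, h2, h3⟩ := hS₂.norm_sq (graph_of_le hLH hk)
    rw [inner_adjoint_mul_self hd hc hck] at h3
    have e4 : ‖c‖ ^ 2 = ‖b'‖ ^ 2 := by exact_mod_cast h3
    have e5 := (sq_eq_sq₀ (norm_nonneg _) (norm_nonneg _)).1 e4
    rw [e5, ← (IsSelfAdjoint.mem_graph_iff hS₂.1).1 h2 _ _ hfg]
    exact norm_inner_le_norm _ _
  have key2 : ∀ u v, (u, v) ∈ T†.graph → ‖(inner ℂ f v : ℂ)‖ ≤ ‖g‖ * ‖u‖ := by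
    intro u v huv
    have h1 : (u, v) ∈ _root_.closure ((T†.domRestrict K).graph : Set (E × E)) := hcore huv
    have hcl : _root_.IsClosed {p : E × E | ‖(inner ℂ f p.2 : ℂ)‖ ≤ ‖g‖ * ‖p.1‖} :=
      isClosed_le (by fun_prop) (by fun_prop)
    exact closure_minimal (fun p hp => key p.1 p.2 hp) hcl h1
  -- extend `u ↦ ⟪f, T* u⟫` to a bounded functional and represent it
  let M : Submodule ℂ E := T†.domain
  let ℓ₀ : M →ₗ[ℂ] ℂ := (innerₛₗ ℂ f).comp T†.toFun
  let ℓ : StrongDual ℂ M := ℓ₀.mkContinuous ‖g‖ fun u => key2 _ _ (T†.mem_graph u)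
  obtain ⟨ℓ', hℓ', hn⟩ := exists_extension_norm_eq M ℓ
  let w := (InnerProductSpace.toDual ℂ E).symm ℓ'
  have hw : ∀ x, (inner ℂ w x : ℂ) = ℓ' x := fun x => InnerProductSpace.toDual_symm_apply
  refine ⟨w, mem_graph_of_adjoint hd hT fun a b hab => ?_, ?_⟩
  · obtain ⟨x, rfl, rfl⟩ := (LinearPMap.mem_graph_iff _).1 hab
    have h1 : ℓ' (x : E) = inner ℂ f (T† x) := hℓ' x
    rw [← hw] at h1
    rw [← inner_conj_symm, ← h1, inner_conj_symm]
  · have : ‖w‖ = ‖ℓ'‖ := LinearIsometryEquiv.norm_map _ _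
    rw [this, hn]
    exact LinearMap.mkContinuous_norm_le _ (norm_nonneg _) _

end AbstractForms

/-! ### Locally absolutely continuous functions on the half-line -/

section Primitives

open Filter intervalIntegral

/-- Increments are dominated by those of the primitive of ‖p‖, which is absolutely continuous. -/
theorem absolutelyContinuousOnInterval_integral {p : ℝ → ℂ} {a b : ℝ}
    (h : IntervalIntegrable p volume a b) :
    AbsolutelyContinuousOnInterval (fun x => ∫ t in a..x, p t) a b := by
  have hN := h.norm.absolutelyContinuousOnInterval_intervalIntegral (c := a) left_mem_uIcc
  rw [absolutelyContinuousOnInterval_iff] at hN ⊢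
  intro ε hε
  obtain ⟨δ, hδ, hd⟩ := hN ε hε
  refine ⟨δ, hδ, fun E hE hs => lt_of_le_of_lt (Finset.sum_le_sum fun i hi => ?_) (hd E hE hs)⟩
  have hm := hE.1 i hi
  have sub : ∀ x ∈ uIcc a b, IntervalIntegrable p volume a x := fun x hx =>
    h.mono_set (uIcc_subset_uIcc left_mem_uIcc hx)
  have i1 := sub _ hm.1
  have i2 := sub _ hm.2
  rw [dist_eq_norm, dist_eq_norm, integral_interval_sub_left i1 i2,
    integral_interval_sub_left i1.norm i2.norm]
  exact norm_integral_le_abs_integral_norm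

/-- `F` is locally absolutely continuous on `(0,∞)` with almost everywhere derivative `p`. -/
structure IsPrim (F p : ℝ → ℂ) : Prop where
  intervalIntegrable : ∀ {a b : ℝ}, 0 < a → 0 < b → IntervalIntegrable p volume a b
  sub_eq : ∀ {a b : ℝ}, 0 < a → 0 < b → F b - F a = ∫ x in a..b, p x

theorem pos_of_mem_uIcc {a b x : ℝ} (ha : 0 < a) (hb : 0 < b) (hx : x ∈ uIcc a b) : 0 < x :=
  lt_of_lt_of_le (lt_min ha hb) hx.1

theorem IsPrim.eq_add {F p : ℝ → ℂ} (h : IsPrim F p) {a b : ℝ} (ha : 0 < a) (hb : 0 < b) :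
    F b = F a + ∫ x in a..b, p x := by
  rw [← h.sub_eq ha hb]; ring

theorem IsPrim.absolutelyContinuous {F p : ℝ → ℂ} (h : IsPrim F p) {a b : ℝ} (ha : 0 < a)
    (hb : 0 < b) : AbsolutelyContinuousOnInterval F a b := by
  have h1 := absolutelyContinuousOnInterval_integral (h.intervalIntegrable ha hb)
  rw [absolutelyContinuousOnInterval_iff] at h1 ⊢
  intro ε hε
  obtain ⟨δ, hδ, hd⟩ := h1 ε hε
  refine ⟨δ, hδ, fun E hE hs => lt_of_le_of_lt (Finset.sum_le_sum fun i hi => ?_) (hd E hE hs)⟩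
  have hm := hE.1 i hi
  rw [h.eq_add ha (pos_of_mem_uIcc ha hb hm.1), h.eq_add ha (pos_of_mem_uIcc ha hb hm.2),
    dist_add_left]

theorem IsPrim.ae_hasDerivAt {F p : ℝ → ℂ} (h : IsPrim F p) {a b : ℝ} (ha : 0 < a)
    (hb : 0 < b) : ∀ᵐ x, x ∈ uIcc a b → HasDerivAt F (p x) x := by
  filter_upwards [(h.intervalIntegrable ha hb).ae_hasDerivAt_integral] with x hx hxm
  have h1 := (hx hxm a left_mem_uIcc).const_add (F a)
  refine h1.congr_of_eventuallyEq ?_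
  filter_upwards [isOpen_Ioi.mem_nhds (pos_of_mem_uIcc ha hb hxm)] with y hy
  exact h.eq_add ha hy

theorem IsPrim.continuousOn {F p : ℝ → ℂ} (h : IsPrim F p) : ContinuousOn F (Ioi 0) := by
  intro x hx
  have hx' : (0 : ℝ) < x := hx
  have h1 := (h.absolutelyContinuous (a := x / 2) (b := 2 * x) (by linarith) (by linarith)).continuousOn
  refine (h1.continuousAt ?_).continuousWithinAt
  rw [uIcc_of_le (by linarith)]
  exact Icc_mem_nhds (by linarith) (by linarith)

theorem intervalIntegrable_of_continuousOn {p : ℝ → ℂ} (h : ContinuousOn p (Ioi 0)) {a b : ℝ}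
    (ha : 0 < a) (hb : 0 < b) : IntervalIntegrable p volume a b :=
  (h.mono fun _ hx => pos_of_mem_uIcc ha hb hx).intervalIntegrable

/-- The difference between F G and the primitive of the expected derivative is absolutely continuous
with derivative zero almost everywhere, hence constant. -/
theorem IsPrim.mul {F G p q : ℝ → ℂ} (hF : IsPrim F p) (hG : IsPrim G q) :
    IsPrim (fun x => F x * G x) (fun x => p x * G x + F x * q x) := by
  have hint : ∀ {a b : ℝ}, 0 < a → 0 < b →
      IntervalIntegrable (fun x => p x * G x + F x * q x) volume a b := fun {a b} ha hb =>
    ((hF.intervalIntegrable ha hb).mul_continuousOn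
      (hG.continuousOn.mono fun _ hx => pos_of_mem_uIcc ha hb hx)).add
    ((hG.intervalIntegrable ha hb).continuousOn_mul
      (hF.continuousOn.mono fun _ hx => pos_of_mem_uIcc ha hb hx))
  refine ⟨hint, fun {a b} ha hb => ?_⟩
  have hac : AbsolutelyContinuousOnInterval
      (fun x => F x * G x - ∫ t in a..x, (p t * G t + F t * q t)) a b :=
    ((hF.absolutelyContinuous ha hb).fun_smul (hG.absolutelyContinuous ha hb)).sub
      (absolutelyContinuousOnInterval_integral (hint ha hb))
  obtain ⟨C, hC⟩ := hac.const_of_ae_hasDerivAt_zero (by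
    filter_upwards [hF.ae_hasDerivAt ha hb, hG.ae_hasDerivAt ha hb,
      (hint ha hb).ae_hasDerivAt_integral] with x h1 h2 h3 hx
    have := ((h1 hx).mul (h2 hx)).sub (h3 hx a left_mem_uIcc)
    rw [sub_self] at this
    exact this)
  have e1 := hC a left_mem_uIcc
  have e2 := hC b right_mem_uIcc
  rw [integral_same, sub_zero] at e1
  rw [← e1] at e2
  linear_combination e2

theorem isPrim_of_hasDerivAt {F p : ℝ → ℂ} (h : ∀ x, 0 < x → HasDerivAt F (p x) x)
    (hp : ContinuousOn p (Ioi 0)) : IsPrim F p where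
  intervalIntegrable ha hb := intervalIntegrable_of_continuousOn hp ha hb
  sub_eq ha hb := (integral_eq_sub_of_hasDerivAt
    (fun x hx => h x (pos_of_mem_uIcc ha hb hx)) (intervalIntegrable_of_continuousOn hp ha hb)).symm

theorem intervalIntegrable_of_locallyIntegrableOn {p : ℝ → ℂ}
    (hp : LocallyIntegrableOn p (Ioi 0)) {a b : ℝ} (ha : 0 < a) (hb : 0 < b) :
    IntervalIntegrable p volume a b := by
  rw [intervalIntegrable_iff]
  exact (hp.integrableOn_compact_subset (fun _ hx => pos_of_mem_uIcc ha hb hx)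
    isCompact_uIcc).mono_set uIoc_subset_uIcc

theorem isPrim_integral {p : ℝ → ℂ} (hp : LocallyIntegrableOn p (Ioi 0)) :
    IsPrim (fun x => ∫ t in (1 : ℝ)..x, p t) p where
  intervalIntegrable ha hb := intervalIntegrable_of_locallyIntegrableOn hp ha hb
  sub_eq ha hb := integral_interval_sub_left
    (intervalIntegrable_of_locallyIntegrableOn hp one_pos hb)
    (intervalIntegrable_of_locallyIntegrableOn hp one_pos ha)

theorem IsPrim.congr {F p q : ℝ → ℂ} (h : IsPrim F p) (hpq : p =ᵐ[halfLine] q) : IsPrim F q := by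
  have hab : ∀ {a b : ℝ}, 0 < a → 0 < b → ∀ᵐ x, x ∈ uIoc a b → p x = q x := by
    intro a b ha hb
    filter_upwards [(ae_restrict_iff' measurableSet_Ioi).1 hpq] with x hx hxm
    exact hx (pos_of_mem_uIcc ha hb (uIoc_subset_uIcc hxm))
  refine ⟨fun ha hb => (h.intervalIntegrable ha hb).congr_ae ?_, fun ha hb => ?_⟩
  · exact (ae_restrict_iff' measurableSet_uIoc).2 (hab ha hb)
  · rw [h.sub_eq ha hb]
    exact integral_congr_ae (hab ha hb)

theorem IsPrim.const_add {F p : ℝ → ℂ} (h : IsPrim F p) (c : ℂ) : IsPrim (fun x => c + F x) p :=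
  ⟨h.intervalIntegrable, fun ha hb => by rw [← h.sub_eq ha hb]; ring⟩

theorem IsPrim.const_mul {F p : ℝ → ℂ} (h : IsPrim F p) (c : ℂ) :
    IsPrim (fun x => c * F x) (fun x => c * p x) :=
  ⟨fun ha hb => (h.intervalIntegrable ha hb).const_mul c, fun ha hb => by
    rw [intervalIntegral.integral_const_mul, ← h.sub_eq ha hb]; ring⟩

theorem IsPrim.conj {F p : ℝ → ℂ} (h : IsPrim F p) :
    IsPrim (fun x => starRingEnd ℂ (F x)) (fun x => starRingEnd ℂ (p x)) := by
  have hi : ∀ {a b : ℝ}, 0 < a → 0 < b →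
      IntervalIntegrable (fun x => starRingEnd ℂ (p x)) volume a b := fun ha hb =>
    ⟨(Complex.conjCLE : ℂ →L[ℝ] ℂ).integrable_comp (h.intervalIntegrable ha hb).1,
      (Complex.conjCLE : ℂ →L[ℝ] ℂ).integrable_comp (h.intervalIntegrable ha hb).2⟩
  refine ⟨hi, fun ha hb => ?_⟩
  rw [← map_sub, h.sub_eq ha hb]
  simp only [intervalIntegral, map_sub, ← integral_conj]

end Primitives

/-! ### Test functions -/

section TestFunctions

open Filter

theorem Test.exists_bounds (φ : Test) : ∃ a b : ℝ, 0 < a ∧ a < b ∧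
    (∀ x, x ∉ Ioo a b → φ x = 0) ∧ ∀ x, x ∉ Ioo a b → deriv φ x = 0 := by
  rcases (tsupport φ).eq_empty_or_nonempty with he | hne
  · have h0 : ∀ x, φ x = 0 := fun x => image_eq_zero_of_notMem_tsupport (by rw [he]; simp)
    have h1 : (φ : ℝ → ℂ) = fun _ => 0 := funext h0
    exact ⟨1, 2, one_pos, one_lt_two, fun x _ => h0 x, fun x _ => by rw [h1]; simp⟩
  · obtain ⟨a, ha⟩ := (φ.hasCompactSupport : IsCompact _).exists_isLeast hne
    obtain ⟨b, hb⟩ := (φ.hasCompactSupport : IsCompact _).exists_isGreatest hne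
    have ha0 : (0 : ℝ) < a := φ.tsupport_subset ha.1
    have hab : a ≤ b := ha.2 hb.1
    have hs : ∀ x, x ∉ Ioo (a / 2) (b + 1) → x ∉ tsupport φ := fun x hx hxt => hx
      ⟨by have := ha.2 hxt; linarith, by have := hb.2 hxt; linarith⟩
    -- The margins around the support make φ and its derivative vanish at both end points, so
    -- integrations by parts have no boundary terms.
    refine ⟨a / 2, b + 1, by linarith, by linarith,
      fun x hx => image_eq_zero_of_notMem_tsupport (hs x hx),
      fun x hx => image_eq_zero_of_notMem_tsupport fun h => hs x hx (tsupport_deriv_subset h)⟩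

theorem Test.differentiable (φ : Test) : Differentiable ℝ φ :=
  φ.contDiff.differentiable (by simp)

theorem Test.hasDerivAt (φ : Test) (x : ℝ) : HasDerivAt φ (deriv φ x) x :=
  (φ.differentiable x).hasDerivAt

theorem Test.continuous_deriv (φ : Test) : Continuous (deriv φ) := (test_deriv_props φ).2.1.1

theorem Test.isPrim (φ : Test) : IsPrim φ (deriv φ) :=
  isPrim_of_hasDerivAt (fun x _ => φ.hasDerivAt x) φ.continuous_deriv.continuousOn

theorem Test.memLp (φ : Test) : MemLp φ 2 halfLine :=
  (test_deriv_props φ).1.1.memLp_of_hasCompactSupport (test_deriv_props φ).1.2.1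

/-- A test function multiplied by a smooth function on `(0,∞)`. -/
noncomputable def Test.smoothMul (c : ℝ → ℂ) (hc : ContDiffOn ℝ ∞ c (Ioi 0)) (φ : Test) : Test where
  toFun x := c x * φ x
  contDiff' := by
    have h : ContDiffOn ℝ ∞ (fun x => c x * φ x) (Ioi 0) := hc.mul φ.contDiff.contDiffOn
    rw [contDiff_iff_contDiffAt]
    intro x
    by_cases hx : x ∈ tsupport φ
    · exact h.contDiffAt (isOpen_Ioi.mem_nhds (φ.tsupport_subset hx))
    · have : (fun x => c x * φ x) =ᶠ[𝓝 x] fun _ => 0 := by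
        filter_upwards [(isClosed_tsupport φ).isOpen_compl.mem_nhds hx] with y hy
        rw [image_eq_zero_of_notMem_tsupport hy, mul_zero]
      exact contDiffAt_const.congr_of_eventuallyEq this
  hasCompactSupport' := φ.hasCompactSupport.mul_left
  tsupport_subset' := (tsupport_mul_subset_right (f := c) (g := φ)).trans φ.tsupport_subset

/-- The derivative of a test function. -/
noncomputable def Test.derivative (φ : Test) : Test where
  toFun := deriv φ
  contDiff' := (contDiff_infty_iff_deriv.1 φ.contDiff).2
  hasCompactSupport' := φ.hasCompactSupport.deriv
  tsupport_subset' := tsupport_deriv_subset.trans φ.tsupport_subset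

@[simp] theorem Test.derivative_apply (φ : Test) (x : ℝ) : φ.derivative x = deriv φ x := rfl

/-- The complex conjugate of a test function. -/
noncomputable def Test.conj (φ : Test) : Test where
  toFun x := starRingEnd ℂ (φ x)
  contDiff' := Complex.conjCLE.contDiff.comp φ.contDiff
  hasCompactSupport' := φ.hasCompactSupport.comp_left (map_zero _)
  tsupport_subset' := (closure_mono fun x hx => by
    simpa [Function.mem_support] using hx).trans φ.tsupport_subset

@[simp] theorem Test.conj_apply (φ : Test) (x : ℝ) : φ.conj x = starRingEnd ℂ (φ x) := rfl

theorem Test.deriv_conj (φ : Test) (x : ℝ) : deriv φ.conj x = starRingEnd ℂ (deriv φ x) :=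
  (((Complex.conjCLE : ℂ →L[ℝ] ℂ).hasFDerivAt).comp_hasDerivAt x (φ.hasDerivAt x)).deriv

/-- A dilated test function `x ↦ φ (a x)`. -/
noncomputable def Test.dilate (a : ℝ) (ha : 0 < a) (φ : Test) : Test where
  toFun x := φ (a * x)
  contDiff' := φ.contDiff.comp (contDiff_const.mul contDiff_id)
  hasCompactSupport' := φ.hasCompactSupport.comp_homeomorph (Homeomorph.mulLeft₀ a ha.ne')
  tsupport_subset' := by
    have h : tsupport (fun x => φ (a * x)) = (Homeomorph.mulLeft₀ a ha.ne') ⁻¹' tsupport φ :=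
      tsupport_comp_eq_preimage (g := φ) (Homeomorph.mulLeft₀ a ha.ne')
    change tsupport (fun x => φ (a * x)) ⊆ Ioi 0
    rw [h]
    intro x hx
    have : (0 : ℝ) < a * x := φ.tsupport_subset hx
    exact pos_of_mul_pos_right this ha.le

theorem Test.deriv_dilate (a : ℝ) (ha : 0 < a) (φ : Test) (x : ℝ) :
    deriv (φ.dilate a ha) x = a * deriv φ (a * x) := by
  have h1 : HasDerivAt (fun x : ℝ => a * x) a x := by simpa using (hasDerivAt_id x).const_mul a
  have h2 := HasDerivAt.scomp x (φ.hasDerivAt (a * x)) h1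
  rw [Complex.real_smul] at h2
  exact h2.deriv

theorem setIntegral_eq_intervalIntegral {h : ℝ → ℂ} {a b : ℝ} (ha : 0 < a) (hab : a ≤ b)
    (h0 : ∀ x, x ∉ Ioo a b → h x = 0) : ∫ x in Ioi 0, h x = ∫ x in a..b, h x := by
  rw [intervalIntegral.integral_of_le hab]
  refine setIntegral_eq_of_subset_of_forall_sdiff_eq_zero measurableSet_Ioi
    (fun x hx => ha.trans hx.1) fun x hx => h0 x fun hx' => hx.2 ⟨hx'.1, hx'.2.le⟩

/-- Integration by parts against a test function. -/
theorem IsPrim.integral_mul_deriv {F p : ℝ → ℂ} (h : IsPrim F p) (φ : Test) :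
    ∫ x in Ioi 0, F x * deriv φ x = -∫ x in Ioi 0, p x * φ x := by
  obtain ⟨a, b, ha, hab, h0, h1⟩ := φ.exists_bounds
  have hb := ha.trans hab
  have hp := (h.mul φ.isPrim).sub_eq ha hb
  rw [h0 a (by simp), h0 b (by simp), mul_zero, mul_zero, sub_zero,
    intervalIntegral.integral_add
      ((h.intervalIntegrable ha hb).mul_continuousOn φ.continuous.continuousOn)
      ((φ.continuous_deriv.intervalIntegrable a b).continuousOn_mul
        (h.continuousOn.mono fun _ hx => pos_of_mem_uIcc ha hb hx))] at hp
  rw [setIntegral_eq_intervalIntegral ha hab.le (fun x hx => by rw [h1 x hx, mul_zero]),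
    setIntegral_eq_intervalIntegral ha hab.le (fun x hx => by rw [h0 x hx, mul_zero])]
  linear_combination -hp

/-- A test function with vanishing integral is the derivative of a test function. -/
theorem Test.exists_primitive (φ : Test) (h : ∫ x in Ioi 0, φ x = 0) :
    ∃ η : Test, ∀ x, deriv η x = φ x := by
  obtain ⟨a, b, ha, hab, h0, -⟩ := φ.exists_bounds
  let η : ℝ → ℂ := fun x => ∫ t in a..x, φ t
  have hd : ∀ x, HasDerivAt η (φ x) x := fun x =>
    intervalIntegral.integral_hasDerivAt_right (φ.continuous.intervalIntegrable _ _)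
      (φ.continuous.stronglyMeasurableAtFilter _ _) φ.continuous.continuousAt
  have hde : deriv η = φ := funext fun x => (hd x).deriv
  have hz : ∀ x, x ∉ Icc a b → η x = 0 := by
    intro x hx
    rcases lt_or_ge x a with hxa | hxa
    · refine (intervalIntegral.integral_congr (g := fun _ => (0 : ℂ)) fun t ht => ?_).trans (by simp)
      rw [uIcc_of_ge hxa.le] at ht
      exact h0 t fun h => absurd h.1 (not_lt.2 ht.2)
    · have hxb : b < x := not_le.1 fun hxb => hx ⟨hxa, hxb⟩
      change ∫ t in a..x, φ t = 0
      rw [← setIntegral_eq_intervalIntegral ha hxa fun y hy => h0 y fun hy' =>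
        hy ⟨hy'.1, hy'.2.trans hxb⟩]
      exact h
  have hts : tsupport η ⊆ Icc a b := closure_minimal (fun x hx => by
    by_contra hc; exact hx (hz x hc)) isClosed_Icc
  refine ⟨⟨η, ?_, ?_, fun x hx => ha.trans_le (hts hx).1⟩, fun x => (hd x).deriv⟩
  · refine contDiff_infty_iff_deriv.2 ⟨fun x => (hd x).differentiableAt, ?_⟩
    rw [hde]; exact φ.contDiff
  · exact isCompact_Icc.of_isClosed_subset (isClosed_tsupport η) hts

theorem exists_test_integral_one : ∃ θ : Test, ∫ x in Ioi 0, θ x = 1 := by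
  let B : ContDiffBump (2 : ℝ) := ⟨1 / 2, 1, by norm_num, by norm_num⟩
  have hts : tsupport (fun x => ((B.normed volume x : ℝ) : ℂ)) ⊆ Ioi 0 := by
    refine (closure_mono (fun x hx => ?_) :
      _ ⊆ tsupport (B.normed volume)).trans ?_
    · simpa [Function.mem_support] using hx
    · change tsupport (B.normed volume) ⊆ Ioi 0
      rw [B.tsupport_normed_eq]
      intro x hx
      have : |x - 2| ≤ 1 := by simpa [Real.dist_eq] using hx
      have := (abs_le.1 this).1
      change 0 < x
      linarith
  refine ⟨⟨fun x => ((B.normed volume x : ℝ) : ℂ),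
    Complex.ofRealCLM.contDiff.comp B.contDiff_normed,
    B.hasCompactSupport_normed.comp_left Complex.ofReal_zero, hts⟩, ?_⟩
  change ∫ x in Ioi 0, ((B.normed volume x : ℝ) : ℂ) = 1
  rw [setIntegral_eq_integral_of_forall_compl_eq_zero, integral_complex_ofReal, B.integral_normed,
    Complex.ofReal_one]
  intro x hx
  exact image_eq_zero_of_notMem_tsupport (f := fun x => ((B.normed volume x : ℝ) : ℂ))
    fun h => hx (hts h)

theorem Test.integrable (φ : Test) : Integrable φ halfLine :=
  (φ.continuous.integrable_of_hasCompactSupport φ.hasCompactSupport).integrableOn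

/-- A linear functional on test functions that kills derivatives is a multiple of the integral. -/
theorem exists_eq_const_mul_integral (Λ : Test →ₗ[ℂ] ℂ) (h : ∀ φ : Test, Λ φ.derivative = 0) :
    ∃ c : ℂ, ∀ φ, Λ φ = c * ∫ x in Ioi 0, φ x := by
  obtain ⟨θ, hθ⟩ := exists_test_integral_one
  -- Subtracting (∫ φ) θ from φ leaves a test function of integral zero, that is, a derivative.
  refine ⟨Λ θ, fun φ => ?_⟩
  obtain ⟨η, hη⟩ := Test.exists_primitive (φ - (∫ x in Ioi 0, φ x) • θ) (by
    have : ∀ x, (φ - (∫ x in Ioi 0, φ x) • θ : Test) x = φ x - (∫ x in Ioi 0, φ x) * θ x :=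
      fun x => rfl
    simp only [this]
    rw [integral_sub φ.integrable (θ.integrable.const_mul _), integral_const_mul, hθ]
    ring)
  have he : η.derivative = φ - (∫ x in Ioi 0, φ x) • θ := TestFunction.ext hη
  have := h η
  rw [he, map_sub, map_smul, smul_eq_mul] at this
  linear_combination this

theorem LocallyIntegrableOn.integrable_mul_test {f : ℝ → ℂ} (hf : LocallyIntegrableOn f (Ioi 0))
    (φ : Test) : Integrable (fun x => f x * φ x) halfLine := by
  obtain ⟨a, b, ha, hab, h0, -⟩ := φ.exists_bounds
  have h1 : IntegrableOn (fun x => f x * φ x) (Icc a b) :=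
    (hf.integrableOn_compact_subset (fun x hx => ha.trans_le hx.1) isCompact_Icc).mul_continuousOn
      φ.continuous.continuousOn isCompact_Icc
  refine (integrableOn_iff_integrable_of_support_subset (s := Icc a b) (fun x hx => ?_)).1
    (h1.mono_measure Measure.restrict_le_self)
  by_contra hc
  exact hx (by change f x * φ x = 0; rw [h0 x fun h => hc ⟨h.1.le, h.2.le⟩, mul_zero])

theorem ae_eq_zero_of_test {f : ℝ → ℂ} (hf : LocallyIntegrableOn f (Ioi 0))
    (h : ∀ φ : Test, ∫ x in Ioi 0, f x * φ x = 0) : f =ᵐ[halfLine] 0 := by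
  have key := isOpen_Ioi.ae_eq_zero_of_integral_contDiff_smul_eq_zero hf (fun r hr hrc hrs => by
    have hcs : HasCompactSupport (fun x => (r x : ℂ)) := hrc.comp_left Complex.ofReal_zero
    have hts : tsupport (fun x => (r x : ℂ)) ⊆ (posReals : Set ℝ) :=
      (closure_mono (fun x hx => by
        simpa [Function.mem_support] using hx)).trans hrs
    have := h ⟨fun x => (r x : ℂ), Complex.ofRealCLM.contDiff.comp hr, hcs, hts⟩
    rw [← this]
    symm
    refine (setIntegral_eq_integral_of_forall_compl_eq_zero (s := Ioi 0) ?_).trans ?_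
    · intro x hx
      have : r x = 0 := by
        by_contra hne
        exact hx (hrs (subset_tsupport _ hne))
      change f x * (r x : ℂ) = 0
      simp [this]
    · refine integral_congr_ae (Filter.Eventually.of_forall fun x => ?_)
      change f x * (r x : ℂ) = r x • f x
      rw [Complex.real_smul, mul_comm])
  exact (ae_restrict_iff' measurableSet_Ioi).2 key

theorem ae_eq_of_test {f g : ℝ → ℂ} (hf : LocallyIntegrableOn f (Ioi 0))
    (hg : LocallyIntegrableOn g (Ioi 0))
    (h : ∀ φ : Test, ∫ x in Ioi 0, f x * φ x = ∫ x in Ioi 0, g x * φ x) : f =ᵐ[halfLine] g := by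
  have := ae_eq_zero_of_test (hf.sub hg) (fun φ => by
    have : ∀ x, (f - g) x * φ x = f x * φ x - g x * φ x := fun x => sub_mul _ _ _
    simp only [this]
    rw [integral_sub (LocallyIntegrableOn.integrable_mul_test hf φ)
      (LocallyIntegrableOn.integrable_mul_test hg φ), h, sub_self])
  filter_upwards [this] with x hx
  exact sub_eq_zero.1 hx

/-- The integral of `f` against test functions. -/
noncomputable def testPairing (f : ℝ → ℂ) (hf : LocallyIntegrableOn f (Ioi 0)) : Test →ₗ[ℂ] ℂ where
  toFun φ := ∫ x in Ioi 0, f x * φ x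
  map_add' φ ψ := by
    rw [← integral_add (LocallyIntegrableOn.integrable_mul_test hf φ)
      (LocallyIntegrableOn.integrable_mul_test hf ψ)]
    refine integral_congr_ae (Eventually.of_forall fun x => ?_)
    exact mul_add _ _ _
  map_smul' c φ := by
    rw [RingHom.id_apply, smul_eq_mul, ← integral_const_mul]
    refine integral_congr_ae (Eventually.of_forall fun x => ?_)
    exact mul_left_comm _ _ _

/-- A locally integrable function with vanishing weak derivative is constant. -/
theorem ae_eq_const_of_test {f : ℝ → ℂ} (hf : LocallyIntegrableOn f (Ioi 0))
    (h : ∀ φ : Test, ∫ x in Ioi 0, f x * deriv φ x = 0) : ∃ c : ℂ, f =ᵐ[halfLine] fun _ => c := by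
  obtain ⟨c, hc⟩ := exists_eq_const_mul_integral (testPairing f hf) h
  refine ⟨c, ae_eq_of_test hf (continuousOn_const.locallyIntegrableOn measurableSet_Ioi) fun φ => ?_⟩
  rw [integral_const_mul]
  exact hc φ

end TestFunctions

/-! ### Elements of `L²` -/

section L2Basics

open Filter

theorem inner_L2 (f g : L2) : (inner ℂ f g : ℂ) = ∫ x in Ioi 0, starRingEnd ℂ (f x) * g x := by
  rw [MeasureTheory.L2.inner_def]
  refine integral_congr_ae (Eventually.of_forall fun x => ?_)
  simp only [RCLike.inner_apply]
  exact mul_comm _ _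

theorem norm_sq_L2 (f : L2) : ‖f‖ ^ 2 = ∫ x in Ioi 0, ‖f x‖ ^ 2 := by
  have h := inner_self_ofReal f
  rw [inner_L2] at h
  have h2 : ∫ x in Ioi 0, starRingEnd ℂ (f x) * f x = ((∫ x in Ioi 0, ‖f x‖ ^ 2 : ℝ) : ℂ) := by
    rw [← integral_complex_ofReal]
    refine integral_congr_ae (Eventually.of_forall fun x => ?_)
    change starRingEnd ℂ (f x) * f x = _
    rw [mul_comm, Complex.mul_conj, Complex.normSq_eq_norm_sq]
  rw [h2] at h
  exact_mod_cast h.symm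

theorem L2.locallyIntegrableOn (f : L2) : LocallyIntegrableOn f (Ioi 0) :=
  locallyIntegrableOn_of_locallyIntegrable_restrict ((Lp.memLp f).locallyIntegrable (by norm_num))

theorem L2.integrable_sq (f : L2) : Integrable (fun x => ‖f x‖ ^ 2) halfLine :=
  (Lp.memLp f).integrable_norm_pow (by norm_num)

theorem L2.integrable_mul (f g : L2) : Integrable (fun x => starRingEnd ℂ (f x) * g x) halfLine :=
  ((Lp.memLp f).star).integrable_mul (Lp.memLp g)

/-- A square integrable function as an element of `L²`. -/
noncomputable abbrev toL2 (u : ℝ → ℂ) (hu : MemLp u 2 halfLine) : L2 := hu.toLp u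

theorem integral_mul_eq_inner (f : L2) {ψ : ℝ → ℂ} (hψ : MemLp ψ 2 halfLine) :
    ∫ x in Ioi 0, f x * ψ x = inner ℂ (toL2 _ hψ.star) f := by
  rw [inner_L2]
  refine integral_congr_ae ?_
  filter_upwards [hψ.star.coeFn_toLp] with x hx
  rw [hx, mul_comm]
  simp

/-- Each test function imposes one equation between L² pairings, a closed condition on (f, g). -/
theorem distGraph_isClosed (Tt : Test → ℝ → ℂ) (hT : ∀ φ, MemLp (Tt φ) 2 halfLine) :
    IsClosed (distGraph Tt hT : Set (L2 × L2)) := by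
  have : (distGraph Tt hT : Set (L2 × L2)) = ⋂ φ : Test, {p | (inner ℂ (toL2 _ φ.memLp.star) p.2 : ℂ)
      = inner ℂ (toL2 _ (hT φ).star) p.1} := by
    ext p
    simp only [mem_iInter, mem_ofPred_eq]
    refine forall_congr' fun φ => ?_
    rw [← integral_mul_eq_inner _ φ.memLp, ← integral_mul_eq_inner _ (hT φ)]
  rw [this]
  exact isClosed_iInter fun φ => isClosed_eq (by fun_prop) (by fun_prop)

theorem distOp_isClosed (Tt : Test → ℝ → ℂ) (hT : ∀ φ, MemLp (Tt φ) 2 halfLine) :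
    (distOp Tt hT).IsClosed := by
  rw [LinearPMap.IsClosed, distOp_graph]
  exact distGraph_isClosed Tt hT

/-- A test function as an element of `L²`. -/
noncomputable def Test.toL2 (φ : Test) : L2 := φ.memLp.toLp _

theorem Test.coeFn_toL2 (φ : Test) : φ.toL2 =ᵐ[halfLine] φ := φ.memLp.coeFn_toLp

theorem Test.toL2_mem (φ : Test) : φ.toL2 ∈ testSubspace := ⟨φ, φ.coeFn_toL2⟩

theorem mem_testSubspace_iff {f : L2} : f ∈ testSubspace ↔ ∃ φ : Test, f = φ.toL2 :=
  ⟨fun ⟨φ, h⟩ => ⟨φ, Lp.ext (h.trans φ.coeFn_toL2.symm)⟩, fun ⟨φ, h⟩ => h ▸ φ.toL2_mem⟩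

theorem Test.inner_toL2 (φ : Test) (f : L2) :
    (inner ℂ φ.toL2 f : ℂ) = ∫ x in Ioi 0, f x * φ.conj x := by
  rw [inner_L2]
  refine integral_congr_ae ?_
  filter_upwards [φ.coeFn_toL2] with x hx
  rw [hx, mul_comm]; rfl

theorem Test.conj_conj (φ : Test) : φ.conj.conj = φ := TestFunction.ext fun x => by simp

theorem dense_testSubspace : Dense (testSubspace : Set L2) := by
  refine dense_of_forall_inner fun f hf => ?_
  have : (f : ℝ → ℂ) =ᵐ[halfLine] 0 := ae_eq_zero_of_test (L2.locallyIntegrableOn f) fun φ => by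
    have := hf _ φ.conj.toL2_mem
    rwa [Test.inner_toL2, Test.conj_conj] at this
  exact Lp.ext (this.trans (Lp.coeFn_zero ℂ 2 halfLine).symm)

theorem dense_domain_of_test {A : L2 →ₗ.[ℂ] L2} (h : testSubspace ≤ A.domain) :
    Dense (A.domain : Set L2) := dense_testSubspace.mono h

end L2Basics

/-! ### Powers of `x` -/

section Powers

/-- The function `x ↦ x ^ a`. -/
noncomputable def rp (a x : ℝ) : ℂ := ((x ^ a : ℝ) : ℂ)

theorem zeta_eq_rp (m : ℝ) : zeta m = rp (1 / 2 + m) := rfl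

theorem rp_add (a b : ℝ) {x : ℝ} (hx : 0 < x) : rp (a + b) x = rp a x * rp b x := by
  simp only [rp, Real.rpow_add hx]; push_cast; rfl

theorem rp_zero (x : ℝ) : rp 0 x = 1 := by simp [rp]

theorem rp_neg_mul (a : ℝ) {x : ℝ} (hx : 0 < x) : rp (-a) x * rp a x = 1 := by
  rw [← rp_add _ _ hx, neg_add_cancel, rp_zero]

theorem rp_mul_neg (a : ℝ) {x : ℝ} (hx : 0 < x) : rp a x * rp (-a) x = 1 := by
  rw [mul_comm, rp_neg_mul a hx]

theorem norm_rp (a : ℝ) {x : ℝ} (hx : 0 < x) : ‖rp a x‖ = x ^ a := by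
  rw [rp, Complex.norm_real, Real.norm_of_nonneg (by positivity)]

theorem conj_rp (a x : ℝ) : starRingEnd ℂ (rp a x) = rp a x := Complex.conj_ofReal _

theorem hasDerivAt_rp (a : ℝ) {x : ℝ} (hx : 0 < x) : HasDerivAt (rp a) (a / x * rp a x) x := by
  have h := (Real.hasDerivAt_rpow_const (p := a) (Or.inl hx.ne')).ofReal_comp
  refine HasDerivAt.congr_deriv h ?_
  change _ = (a : ℂ) / x * ((x ^ a : ℝ) : ℂ)
  rw [Real.rpow_sub_one hx.ne']
  push_cast
  ring

theorem contDiffOn_rp (a : ℝ) : ContDiffOn ℝ ∞ (rp a) (Ioi 0) := by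
  intro x hx
  have h : ContDiffAt ℝ ∞ (fun x : ℝ => x ^ a) x := Real.contDiffAt_rpow_const_of_ne (ne_of_gt hx)
  exact (Complex.ofRealCLM.contDiff.contDiffAt.comp x h).contDiffWithinAt

theorem continuousOn_rp (a : ℝ) : ContinuousOn (rp a) (Ioi 0) := (contDiffOn_rp a).continuousOn

theorem locallyIntegrableOn_rp_mul (a : ℝ) {f : ℝ → ℂ} (hf : LocallyIntegrableOn f (Ioi 0)) :
    LocallyIntegrableOn (fun x => rp a x * f x) (Ioi 0) :=
  hf.continuousOn_mul (continuousOn_rp a) isOpen_Ioi.isLocallyClosed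

/-- The product of a power of `x` and a test function. -/
noncomputable def Test.rpMul (a : ℝ) (φ : Test) : Test := φ.smoothMul (rp a) (contDiffOn_rp a)

@[simp] theorem Test.rpMul_apply (a : ℝ) (φ : Test) (x : ℝ) : φ.rpMul a x = rp a x * φ x := rfl

theorem Test.deriv_rpMul (a : ℝ) (φ : Test) {x : ℝ} (hx : 0 < x) :
    deriv (φ.rpMul a) x = rp a x * (deriv φ x + a / x * φ x) := by
  have := ((hasDerivAt_rp a hx).mul (φ.hasDerivAt x)).deriv
  refine Eq.trans this ?_
  ring

end Powers

/-! ### First order expressions -/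

section FirstOrder

open Filter

/-- `-i f' + i (α / x) f = g` in the sense of distributions on `(0,∞)`. -/
def WeakFirst (α : ℝ) (f g : ℝ → ℂ) : Prop :=
  ∀ φ : Test, ∫ x in Ioi 0, g x * φ x =
    ∫ x in Ioi 0, f x * (Complex.I * deriv φ x + Complex.I * (α / x) * φ x)

theorem mem_Amax_graph {α : ℝ} {f g : L2} : (f, g) ∈ (Amax α).graph ↔ WeakFirst α f g := by
  rw [Amax, distOp_graph]; rfl

theorem integral_halfLine_congr {f g : ℝ → ℂ} (h : ∀ x, 0 < x → f x = g x) :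
    ∫ x in Ioi 0, f x = ∫ x in Ioi 0, g x :=
  setIntegral_congr_fun measurableSet_Ioi fun x hx => h x hx

theorem ae_halfLine_of_forall {p : ℝ → Prop} (h : ∀ x, 0 < x → p x) : ∀ᵐ x ∂halfLine, p x :=
  (ae_restrict_iff' measurableSet_Ioi).2 (Eventually.of_forall h)

theorem weakFirst_of_isPrim {α : ℝ} {f g F : ℝ → ℂ}
    (hF : IsPrim F fun x => Complex.I * (rp (-α) x * g x))
    (hf : f =ᵐ[halfLine] fun x => rp α x * F x) : WeakFirst α f g := by
  intro φ
  have h1 := hF.integral_mul_deriv (φ.rpMul α)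
  have h2 : ∫ x in Ioi 0, f x * (Complex.I * deriv φ x + Complex.I * (α / x) * φ x)
      = Complex.I * ∫ x in Ioi 0, F x * deriv (φ.rpMul α) x := by
    rw [← integral_const_mul]
    refine integral_congr_ae ?_
    filter_upwards [hf, ae_restrict_mem measurableSet_Ioi] with x hx hx0
    rw [hx, Test.deriv_rpMul α φ hx0]; ring
  have h3 : ∫ x in Ioi 0, Complex.I * (rp (-α) x * g x) * φ.rpMul α x
      = Complex.I * ∫ x in Ioi 0, g x * φ x := by
    rw [← integral_const_mul]
    refine integral_halfLine_congr fun x hx => ?_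
    rw [Test.rpMul_apply]
    linear_combination (Complex.I * g x * φ x) * rp_neg_mul α hx
  rw [h2, h1, h3]
  linear_combination (∫ x in Ioi 0, g x * φ x) * Complex.I_sq

/-- Conjugation by x^α removes the potential: for f = x^α F the equation reads F' = i x^{-α} g. -/
theorem weakFirst_iff {α : ℝ} {f g : ℝ → ℂ} (hf : LocallyIntegrableOn f (Ioi 0))
    (hg : LocallyIntegrableOn g (Ioi 0)) :
    WeakFirst α f g ↔ ∃ F, (IsPrim F fun x => Complex.I * (rp (-α) x * g x)) ∧
      f =ᵐ[halfLine] fun x => rp α x * F x := by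
  refine ⟨fun h => ?_, fun ⟨F, hF, hfF⟩ => weakFirst_of_isPrim hF hfF⟩
  have hg' := (isPrim_integral (locallyIntegrableOn_rp_mul (-α) hg)).const_mul Complex.I
  set P := fun x => Complex.I * ∫ t in (1 : ℝ)..x, rp (-α) t * g t with hP
  have hf' := locallyIntegrableOn_rp_mul (-α) hf
  have hPl : LocallyIntegrableOn P (Ioi 0) :=
    hg'.continuousOn.locallyIntegrableOn measurableSet_Ioi
  -- Testing the equation against x^{-α} φ shows that x^{-α} f minus the explicit primitive has zero
  -- weak derivative.
  obtain ⟨c, hc⟩ := ae_eq_const_of_test (hf'.sub hPl) (fun φ => by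
    have e1 : ∀ x, ((fun x => rp (-α) x * f x) - P) x * deriv φ x
        = rp (-α) x * f x * deriv φ x - P x * deriv φ x := fun x => sub_mul _ _ _
    simp only [e1]
    have i1 : Integrable (fun x => rp (-α) x * f x * deriv φ x) halfLine :=
      LocallyIntegrableOn.integrable_mul_test hf' φ.derivative
    have i2 : Integrable (fun x => P x * deriv φ x) halfLine :=
      LocallyIntegrableOn.integrable_mul_test hPl φ.derivative
    rw [integral_sub i1 i2, hg'.integral_mul_deriv φ]
    have e2 := h (φ.rpMul (-α))
    have e3 : ∫ x in Ioi 0, f x * (Complex.I * deriv (φ.rpMul (-α)) x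
        + Complex.I * (α / x) * φ.rpMul (-α) x) = Complex.I * ∫ x in Ioi 0, rp (-α) x * f x * deriv φ x := by
      rw [← integral_const_mul]
      refine integral_halfLine_congr fun x hx => ?_
      rw [Test.deriv_rpMul _ _ hx, Test.rpMul_apply]
      push_cast
      ring
    have e4 : ∫ x in Ioi 0, Complex.I * (rp (-α) x * g x) * φ x
        = Complex.I * ∫ x in Ioi 0, g x * φ.rpMul (-α) x := by
      rw [← integral_const_mul]
      refine integral_halfLine_congr fun x hx => ?_
      rw [Test.rpMul_apply]; ring
    rw [e4, e2, e3]
    linear_combination (∫ x in Ioi 0, rp (-α) x * f x * deriv φ x) * Complex.I_sq)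
  refine ⟨fun x => c + P x, hg'.const_add c, ?_⟩
  filter_upwards [hc, ae_restrict_mem measurableSet_Ioi] with x hx hx0
  have hx' : rp (-α) x * f x - P x = c := hx
  rw [← hx']
  linear_combination (-f x) * rp_mul_neg α hx0

theorem mem_Amax_graph_iff {α : ℝ} {f g : L2} : (f, g) ∈ (Amax α).graph ↔
    ∃ F, (IsPrim F fun x => Complex.I * (rp (-α) x * g x)) ∧
      f =ᵐ[halfLine] fun x => rp α x * F x :=
  mem_Amax_graph.trans (weakFirst_iff (L2.locallyIntegrableOn f) (L2.locallyIntegrableOn g))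

theorem weakFirst_of_hasDerivAt {α : ℝ} {u u' : ℝ → ℂ} (hu : ∀ x, 0 < x → HasDerivAt u (u' x) x)
    (hc : ContinuousOn u' (Ioi 0)) {f g : ℝ → ℂ} (hf : f =ᵐ[halfLine] u)
    (hg : g =ᵐ[halfLine] fun x => -Complex.I * u' x + Complex.I * (α / x) * u x) :
    WeakFirst α f g := by
  have huc : ContinuousOn u (Ioi 0) := fun x hx => (hu x hx).continuousAt.continuousWithinAt
  have hp : IsPrim (fun x => rp (-α) x * u x)
      (fun x => ((-α : ℝ) : ℂ) / x * rp (-α) x * u x + rp (-α) x * u' x) := by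
    refine isPrim_of_hasDerivAt (fun x hx => (hasDerivAt_rp (-α) hx).mul (hu x hx)) ?_
    have hx : ContinuousOn (fun x : ℝ => (x : ℂ)) (Ioi 0) := by fun_prop
    exact (((continuousOn_const.div hx fun x hx => by exact_mod_cast (ne_of_gt hx)).mul
      (continuousOn_rp _)).mul huc).add ((continuousOn_rp _).mul hc)
  refine weakFirst_of_isPrim (F := fun x => rp (-α) x * u x) (hp.congr ?_) ?_
  · filter_upwards [hg] with x hx
    rw [hx]
    push_cast
    linear_combination (rp (-α) x * u' x - α / x * rp (-α) x * u x) * Complex.I_sq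
  · filter_upwards [hf, ae_restrict_mem measurableSet_Ioi] with x hx hx0
    rw [hx]
    linear_combination (-u x) * rp_mul_neg α hx0

theorem contDiffOn_div (α : ℝ) : ContDiffOn ℝ ∞ (fun x : ℝ => ((α : ℂ) / x)) (Ioi 0) := by
  have h : ContDiffOn ℝ ∞ (fun x : ℝ => (x : ℂ)) (Ioi 0) := Complex.ofRealCLM.contDiff.contDiffOn
  simp only [div_eq_mul_inv]
  refine contDiffOn_const.mul (h.inv fun x hx => ?_)
  have hx' : (0 : ℝ) < x := hx
  exact_mod_cast hx'.ne'

/-- The first order expression `-i ∂ₓ + i α / x` on test functions. -/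
noncomputable def Test.first (α : ℝ) (φ : Test) : Test :=
  (-Complex.I) • φ.derivative + Complex.I • φ.smoothMul (fun x : ℝ => (α : ℂ) / x) (contDiffOn_div α)

@[simp] theorem Test.first_apply (α : ℝ) (φ : Test) (x : ℝ) :
    φ.first α x = -Complex.I * deriv φ x + Complex.I * (α / x * φ x) := rfl

theorem Test.mem_Amax (α : ℝ) (φ : Test) : (φ.toL2, (φ.first α).toL2) ∈ (Amax α).graph := by
  refine mem_Amax_graph.2 (weakFirst_of_hasDerivAt (fun x _ => φ.hasDerivAt x)
    φ.continuous_deriv.continuousOn φ.coeFn_toL2 ?_)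
  filter_upwards [(φ.first α).coeFn_toL2] with x hx
  rw [hx, Test.first_apply]; ring

theorem Amax_isClosed (α : ℝ) : (Amax α).IsClosed := distOp_isClosed _ _

theorem Amin_le_Amax (α : ℝ) : Amin α ≤ Amax α :=
  closure_le_of_le (Amax_isClosed α) LinearPMap.domRestrict_le

theorem Amin_graph (α : ℝ) :
    (Amin α).graph = ((Amax α).domRestrict testSubspace).graph.topologicalClosure :=
  closure_graph_of_le (Amax_isClosed α) LinearPMap.domRestrict_le

theorem Amin_isClosed (α : ℝ) : (Amin α).IsClosed := by
  rw [LinearPMap.IsClosed, Amin_graph]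
  exact Submodule.isClosed_topologicalClosure _

theorem Test.mem_restrict (α : ℝ) (φ : Test) :
    (φ.toL2, (φ.first α).toL2) ∈ ((Amax α).domRestrict testSubspace).graph :=
  mem_domRestrict_graph.2 ⟨φ.toL2_mem, φ.mem_Amax α⟩

theorem mem_restrict_iff {α : ℝ} {f g : L2} : (f, g) ∈ ((Amax α).domRestrict testSubspace).graph ↔
    ∃ φ : Test, f = φ.toL2 ∧ g = (φ.first α).toL2 := by
  constructor
  · intro h
    obtain ⟨h1, h2⟩ := mem_domRestrict_graph.1 h
    obtain ⟨φ, rfl⟩ := mem_testSubspace_iff.1 h1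
    exact ⟨φ, rfl, LinearPMap.mem_graph_snd_inj _ h2 (φ.mem_Amax α) rfl⟩
  · rintro ⟨φ, rfl, rfl⟩
    exact φ.mem_restrict α

theorem Test.mem_Amin (α : ℝ) (φ : Test) : (φ.toL2, (φ.first α).toL2) ∈ (Amin α).graph := by
  rw [Amin_graph]
  exact Submodule.le_topologicalClosure _ (φ.mem_restrict α)

theorem testSubspace_le_Amin (α : ℝ) : testSubspace ≤ (Amin α).domain := fun f hf => by
  obtain ⟨φ, rfl⟩ := mem_testSubspace_iff.1 hf
  exact mem_domain_iff_graph.2 ⟨_, φ.mem_Amin α⟩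

theorem dense_Amin (α : ℝ) : Dense ((Amin α).domain : Set L2) :=
  dense_domain_of_test (testSubspace_le_Amin α)

theorem dense_Amax (α : ℝ) : Dense ((Amax α).domain : Set L2) :=
  (dense_Amin α).mono (Amin_le_Amax α).1

theorem Test.first_conj (α : ℝ) (φ : Test) (x : ℝ) :
    (φ.first α).conj x = Complex.I * deriv φ.conj x + Complex.I * ((-α : ℝ) / x) * φ.conj x := by
  rw [Test.conj_apply, Test.first_apply, Test.deriv_conj, Test.conj_apply]
  simp only [map_add, map_mul, map_neg, Complex.conj_I, map_div₀, Complex.conj_ofReal]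
  push_cast
  ring

/-- Against conjugated test functions the adjoint relation is the distributional equation for
A_{-α}; being a closed condition, it passes from test functions to the whole minimal graph. -/
theorem Amin_adjoint (α : ℝ) : (Amin α).adjoint = Amax (-α) := by
  refine ext_of_graph fun f g => ?_
  rw [mem_adjoint_graph (dense_Amin α), mem_Amax_graph]
  have key : ∀ φ : Test, ((inner ℂ (φ.first α).toL2 f : ℂ) = inner ℂ φ.toL2 g) ↔
      ∫ x in Ioi 0, g x * φ.conj x = ∫ x in Ioi 0, f x * (Complex.I * deriv φ.conj x
        + Complex.I * ((-α : ℝ) / x) * φ.conj x) := by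
    intro φ
    rw [Test.inner_toL2, Test.inner_toL2, eq_comm]
    simp only [Test.first_conj]
  constructor
  · intro h φ
    have := (key φ.conj).1 (h _ _ (φ.conj.mem_Amin α))
    rwa [Test.conj_conj] at this
  · intro h a b hab
    rw [Amin_graph] at hab
    have hcl : IsClosed {p : L2 × L2 | (inner ℂ p.2 f : ℂ) = inner ℂ p.1 g} :=
      isClosed_eq (by fun_prop) (by fun_prop)
    refine closure_minimal (fun p hp => ?_) hcl hab
    obtain ⟨φ, h1, h2⟩ := mem_restrict_iff.1 (show (p.1, p.2) ∈ _ from hp)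
    rw [mem_ofPred_eq, h1, h2]
    exact (key φ).2 (h φ.conj)

theorem Amax_adjoint (α : ℝ) : (Amax α).adjoint = Amin (-α) := by
  have h : Amax α = (Amin (-α)).adjoint := by rw [Amin_adjoint, neg_neg]
  refine ext_of_graph fun f g => ?_
  rw [mem_adjoint_graph (dense_Amax α), h]
  refine ⟨fun hfg => mem_graph_of_adjoint (dense_Amin _) (Amin_isClosed _) hfg, fun hfg a b hab => ?_⟩
  exact (inner_of_adjoint' (dense_Amin _) hab hfg).symm

end FirstOrder

/-! ### Behaviour at the end points -/

section Boundary

open Filter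

/-- The bound compares ‖h‖² with c²/x, which is not integrable at the origin. -/
theorem false_of_le_sqrt_mul_norm {h : ℝ → ℂ} (hh : MemLp h 2 halfLine) {c δ : ℝ} (hc : 0 < c)
    (hδ : 0 < δ) (H : ∀ᵐ x ∂halfLine, x < δ → c ≤ √x * ‖h x‖) : False := by
  have h1 : IntegrableOn (fun x => ‖h x‖ ^ 2) (Ioo 0 δ) :=
    IntegrableOn.mono_set (hh.integrable_norm_pow (by norm_num)) Ioo_subset_Ioi_self
  have h2 : IntegrableOn (fun x : ℝ => x ^ (-1 : ℝ)) (Ioo 0 δ) := by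
    refine (h1.const_mul (c ^ 2)⁻¹).mono' ?_ ?_
    · refine (ContinuousOn.aestronglyMeasurable ?_ measurableSet_Ioo)
      exact fun x hx => (Real.continuousAt_rpow_const x _ (Or.inl hx.1.ne')).continuousWithinAt
    · have H' : ∀ᵐ x ∂(volume.restrict (Ioo 0 δ)), x < δ → c ≤ √x * ‖h x‖ :=
        ae_restrict_of_ae_restrict_of_subset Ioo_subset_Ioi_self H
      filter_upwards [H', ae_restrict_mem measurableSet_Ioo] with x hx hx0
      have h3 := hx hx0.2
      have h4 : c ^ 2 ≤ x * ‖h x‖ ^ 2 := by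
        calc c ^ 2 ≤ (√x * ‖h x‖) ^ 2 := by gcongr
          _ = x * ‖h x‖ ^ 2 := by rw [mul_pow, Real.sq_sqrt hx0.1.le]
      rw [Real.rpow_neg_one, norm_inv, Real.norm_of_nonneg hx0.1.le, inv_mul_eq_div,
        le_div_iff₀ (by positivity), inv_mul_le_iff₀ hx0.1]
      exact h4
  rw [intervalIntegral.integrableOn_Ioo_rpow_iff hδ] at h2
  exact lt_irrefl _ h2

theorem false_of_le_at_top {f : ℝ → ℝ} (hf : Integrable f halfLine) {c M : ℝ} (hc : 0 < c)
    (H : ∀ᵐ x ∂halfLine, M < x → c ≤ f x) : False := by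
  have hs : Ioi (max M 0) ⊆ Ioi (0 : ℝ) := Ioi_subset_Ioi (le_max_right _ _)
  have h1 : IntegrableOn f (Ioi (max M 0)) := IntegrableOn.mono_set hf hs
  have h2 : IntegrableOn (fun _ : ℝ => c) (Ioi (max M 0)) := by
    refine h1.mono' aestronglyMeasurable_const ?_
    filter_upwards [ae_restrict_of_ae_restrict_of_subset hs H, ae_restrict_mem measurableSet_Ioi]
      with x hx hx0
    rw [Real.norm_of_nonneg hc.le]
    exact hx (lt_of_le_of_lt (le_max_left _ _) hx0)
  rw [integrableOn_const_iff] at h2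
  rcases h2 with h2 | h2
  · simp at h2; exact hc.ne' h2
  · simp at h2

theorem IsPrim.exists_eq_add_integral {F q : ℝ → ℂ} (h : IsPrim F q)
    (hq : IntegrableOn q (Ioc 0 1)) :
    ∃ c, (∀ x, 0 < x → F x = c + ∫ t in (0 : ℝ)..x, q t) ∧ Tendsto F (𝓝[>] 0) (𝓝 c) := by
  have h01 : IntervalIntegrable q volume 0 1 :=
    (intervalIntegrable_iff_integrableOn_Ioc_of_le zero_le_one).2 hq
  have key : ∀ x, 0 < x → F x = (F 1 - ∫ t in (0 : ℝ)..1, q t) + ∫ t in (0 : ℝ)..x, q t := by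
    intro x hx
    rw [← intervalIntegral.integral_add_adjacent_intervals h01
      (h.intervalIntegrable one_pos hx), ← h.sub_eq one_pos hx]
    ring
  refine ⟨_, key, ?_⟩
  have h1 : ContinuousWithinAt (fun x => ∫ t in (0 : ℝ)..x, q t) (uIcc 0 1) 0 :=
    intervalIntegral.continuousOn_primitive_interval' h01 left_mem_uIcc 0 left_mem_uIcc
  have h2 : Tendsto (fun x => ∫ t in (0 : ℝ)..x, q t) (𝓝[>] 0) (𝓝 0) := by
    have h3 : Tendsto (fun x => ∫ t in (0 : ℝ)..x, q t) (𝓝[uIcc 0 1] 0) (𝓝 0) := by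
      simpa [ContinuousWithinAt] using h1
    refine h3.mono_left ?_
    rw [uIcc_of_le zero_le_one]
    refine nhdsWithin_le_of_mem ?_
    exact mem_of_superset (Ioo_mem_nhdsGT one_pos) Ioo_subset_Icc_self
  have h3 := h2.const_add (F 1 - ∫ t in (0 : ℝ)..1, q t)
  rw [add_zero] at h3
  refine h3.congr' ?_
  filter_upwards [self_mem_nhdsWithin] with x hx
  exact (key x hx).symm

/-- Green's formula for first order operators, when one function is `O(√x)` at the origin. -/
theorem inner_eq_of_bound {α C : ℝ} {f a h b : L2} (hf : (f, a) ∈ (Amax α).graph)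
    (hh : (h, b) ∈ (Amax (-α)).graph) (hC : ∀ᵐ x ∂halfLine, x < 1 → ‖f x‖ ≤ C * √x) :
    (inner ℂ f b : ℂ) = inner ℂ a h := by
  obtain ⟨F, hF, hfF⟩ := mem_Amax_graph_iff.1 hf
  obtain ⟨K, hK, hhK⟩ := mem_Amax_graph_iff.1 hh
  -- The weights x^α and x^{-α} cancel, so |P| = |f h|, and P' = q is integrable, which gives P
  -- limits at 0 and at infinity. A nonzero limit at 0 would contradict h in L² because f = O(√x); a
  -- nonzero limit at infinity would contradict integrability of f h. Hence ∫ q = 0, which is the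
  -- formula.
  set P := fun x => starRingEnd ℂ (F x) * K x with hPdef
  set q := fun x => Complex.I * (starRingEnd ℂ (f x) * b x - starRingEnd ℂ (a x) * h x) with hq
  have hPq : IsPrim P q := by
    refine (hF.conj.mul hK).congr ?_
    filter_upwards [hfF, hhK, ae_restrict_mem measurableSet_Ioi] with x h1 h2 hx
    have e := rp_mul_neg α hx
    simp only [hq, h1, h2, map_mul, Complex.conj_I, conj_rp, neg_neg]
    ring
  have hPf : ∀ᵐ x ∂halfLine, ‖P x‖ = ‖f x‖ * ‖h x‖ := by
    filter_upwards [hfF, hhK, ae_restrict_mem measurableSet_Ioi] with x h1 h2 hx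
    have e := congrArg norm (rp_mul_neg α hx)
    rw [norm_mul, norm_one] at e
    simp only [hPdef, h1, h2, norm_mul, RCLike.norm_conj]
    linear_combination (-‖F x‖ * ‖K x‖) * e
  have hqi : Integrable q halfLine :=
    ((L2.integrable_mul f b).sub (L2.integrable_mul a h)).const_mul _
  obtain ⟨c, hc, hlim⟩ := hPq.exists_eq_add_integral
    (IntegrableOn.mono_set hqi Ioc_subset_Ioi_self)
  have hc0 : c = 0 := by
    by_contra hne
    have hpos : 0 < ‖c‖ := norm_pos_iff.2 hne
    have hev : ∀ᶠ x in 𝓝[>] 0, ‖c‖ / 2 < ‖P x‖ := hlim.norm.eventually_const_lt (by linarith)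
    obtain ⟨δ, hδ, hδP⟩ := mem_nhdsGT_iff_exists_Ioo_subset.1 hev
    refine false_of_le_sqrt_mul_norm (Lp.memLp h) (c := ‖c‖ / 2 / (|C| + 1)) (δ := min δ 1)
      (by positivity) (lt_min hδ one_pos) ?_
    filter_upwards [hPf, hC, ae_restrict_mem measurableSet_Ioi] with x h1 h2 hx hxδ
    have h3 : ‖c‖ / 2 < ‖P x‖ := hδP ⟨hx, hxδ.trans_le (min_le_left _ _)⟩
    have h4 := h2 (hxδ.trans_le (min_le_right _ _))
    rw [h1] at h3
    have h5 : ‖f x‖ ≤ (|C| + 1) * √x :=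
      h4.trans (by gcongr; linarith [le_abs_self C])
    rw [div_le_iff₀ (by positivity)]
    calc ‖c‖ / 2 ≤ ‖f x‖ * ‖h x‖ := h3.le
      _ ≤ (|C| + 1) * √x * ‖h x‖ := by gcongr
      _ = _ := by ring
  have hlim2 : Tendsto P atTop (𝓝 (∫ x in Ioi 0, q x)) := by
    have := intervalIntegral_tendsto_integral_Ioi 0 hqi tendsto_id
    refine this.congr' ?_
    filter_upwards [eventually_gt_atTop 0] with x hx
    rw [hc x hx, hc0, zero_add]; rfl
  have hJ : ∫ x in Ioi 0, q x = 0 := by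
    by_contra hne
    have hpos : 0 < ‖∫ x in Ioi 0, q x‖ := norm_pos_iff.2 hne
    have hev : ∀ᶠ x in atTop, ‖∫ x in Ioi 0, q x‖ / 2 < ‖P x‖ :=
      hlim2.norm.eventually_const_lt (by linarith)
    obtain ⟨M, hM⟩ := eventually_atTop.1 hev
    refine false_of_le_at_top (L2.integrable_mul f h).norm (M := M) (half_pos hpos) ?_
    filter_upwards [hPf] with x h1 hx
    rw [norm_mul, RCLike.norm_conj, ← h1]
    exact (hM x hx.le).le
  rw [hq, integral_const_mul, integral_sub (L2.integrable_mul f b) (L2.integrable_mul a h),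
    ← inner_L2, ← inner_L2] at hJ
  exact sub_eq_zero.1 ((mul_eq_zero.1 hJ).resolve_left Complex.I_ne_zero)

/-- Since `Amin α` is the adjoint of `Amax (-α)`, membership is precisely Green's formula without
boundary term. -/
theorem mem_Amin_of_bound {α C : ℝ} {f a : L2} (hf : (f, a) ∈ (Amax α).graph)
    (hC : ∀ᵐ x ∂halfLine, x < 1 → ‖f x‖ ≤ C * √x) : (f, a) ∈ (Amin α).graph := by
  have h : Amin α = (Amax (-α)).adjoint := by rw [Amax_adjoint, neg_neg]
  rw [h, mem_adjoint_graph' (dense_Amax _)]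
  exact fun b c hbc => inner_eq_of_bound hf hbc hC

/-- Cauchy–Schwarz on (0, x), with ∫₀ˣ t^{2β} dt = x^{2β+1} / (2β+1). -/
theorem integral_rp_mul_le {β : ℝ} (hβ : -1 / 2 < β) (a : L2) {x : ℝ} (hx : 0 < x) :
    IntegrableOn (fun t => rp β t * a t) (Ioc 0 x) ∧
      ∫ t in Ioc 0 x, ‖rp β t * a t‖ ≤ (‖a‖ / √(2 * β + 1)) * x ^ (β + 1 / 2) := by
  have hm : AEStronglyMeasurable (rp β) (volume.restrict (Ioc 0 x)) :=
    ((continuousOn_rp β).mono fun t ht => ht.1).aestronglyMeasurable measurableSet_Ioc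
  have hsq : ∀ t ∈ Ioc 0 x, ‖rp β t‖ ^ 2 = t ^ (2 * β) := by
    intro t ht
    rw [norm_rp β ht.1, ← Real.rpow_natCast, ← Real.rpow_mul ht.1.le]
    congr 1
    push_cast
    ring
  have hint : IntegrableOn (fun t : ℝ => t ^ (2 * β)) (Ioc 0 x) :=
    (intervalIntegrable_iff_integrableOn_Ioc_of_le hx.le).1
      (intervalIntegral.intervalIntegrable_rpow' (by linarith))
  have hrp : MemLp (rp β) 2 (volume.restrict (Ioc 0 x)) := by
    rw [memLp_two_iff_integrable_sq_norm hm]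
    exact hint.congr ((ae_restrict_iff' measurableSet_Ioc).2
      (Eventually.of_forall fun t ht => (hsq t ht).symm))
  have ha : MemLp a 2 (volume.restrict (Ioc 0 x)) :=
    (Lp.memLp a).mono_measure (Measure.restrict_mono Ioc_subset_Ioi_self le_rfl)
  refine ⟨hrp.integrable_mul ha, ?_⟩
  have hcs := integral_mul_norm_le_Lp_mul_Lq (μ := volume.restrict (Ioc 0 x)) (f := rp β) (g := a)
    Real.HolderConjugate.two_two (by simpa using hrp) (by simpa using ha)
  simp only [norm_mul]
  refine hcs.trans ?_
  have e1 : ∫ t in Ioc 0 x, ‖rp β t‖ ^ (2 : ℝ) = x ^ (2 * β + 1) / (2 * β + 1) := by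
    have : ∫ t in Ioc 0 x, ‖rp β t‖ ^ (2 : ℝ) = ∫ t in Ioc 0 x, t ^ (2 * β) :=
      setIntegral_congr_fun measurableSet_Ioc fun t ht => by
        rw [← hsq t ht]; norm_cast
    rw [this, ← intervalIntegral.integral_of_le hx.le, integral_rpow (Or.inl (by linarith)),
      Real.zero_rpow (by linarith), sub_zero]
  have e2 : ∫ t in Ioc 0 x, ‖a t‖ ^ (2 : ℝ) ≤ ‖a‖ ^ 2 := by
    rw [norm_sq_L2]
    simp only [Real.rpow_two]
    exact setIntegral_mono_set (L2.integrable_sq a) (Eventually.of_forall fun t => by positivity)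
      (Eventually.of_forall fun t ht => ht.1)
  rw [e1, ← Real.sqrt_eq_rpow, ← Real.sqrt_eq_rpow, Real.sqrt_div (by positivity)]
  have e3 : √(∫ t in Ioc 0 x, ‖a t‖ ^ (2 : ℝ)) ≤ ‖a‖ := by
    rw [← Real.sqrt_sq (norm_nonneg a)]; exact Real.sqrt_le_sqrt e2
  have e4 : √(x ^ (2 * β + 1)) = x ^ (β + 1 / 2) := by
    rw [Real.sqrt_eq_rpow, ← Real.rpow_mul hx.le]; congr 1; ring
  rw [e4]
  calc x ^ (β + 1 / 2) / √(2 * β + 1) * √(∫ t in Ioc 0 x, ‖a t‖ ^ (2 : ℝ))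
      ≤ x ^ (β + 1 / 2) / √(2 * β + 1) * ‖a‖ := by gcongr
    _ = _ := by ring

/-- Elements of the domain of the maximal operator behave like `c x ^ α` at the origin. -/
theorem exists_bound_near_zero {α : ℝ} (hα : α < 1 / 2) {f a : L2}
    (hf : (f, a) ∈ (Amax α).graph) :
    ∃ c : ℂ, ∃ C : ℝ, ∀ᵐ x ∂halfLine, ‖f x - c * rp α x‖ ≤ C * √x := by
  obtain ⟨F, hF, hfF⟩ := mem_Amax_graph_iff.1 hf
  have hβ : -1 / 2 < -α := by linarith
  obtain ⟨c, hc, -⟩ := hF.exists_eq_add_integral ((integral_rp_mul_le hβ a one_pos).1.const_mul _)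
  refine ⟨c, ‖a‖ / √(2 * (-α) + 1), ?_⟩
  filter_upwards [hfF, ae_restrict_mem measurableSet_Ioi] with x h1 hx
  have hx : 0 < x := hx
  have h2 := (integral_rp_mul_le hβ a hx).2
  have h3 : ‖∫ t in (0 : ℝ)..x, Complex.I * (rp (-α) t * a t)‖
      ≤ ∫ t in Ioc 0 x, ‖rp (-α) t * a t‖ := by
    rw [intervalIntegral.integral_of_le hx.le]
    refine (norm_integral_le_integral_norm _).trans (le_of_eq ?_)
    congr 1; ext t
    rw [norm_mul, Complex.norm_I, one_mul]
  rw [h1, hc x hx, show rp α x * (c + ∫ t in (0 : ℝ)..x, Complex.I * (rp (-α) t * a t)) - c * rp α x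
    = rp α x * ∫ t in (0 : ℝ)..x, Complex.I * (rp (-α) t * a t) by ring, norm_mul, norm_rp α hx]
  calc x ^ α * ‖∫ t in (0 : ℝ)..x, Complex.I * (rp (-α) t * a t)‖
      ≤ x ^ α * ((‖a‖ / √(2 * (-α) + 1)) * x ^ (-α + 1 / 2)) := by gcongr; exact h3.trans h2
    _ = (‖a‖ / √(2 * (-α) + 1)) * (x ^ α * x ^ (-α + 1 / 2)) := by ring
    _ = _ := by
      have e : x ^ α * x ^ (-α + 1 / 2) = √x := by
        rw [← Real.rpow_add hx, Real.sqrt_eq_rpow]; congr 1; ring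
      rw [e]

/-- For α ≤ -1/2 the leading term c x^α is not square integrable at the origin unless c = 0, and
what remains is O(√x). -/
theorem Amin_eq_Amax_of_le {α : ℝ} (hα : α ≤ -1 / 2) : Amin α = Amax α := by
  refine le_antisymm (Amin_le_Amax α) (le_of_graph fun f a hf => ?_)
  obtain ⟨c, C, hC⟩ := exists_bound_near_zero (by linarith) hf
  have hc : c = 0 := by
    by_contra hne
    have hpos : 0 < ‖c‖ := norm_pos_iff.2 hne
    -- After multiplication by √x the remainder is at most C x; the choice of δ keeps it below ‖c‖ /
    -- 2.
    refine false_of_le_sqrt_mul_norm (Lp.memLp f) (c := ‖c‖ / 2)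
      (δ := min 1 (‖c‖ / 2 / (|C| + 1))) (by positivity) (by positivity) ?_
    filter_upwards [hC, ae_restrict_mem measurableSet_Ioi] with x h1 hx hxδ
    have hx : 0 < x := hx
    have hx1 : x ≤ 1 := (hxδ.trans_le (min_le_left _ _)).le
    have hx2 := hxδ.trans_le (min_le_right _ _)
    rw [lt_div_iff₀ (by positivity)] at hx2
    have h2 : ‖c‖ * x ^ α ≤ ‖f x‖ + C * √x := by
      have : ‖c * rp α x‖ ≤ ‖f x‖ + ‖f x - c * rp α x‖ := by
        calc ‖c * rp α x‖ = ‖f x - (f x - c * rp α x)‖ := by rw [sub_sub_cancel]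
          _ ≤ _ := norm_sub_le _ _
      rw [norm_mul, norm_rp α hx] at this
      linarith
    have h3 : 1 ≤ √x * x ^ α := by
      rw [Real.sqrt_eq_rpow, ← Real.rpow_add hx]
      exact Real.one_le_rpow_of_pos_of_le_one_of_nonpos hx hx1 (by linarith)
    have h4 : √x * √x = x := Real.mul_self_sqrt hx.le
    have h5 : C * x ≤ (|C| + 1) * x := by gcongr; linarith [le_abs_self C]
    have h6 : √x * (‖c‖ * x ^ α) ≤ √x * (‖f x‖ + C * √x) := by gcongr
    have h7 : ‖c‖ * 1 ≤ ‖c‖ * (√x * x ^ α) := by gcongr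
    have h8 : √x * (‖f x‖ + C * √x) = √x * ‖f x‖ + C * x := by linear_combination C * h4
    nlinarith
  refine mem_Amin_of_bound (C := C) hf ?_
  filter_upwards [hC] with x hx _
  simpa [hc] using hx

/-- Dual to the case α ≤ -1/2: take adjoints at -α. -/
theorem Amin_eq_Amax_of_ge {α : ℝ} (hα : 1 / 2 ≤ α) : Amin α = Amax α := by
  have h : (Amin (-α)).adjoint = (Amax (-α)).adjoint := by
    rw [Amin_eq_Amax_of_le (by linarith)]
  rw [Amin_adjoint, Amax_adjoint, neg_neg] at h
  exact h.symm

end Boundary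

/-! ### The cut-off functions `ξ x ^ a` -/

section Cutoff

open Filter

variable {ξ : ℝ → ℂ}

theorem IsCutoff.hasDerivAt (hξ : IsCutoff ξ) (x : ℝ) : HasDerivAt ξ (deriv ξ x) x :=
  (hξ.smooth.differentiable (by simp) x).hasDerivAt

theorem IsCutoff.continuous_deriv (hξ : IsCutoff ξ) : Continuous (deriv ξ) :=
  hξ.smooth.continuous_deriv (by simp)

/-- The derivative of the cut-off function as a test function. -/
noncomputable def IsCutoff.derivTest (hξ : IsCutoff ξ) : Test :=
  have hts : tsupport (deriv ξ) ⊆ Icc 1 2 := closure_minimal (fun x hx => by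
    by_contra hc
    rw [mem_Icc, not_and_or, not_le, not_le] at hc
    refine hx ?_
    rcases hc with hc | hc
    · have : ξ =ᶠ[𝓝 x] fun _ => 1 := by
        filter_upwards [isOpen_Iio.mem_nhds hc] with y hy using hξ.eq_one y (le_of_lt hy)
      rw [this.deriv_eq, deriv_const]
    · have : ξ =ᶠ[𝓝 x] fun _ => 0 := by
        filter_upwards [isOpen_Ioi.mem_nhds hc] with y hy using hξ.eq_zero y (le_of_lt hy)
      rw [this.deriv_eq, deriv_const]) isClosed_Icc
  { toFun := deriv ξ
    contDiff' := (contDiff_infty_iff_deriv.1 hξ.smooth).2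
    hasCompactSupport' := isCompact_Icc.of_isClosed_subset (isClosed_tsupport _) hts
    tsupport_subset' := fun x hx => one_pos.trans_le (hts hx).1 }

theorem memLp_cutoff (hξ : IsCutoff ξ) {a : ℝ} (ha : -1 / 2 < a) :
    MemLp (fun x => ξ x * rp a x) 2 halfLine := by
  have hc : Continuous ξ := hξ.smooth.continuous
  have hm : AEStronglyMeasurable (fun x => ξ x * rp a x) halfLine :=
    (hc.continuousOn.mul (continuousOn_rp a)).aestronglyMeasurable measurableSet_Ioi
  rw [memLp_two_iff_integrable_sq_norm hm]
  obtain ⟨C, hC⟩ := isCompact_Icc.exists_bound_of_continuousOn (s := Icc (0 : ℝ) 2) hc.continuousOn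
  have hint : IntegrableOn (fun t : ℝ => C ^ 2 * t ^ (2 * a)) (Ioc 0 2) :=
    ((intervalIntegrable_iff_integrableOn_Ioc_of_le zero_le_two).1
      (intervalIntegral.intervalIntegrable_rpow' (by linarith))).const_mul _
  have hon : IntegrableOn (fun x => ‖ξ x * rp a x‖ ^ 2) (Ioc 0 2) := by
    refine hint.mono' ?_ ?_
    · exact ((hm.mono_measure (Measure.restrict_mono Ioc_subset_Ioi_self le_rfl)).norm.pow 2)
    · filter_upwards [ae_restrict_mem measurableSet_Ioc] with x hx
      rw [Real.norm_of_nonneg (by positivity), norm_mul, mul_pow, norm_rp a hx.1,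
        ← Real.rpow_natCast (x ^ a), ← Real.rpow_mul hx.1.le]
      have h1 := hC x ⟨hx.1.le, hx.2⟩
      have h2 : a * (2 : ℕ) = 2 * a := by push_cast; ring
      rw [h2]
      have h3 : 0 ≤ x ^ (2 * a) := Real.rpow_nonneg hx.1.le _
      gcongr
  have : IntegrableOn (fun x => ‖ξ x * rp a x‖ ^ 2) (Ioi 0) := by
    have hz : IntegrableOn (fun x => ‖ξ x * rp a x‖ ^ 2) (Ioi 2) := by
      refine (integrableOn_zero (μ := volume) (s := Ioi (2 : ℝ))).congr_fun (fun x hx => ?_) measurableSet_Ioi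
      have : ξ x = 0 := hξ.eq_zero x (le_of_lt hx)
      simp [this]
    rw [← Ioc_union_Ioi_eq_Ioi (zero_le_two (α := ℝ))]
    exact hon.union hz
  exact this

/-- The function `ξ x ^ a` as an element of `L²`. -/
noncomputable def cutoffElt (hξ : IsCutoff ξ) {a : ℝ} (ha : -1 / 2 < a) : L2 :=
  (memLp_cutoff hξ ha).toLp _

theorem coeFn_cutoffElt (hξ : IsCutoff ξ) {a : ℝ} (ha : -1 / 2 < a) :
    cutoffElt hξ ha =ᵐ[halfLine] fun x => ξ x * rp a x := (memLp_cutoff hξ ha).coeFn_toLp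

theorem mem_cutoffLine_iff (hξ : IsCutoff ξ) {m : ℝ} (ha : -1 / 2 < 1 / 2 + m) {f : L2} :
    f ∈ cutoffLine m ξ ↔ ∃ c : ℂ, f = c • cutoffElt hξ ha := by
  have key : ∀ c : ℂ, (c • cutoffElt hξ ha : L2) =ᵐ[halfLine] fun x => c * (ξ x * zeta m x) := by
    intro c
    filter_upwards [Lp.coeFn_smul c (cutoffElt hξ ha), coeFn_cutoffElt hξ ha] with x h1 h2
    rw [h1, Pi.smul_apply, h2, smul_eq_mul, zeta_eq_rp]
  constructor
  · rintro ⟨c, hc⟩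
    exact ⟨c, Lp.ext (hc.trans (key c).symm)⟩
  · rintro ⟨c, rfl⟩
    exact ⟨c, key c⟩

theorem cutoffElt_mem_cutoffLine (hξ : IsCutoff ξ) {m : ℝ} (ha : -1 / 2 < 1 / 2 + m) :
    cutoffElt hξ ha ∈ cutoffLine m ξ := (mem_cutoffLine_iff hξ ha).2 ⟨1, (one_smul _ _).symm⟩

theorem cutoff_weakFirst (hξ : IsCutoff ξ) (a β : ℝ) {f g : ℝ → ℂ}
    (hf : f =ᵐ[halfLine] fun x => ξ x * rp a x)
    (hg : g =ᵐ[halfLine] fun x => -Complex.I * (deriv ξ x * rp a x) +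
      Complex.I * ((β - a) / x) * (ξ x * rp a x)) : WeakFirst β f g := by
  refine weakFirst_of_hasDerivAt (u := fun x => ξ x * rp a x)
    (u' := fun x => deriv ξ x * rp a x + ξ x * (a / x * rp a x))
    (fun x hx => (hξ.hasDerivAt x).mul (hasDerivAt_rp a hx)) ?_ hf ?_
  · exact (hξ.continuous_deriv.continuousOn.mul (continuousOn_rp a)).add
      (hξ.smooth.continuous.continuousOn.mul ((contDiffOn_div a).continuousOn.mul (continuousOn_rp a)))
  · filter_upwards [hg] with x hx
    rw [hx]; ring

/-- A_a annihilates x^a, so only the derivative of ξ survives, and the image is a test function. -/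
theorem cutoffElt_mem_Amax (hξ : IsCutoff ξ) {a : ℝ} (ha : -1 / 2 < a) :
    (cutoffElt hξ ha, ((-Complex.I) • hξ.derivTest.rpMul a : Test).toL2) ∈ (Amax a).graph := by
  refine mem_Amax_graph.2 (cutoff_weakFirst hξ a a (coeFn_cutoffElt hξ ha) ?_)
  filter_upwards [((-Complex.I) • hξ.derivTest.rpMul a : Test).coeFn_toL2] with x hx
  rw [hx]
  change -Complex.I * (rp a x * deriv ξ x) = _
  rw [sub_self, zero_div]; ring

/-- For β ≠ a the image picks up a multiple of ξ x^{a-1}, still square integrable when a > 1/2. -/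
theorem cutoffElt_mem_Amax' (hξ : IsCutoff ξ) {a : ℝ} (ha : -1 / 2 < a) (ha' : -1 / 2 < a - 1)
    (β : ℝ) : (cutoffElt hξ ha, ((-Complex.I) • hξ.derivTest.rpMul a : Test).toL2 +
      (Complex.I * (β - a)) • cutoffElt hξ ha') ∈ (Amax β).graph := by
  refine mem_Amax_graph.2 (cutoff_weakFirst hξ a β (coeFn_cutoffElt hξ ha) ?_)
  filter_upwards [((-Complex.I) • hξ.derivTest.rpMul a : Test).coeFn_toL2, coeFn_cutoffElt hξ ha',
    Lp.coeFn_add ((-Complex.I) • hξ.derivTest.rpMul a : Test).toL2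
      ((Complex.I * (β - a)) • cutoffElt hξ ha'),
    Lp.coeFn_smul (Complex.I * (β - a)) (cutoffElt hξ ha'), ae_restrict_mem measurableSet_Ioi]
    with x h1 h2 h3 h4 hx
  have hx : 0 < x := hx
  rw [h3, Pi.add_apply, h1, h4, Pi.smul_apply, h2, smul_eq_mul]
  change -Complex.I * (rp a x * deriv ξ x) + _ = _
  have h5 : rp (a - 1) x = rp a x / x := by
    simp only [rp, Real.rpow_sub_one hx.ne']; push_cast; rfl
  rw [h5]; ring

/-- Near the origin the image is i (β - a) x^{a-1}, which is not square integrable for a ≤ 1/2. -/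
theorem cutoffElt_notMem_Amax (hξ : IsCutoff ξ) {a β : ℝ} (ha : -1 / 2 < a) (ha' : a ≤ 1 / 2)
    (hβ : β ≠ a) : cutoffElt hξ ha ∉ (Amax β).domain := by
  intro hmem
  obtain ⟨g, hg⟩ := mem_domain_iff_graph.1 hmem
  set w : ℝ → ℂ := fun x => -Complex.I * (deriv ξ x * rp a x) +
      Complex.I * ((β - a) / x) * (ξ x * rp a x) with hw
  have h1 : WeakFirst β (cutoffElt hξ ha) w :=
    cutoff_weakFirst hξ a β (coeFn_cutoffElt hξ ha) (ae_eq_refl _)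
  have hwc : ContinuousOn w (Ioi 0) := by
    have hd : ContinuousOn (fun x : ℝ => ((β : ℂ) - a) / x) (Ioi 0) := by
      have := (contDiffOn_div (β - a)).continuousOn
      push_cast at this
      exact this
    exact (continuousOn_const.mul (hξ.continuous_deriv.continuousOn.mul (continuousOn_rp a))).add
      ((continuousOn_const.mul hd).mul (hξ.smooth.continuous.continuousOn.mul (continuousOn_rp a)))
  have h2 : (g : ℝ → ℂ) =ᵐ[halfLine] w := ae_eq_of_test (L2.locallyIntegrableOn g)
    (hwc.locallyIntegrableOn measurableSet_Ioi)
    fun φ => (mem_Amax_graph.1 hg φ).trans (h1 φ).symm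
  have hne : (β : ℂ) - a ≠ 0 := by
    rw [sub_ne_zero]; exact_mod_cast hβ
  refine false_of_le_sqrt_mul_norm (Lp.memLp g) (c := ‖(β : ℂ) - a‖) (norm_pos_iff.2 hne) one_pos ?_
  filter_upwards [h2, ae_restrict_mem measurableSet_Ioi] with x hx hx0 hx1
  have hx0 : 0 < x := hx0
  have hd : deriv ξ x = 0 := by
    have : ξ =ᶠ[𝓝 x] fun _ => 1 := by
      filter_upwards [isOpen_Iio.mem_nhds hx1] with y hy using hξ.eq_one y (le_of_lt hy)
    rw [this.deriv_eq, deriv_const]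
  rw [hx, hw]
  simp only [hd, hξ.eq_one x hx1.le, zero_mul, mul_zero, zero_add, one_mul]
  rw [norm_mul, norm_mul, Complex.norm_I, one_mul, norm_div, Complex.norm_real,
    Real.norm_of_nonneg hx0.le, norm_rp a hx0]
  have h3 : 1 ≤ √x * x ^ a / x := by
    rw [Real.sqrt_eq_rpow, ← Real.rpow_add hx0, ← Real.rpow_sub_one hx0.ne']
    exact Real.one_le_rpow_of_pos_of_le_one_of_nonpos hx0 hx1.le (by linarith)
  calc ‖(β : ℂ) - a‖ = ‖(β : ℂ) - a‖ * 1 := (mul_one _).symm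
    _ ≤ ‖(β : ℂ) - a‖ * (√x * x ^ a / x) := by gcongr
    _ = _ := by ring

/-- Subtracting c ξ x^{1/2+m}, with c the leading coefficient of f, leaves a function that is O(√x)
at the origin. -/
theorem Amax_domain_eq (hξ : IsCutoff ξ) {m : ℝ} (h1 : -1 < m) (h2 : m < 0) :
    (Amax (1 / 2 + m)).domain = (Amin (1 / 2 + m)).domain ⊔ cutoffLine m ξ := by
  have ha : -1 / 2 < 1 / 2 + m := by linarith
  refine le_antisymm (fun f hf => ?_) (sup_le (Amin_le_Amax _).1 fun f hf => ?_)
  · obtain ⟨a, hfa⟩ := mem_domain_iff_graph.1 hf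
    obtain ⟨c, C, hC⟩ := exists_bound_near_zero (by linarith) hfa
    have h3 := (Amax (1 / 2 + m)).graph.sub_mem hfa
      ((Amax (1 / 2 + m)).graph.smul_mem c (cutoffElt_mem_Amax hξ ha))
    have h4 := mem_Amin_of_bound (C := C) h3 (by
      filter_upwards [hC, Lp.coeFn_sub f (c • cutoffElt hξ ha), Lp.coeFn_smul c (cutoffElt hξ ha),
        coeFn_cutoffElt hξ ha] with x e1 e2 e3 e4 hx
      change ‖(f - c • cutoffElt hξ ha : L2) x‖ ≤ _
      rw [e2, Pi.sub_apply, e3, Pi.smul_apply, e4, hξ.eq_one x hx.le, one_mul, smul_eq_mul]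
      exact e1)
    refine Submodule.mem_sup.2 ⟨f - c • cutoffElt hξ ha, mem_domain_iff_graph.2 ⟨_, h4⟩,
      c • cutoffElt hξ ha, (mem_cutoffLine_iff hξ ha).2 ⟨c, rfl⟩, sub_add_cancel _ _⟩
  · obtain ⟨c, rfl⟩ := (mem_cutoffLine_iff hξ ha).1 hf
    exact Submodule.smul_mem _ _ (mem_domain_iff_graph.2 ⟨_, cutoffElt_mem_Amax hξ ha⟩)

end Cutoff

/-! ### Hardy's inequality and the domain of the minimal operator -/

section Hardy

/-- The test function `φ / x`. -/
noncomputable def Test.divX (φ : Test) : Test :=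
  φ.smoothMul (fun x : ℝ => ((1 : ℝ) : ℂ) / x) (contDiffOn_div 1)

@[simp] theorem Test.divX_apply (φ : Test) (x : ℝ) : φ.divX x = ((1 : ℝ) : ℂ) / x * φ x := rfl

theorem Test.toL2_add (φ ψ : Test) : (φ + ψ).toL2 = φ.toL2 + ψ.toL2 := MemLp.toLp_add φ.memLp ψ.memLp

theorem Test.toL2_smul (c : ℂ) (φ : Test) : (c • φ).toL2 = c • φ.toL2 :=
  MemLp.toLp_const_smul c φ.memLp

theorem Test.first_toL2 (α : ℝ) (φ : Test) :
    (φ.first α).toL2 = (-Complex.I) • (φ.derivative.toL2 - (α : ℂ) • φ.divX.toL2) := by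
  have : φ.first α = (-Complex.I) • (φ.derivative + (-α : ℂ) • φ.divX) :=
    TestFunction.ext fun x => by
      change -Complex.I * deriv φ x + Complex.I * (α / x * φ x)
        = -Complex.I * (deriv φ x + -α * (((1 : ℝ) : ℂ) / x * φ x))
      push_cast; ring
  rw [this, Test.toL2_smul, Test.toL2_add, Test.toL2_smul, neg_smul (α : ℂ), sub_eq_add_neg]

/-- This is the vanishing of the integral of the derivative of |φ|² / x. -/
theorem Test.inner_derivative_divX (φ : Test) :
    (inner ℂ φ.divX.toL2 φ.derivative.toL2 : ℂ) + inner ℂ φ.derivative.toL2 φ.divX.toL2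
      = inner ℂ φ.divX.toL2 φ.divX.toL2 := by
  have e : ∀ u v : Test, (inner ℂ u.toL2 v.toL2 : ℂ) = ∫ x in Ioi 0, u.conj x * v x := by
    intro u v
    rw [Test.inner_toL2]
    refine integral_congr_ae ?_
    filter_upwards [v.coeFn_toL2] with x hx
    rw [hx, mul_comm]
  have i : ∀ u v : Test, Integrable (fun x => u x * v x) halfLine := fun u v =>
    LocallyIntegrableOn.integrable_mul_test
      (u.continuous.continuousOn.locallyIntegrableOn measurableSet_Ioi) v
  have h := φ.divX.conj.isPrim.integral_mul_deriv φ
  rw [e, e, e]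
  have h2 : ∫ x in Ioi 0, deriv φ.divX.conj x * φ x
      = (∫ x in Ioi 0, φ.derivative.conj x * φ.divX x) - ∫ x in Ioi 0, φ.divX.conj x * φ.divX x := by
    rw [← integral_sub (i _ _) (i _ _)]
    refine integral_halfLine_congr fun x hx => ?_
    have hx' : (x : ℂ) ≠ 0 := by exact_mod_cast hx.ne'
    have h3 : HasDerivAt (fun y : ℝ => ((1 : ℝ) : ℂ) / y) (-1 / (x : ℂ) ^ 2) x := by
      have := ((hasDerivAt_id x).ofReal_comp).fun_inv (by simpa using hx')
      simpa [one_div] using this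
    have h4 : deriv φ.divX x = -1 / (x : ℂ) ^ 2 * φ x + ((1 : ℝ) : ℂ) / x * deriv φ x :=
      (h3.mul (φ.hasDerivAt x)).deriv
    rw [Test.deriv_conj, h4]
    simp only [Test.conj_apply, Test.divX_apply, Test.derivative_apply, map_add, map_mul, map_div₀,
      map_neg, map_one, map_pow, Complex.conj_ofReal]
    push_cast
    field_simp
    ring
  rw [h2] at h
  have h5 : ∫ x in Ioi 0, φ.divX.conj x * deriv φ x = ∫ x in Ioi 0, φ.divX.conj x * φ.derivative x := rfl
  rw [h5] at h
  rw [h]; ring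

/-- In the expansion of ‖φ' - α φ/x‖² the cross term is -2α times the real part of the pairing of φ'
and φ/x, that is, -α ‖φ/x‖². -/
theorem Test.norm_first_sq (α : ℝ) (φ : Test) : ‖(φ.first α).toL2‖ ^ 2
    = ‖φ.derivative.toL2‖ ^ 2 + (α ^ 2 - α) * ‖φ.divX.toL2‖ ^ 2 := by
  have h := congrArg Complex.re φ.inner_derivative_divX
  rw [Test.first_toL2, norm_smul, norm_neg, Complex.norm_I, one_mul, @norm_sub_sq ℂ, norm_smul,
    inner_smul_right, Complex.norm_real]
  rw [Complex.add_re, inner_self_ofReal, Complex.ofReal_re, ← inner_conj_symm φ.divX.toL2,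
    Complex.conj_re] at h
  have h2 : RCLike.re ((α : ℂ) * inner ℂ φ.derivative.toL2 φ.divX.toL2)
      = α * (inner ℂ φ.derivative.toL2 φ.divX.toL2 : ℂ).re := Complex.re_ofReal_mul _ _
  rw [h2, mul_pow, Real.norm_eq_abs, sq_abs]
  linear_combination (-α) * h

/-- At α = 1/2 the coefficient α² - α is -1/4, and the square on the left is nonnegative. -/
theorem Test.hardy (φ : Test) : ‖φ.divX.toL2‖ ≤ 2 * ‖φ.derivative.toL2‖ := by
  have h := φ.norm_first_sq (1 / 2)
  refine abs_le_of_sq_le_sq' ?_ (by positivity) |>.2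
  nlinarith [sq_nonneg ‖(φ.first (1 / 2)).toL2‖]

/-- Away from the critical value 1/2, ‖A_α φ‖ is comparable with ‖φ'‖ on test functions, so all the
minimal domains coincide. At α = 1/2 Hardy's inequality is saturated and the constant degenerates.
-/
theorem Test.exists_norm_first_le {α : ℝ} (hα : α ≠ 1 / 2) (β : ℝ) :
    ∃ C, ∀ φ : Test, ‖(φ.first β).toL2‖ ≤ C * ‖(φ.first α).toL2‖ := by
  -- If α² - α ≥ 0 the constant 1 works; otherwise Hardy's inequality gives 1 + 4 (α² - α) = 4 (α -
  -- 1/2)².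
  set d := min 1 (4 * (α - 1 / 2) ^ 2) with hd
  have hα' : α - 1 / 2 ≠ 0 := sub_ne_zero.2 hα
  have hd0 : 0 < d := lt_min one_pos (by positivity)
  refine ⟨(1 + 2 * |β|) / √d, fun φ => ?_⟩
  have h1 : d * ‖φ.derivative.toL2‖ ^ 2 ≤ ‖(φ.first α).toL2‖ ^ 2 := by
    rw [φ.norm_first_sq α]
    have h := φ.hardy
    have h2 : ‖φ.divX.toL2‖ ^ 2 ≤ 4 * ‖φ.derivative.toL2‖ ^ 2 := by
      calc _ ≤ (2 * ‖φ.derivative.toL2‖) ^ 2 := by gcongr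
        _ = _ := by ring
    rcases le_total 0 (α ^ 2 - α) with h0 | h0
    · have : d ≤ 1 := min_le_left _ _
      nlinarith [mul_nonneg h0 (sq_nonneg ‖φ.divX.toL2‖), sq_nonneg ‖φ.derivative.toL2‖]
    · have : d ≤ 4 * (α - 1 / 2) ^ 2 := min_le_right _ _
      nlinarith [mul_le_mul_of_nonpos_left h2 h0, sq_nonneg ‖φ.derivative.toL2‖]
  have h2 : √d * ‖φ.derivative.toL2‖ ≤ ‖(φ.first α).toL2‖ := by
    refine abs_le_of_sq_le_sq' ?_ (by positivity) |>.2
    rwa [mul_pow, Real.sq_sqrt hd0.le]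
  have h3 : ‖(φ.first β).toL2‖ ≤ (1 + 2 * |β|) * ‖φ.derivative.toL2‖ := by
    rw [Test.first_toL2, norm_smul, norm_neg, Complex.norm_I, one_mul]
    refine (norm_sub_le _ _).trans ?_
    rw [norm_smul, Complex.norm_real, Real.norm_eq_abs]
    nlinarith [mul_le_mul_of_nonneg_left φ.hardy (abs_nonneg β)]
  have hs : 0 < √d := Real.sqrt_pos.2 hd0
  calc _ ≤ (1 + 2 * |β|) * ‖φ.derivative.toL2‖ := h3
    _ = (1 + 2 * |β|) / √d * (√d * ‖φ.derivative.toL2‖) := by field_simp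
    _ ≤ _ := by gcongr

theorem Amin_domain_le {α : ℝ} (hα : α ≠ 1 / 2) (β : ℝ) : (Amin α).domain ≤ (Amin β).domain := by
  obtain ⟨C, hC⟩ := Test.exists_norm_first_le hα β
  intro f hf
  obtain ⟨g, hg⟩ := mem_domain_iff_graph.1 hf
  rw [Amin_graph] at hg
  obtain ⟨g', hg', -⟩ := exists_mem_closure_of_bound (C := C)
    (G' := ((Amax β).domRestrict testSubspace).graph) (fun a b hab => by
      obtain ⟨φ, rfl, rfl⟩ := mem_restrict_iff.1 hab
      exact ⟨_, φ.mem_restrict β⟩) (fun a b b' hab hab' => by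
      obtain ⟨φ, rfl, rfl⟩ := mem_restrict_iff.1 hab
      rw [LinearPMap.mem_graph_snd_inj _ hab' (φ.mem_restrict β) rfl]
      exact hC φ) hg
  rw [← Amin_graph] at hg'
  exact mem_domain_iff_graph.2 ⟨g', hg'⟩

theorem mem_weakDeriv_graph {f g : L2} :
    (f, g) ∈ weakDeriv.graph ↔ (f, (-Complex.I) • g) ∈ (Amax 0).graph := by
  rw [mem_Amax_graph, weakDeriv, distOp_graph]
  refine forall_congr' fun φ => ?_
  have h1 : ∫ x in Ioi 0, ((-Complex.I) • g : L2) x * φ x = -Complex.I * ∫ x in Ioi 0, g x * φ x := by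
    rw [← integral_const_mul]
    refine integral_congr_ae ?_
    filter_upwards [Lp.coeFn_smul (-Complex.I) g] with x hx
    rw [hx, Pi.smul_apply, smul_eq_mul]; ring
  have h2 : ∫ x in Ioi 0, f x * (Complex.I * deriv φ x + Complex.I * ((0 : ℝ) / x) * φ x)
      = -Complex.I * ∫ x in Ioi 0, f x * (-deriv φ x) := by
    rw [← integral_const_mul]
    refine integral_halfLine_congr fun x _ => ?_
    simp only [Complex.ofReal_zero, zero_div]; ring
  rw [h1, h2]
  exact (mul_right_inj' (neg_ne_zero.2 Complex.I_ne_zero)).symm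

theorem H01_eq_Amin_zero : H01 = (Amin 0).domain := by
  have hI : ∀ g : L2, (-Complex.I) • (Complex.I • g) = g := fun g => by
    rw [smul_smul, neg_mul, Complex.I_mul_I, neg_neg, one_smul]
  have hG : (weakDeriv.domRestrict testSubspace).closure.graph
      = (weakDeriv.domRestrict testSubspace).graph.topologicalClosure :=
    closure_graph_of_le (distOp_isClosed _ _) LinearPMap.domRestrict_le
  have key : ∀ a b : L2, (a, b) ∈ (weakDeriv.domRestrict testSubspace).graph ↔
      (a, (-Complex.I) • b) ∈ ((Amax 0).domRestrict testSubspace).graph := fun a b => by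
    rw [mem_domRestrict_graph, mem_domRestrict_graph, mem_weakDeriv_graph]
  have key' : ∀ a b : L2, (a, b) ∈ ((Amax 0).domRestrict testSubspace).graph ↔
      (a, Complex.I • b) ∈ (weakDeriv.domRestrict testSubspace).graph := fun a b => by
    rw [key, hI]
  ext f
  constructor
  · intro hf
    obtain ⟨g, hg⟩ := mem_domain_iff_graph.1 hf
    rw [hG] at hg
    obtain ⟨g', hg', -⟩ := exists_mem_closure_of_bound (C := 1)
      (G' := ((Amax 0).domRestrict testSubspace).graph) (fun a b hab => ⟨_, (key a b).1 hab⟩)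
      (fun a b b' hab hab' => by
        rw [LinearPMap.mem_graph_snd_inj _ hab' ((key a b).1 hab) rfl, norm_smul]; simp) hg
    rw [← Amin_graph] at hg'
    exact mem_domain_iff_graph.2 ⟨g', hg'⟩
  · intro hf
    obtain ⟨g, hg⟩ := mem_domain_iff_graph.1 hf
    rw [Amin_graph] at hg
    obtain ⟨g', hg', -⟩ := exists_mem_closure_of_bound (C := 1)
      (G' := (weakDeriv.domRestrict testSubspace).graph) (fun a b hab => ⟨_, (key' a b).1 hab⟩)
      (fun a b b' hab hab' => by
        rw [LinearPMap.mem_graph_snd_inj _ hab' ((key' a b).1 hab) rfl, norm_smul]; simp) hg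
    rw [← hG] at hg'
    exact mem_domain_iff_graph.2 ⟨g', hg'⟩

theorem H01_eq_Amin {α : ℝ} (hα : α ≠ 1 / 2) : H01 = (Amin α).domain := by
  rw [H01_eq_Amin_zero]
  exact le_antisymm (Amin_domain_le (by norm_num) α) (Amin_domain_le hα 0)

theorem H01_le_Amin (α : ℝ) : H01 ≤ (Amin α).domain := by
  rw [H01_eq_Amin_zero]
  exact Amin_domain_le (by norm_num) α

end Hardy

/-! ### A core for the adjoint -/

section KreinCore

open Filter

theorem Test.norm_dilate_sq (a : ℝ) (ha : 0 < a) (φ : Test) :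
    ‖(φ.dilate a ha).toL2‖ ^ 2 = a⁻¹ * ‖φ.toL2‖ ^ 2 := by
  have e : ∀ u : Test, ‖u.toL2‖ ^ 2 = ∫ x in Ioi 0, ‖u x‖ ^ 2 := by
    intro u
    rw [norm_sq_L2]
    refine integral_congr_ae ?_
    filter_upwards [u.coeFn_toL2] with x hx
    rw [hx]
  rw [e, e]
  have h := integral_comp_mul_left_Ioi (fun x => ‖φ x‖ ^ 2) 0 ha
  rw [mul_zero, smul_eq_mul] at h
  exact h

theorem Test.first_dilate (α a : ℝ) (ha : 0 < a) (φ : Test) :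
    (φ.dilate a ha).first α = (a : ℂ) • (φ.first α).dilate a ha :=
  TestFunction.ext fun x => by
    change -Complex.I * deriv (φ.dilate a ha) x + Complex.I * (α / x * φ (a * x))
      = (a : ℂ) * (-Complex.I * deriv φ (a * x) + Complex.I * (α / ((a * x : ℝ) : ℂ) * φ (a * x)))
    rw [Test.deriv_dilate]
    have ha' : (a : ℂ) ≠ 0 := by exact_mod_cast ha.ne'
    push_cast
    rcases eq_or_ne x 0 with rfl | hx
    · simp; ring
    · have hx' : (x : ℂ) ≠ 0 := by exact_mod_cast hx
      field_simp

theorem Test.integral_rp_mul_dilate (β a : ℝ) (ha : 0 < a) (φ : Test) :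
    ∫ x in Ioi 0, rp β x * φ.dilate a ha x
      = ((a ^ (-β - 1) : ℝ) : ℂ) * ∫ x in Ioi 0, rp β x * φ x := by
  have h := integral_comp_mul_left_Ioi (fun x => rp β x * φ x) 0 ha
  rw [mul_zero] at h
  have h1 : ∫ x in Ioi 0, rp β x * φ.dilate a ha x
      = ((a ^ (-β) : ℝ) : ℂ) * ∫ x in Ioi 0, rp β (a * x) * φ (a * x) := by
    rw [← integral_const_mul]
    refine integral_halfLine_congr fun x hx => ?_
    change rp β x * φ (a * x) = _
    have : rp β x = ((a ^ (-β) : ℝ) : ℂ) * rp β (a * x) := by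
      simp only [rp]
      rw [← Complex.ofReal_mul, Real.mul_rpow ha.le hx.le, ← mul_assoc, ← Real.rpow_add ha,
        neg_add_cancel, Real.rpow_zero, one_mul]
    rw [this]; ring
  rw [h1, h, Real.rpow_sub_one ha.ne', Complex.real_smul]
  push_cast
  ring

/-- As a decreases to 0 the support of φ(a x) moves off to infinity and leaves that of ψ. -/
theorem Test.inner_dilate_eq_zero (φ ψ : Test) :
    ∃ δ > 0, ∀ (a : ℝ) (ha : 0 < a), a < δ → (inner ℂ (φ.dilate a ha).toL2 ψ.toL2 : ℂ) = 0 := by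
  obtain ⟨p, q, hp, hpq, h0, -⟩ := φ.exists_bounds
  obtain ⟨p', q', hp', hpq', h0', -⟩ := ψ.exists_bounds
  refine ⟨p / q', div_pos hp (hp'.trans hpq'), fun a ha had => ?_⟩
  rw [lt_div_iff₀ (by linarith)] at had
  rw [inner_L2]
  refine integral_eq_zero_of_ae ?_
  filter_upwards [(φ.dilate a ha).coeFn_toL2, ψ.coeFn_toL2] with x h1 h2
  rw [h1, h2]
  by_cases hx : x ∈ Ioo p' q'
  · have : (φ.dilate a ha) x = 0 := h0 _ fun h => by nlinarith [h.1, hx.2]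
    rw [this]; simp
  · rw [h0' x hx]; simp

/-- Dilated test functions, normalized in `L²`, tend weakly to zero. -/
theorem Test.exists_norm_inner_dilate_le (φ : Test) (f : L2) {ε : ℝ} (hε : 0 < ε) :
    ∃ δ > 0, ∀ (a : ℝ) (ha : 0 < a), a < δ →
      ‖(inner ℂ (φ.dilate a ha).toL2 f : ℂ)‖ ≤ ‖(φ.dilate a ha).toL2‖ * ε := by
  obtain ⟨g, hg, hfg⟩ := Metric.mem_closure_iff.1 (dense_testSubspace f) ε hε
  obtain ⟨ψ, rfl⟩ := mem_testSubspace_iff.1 hg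
  obtain ⟨δ, hδ, h⟩ := φ.inner_dilate_eq_zero ψ
  refine ⟨δ, hδ, fun a ha had => ?_⟩
  have h1 : (inner ℂ (φ.dilate a ha).toL2 f : ℂ) = inner ℂ (φ.dilate a ha).toL2 (f - ψ.toL2) := by
    rw [inner_sub_right, h a ha had, sub_zero]
  rw [h1]
  refine (norm_inner_le_norm _ _).trans ?_
  rw [dist_eq_norm] at hfg
  gcongr

theorem Test.eq_zero_of_not_pos (φ : Test) {x : ℝ} (hx : ¬ 0 < x) : φ x = 0 :=
  image_eq_zero_of_notMem_tsupport fun hm => hx (φ.tsupport_subset hm)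

theorem Test.ext_of_pos {φ ψ : Test} (h : ∀ x, 0 < x → φ x = ψ x) : φ = ψ :=
  TestFunction.ext fun x => by
    by_cases hx : 0 < x
    · exact h x hx
    · rw [φ.eq_zero_of_not_pos hx, ψ.eq_zero_of_not_pos hx]

/-- The differential expression `A_α` as a linear map on test functions. -/
noncomputable def firstLin (α : ℝ) : Test →ₗ[ℂ] Test where
  toFun φ := φ.first α
  map_add' u v := TestFunction.ext fun x => by
    have hd : deriv (u + v : Test) x = deriv u x + deriv v x :=
      ((u.hasDerivAt x).add (v.hasDerivAt x)).deriv
    change (u + v : Test).first α x = u.first α x + v.first α x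
    simp only [Test.first_apply, hd]
    change _ + Complex.I * (α / x * (u x + v x)) = _
    ring
  map_smul' c u := TestFunction.ext fun x => by
    have hd : deriv (c • u : Test) x = c * deriv u x := ((u.hasDerivAt x).const_smul c).deriv
    change (c • u : Test).first α x = c * u.first α x
    simp only [Test.first_apply, hd]
    change _ + Complex.I * (α / x * (c * u x)) = _
    ring

/-- Multiplication by `x ^ a` as a linear map on test functions. -/
noncomputable def rpMulLin (a : ℝ) : Test →ₗ[ℂ] Test where
  toFun φ := φ.rpMul a
  map_add' u v := TestFunction.ext fun x => mul_add (rp a x) (u x) (v x)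
  map_smul' c u := TestFunction.ext fun x => mul_left_comm (rp a x) c (u x)

theorem Test.rpMul_rpMul_neg (a : ℝ) (φ : Test) : (φ.rpMul (-a)).rpMul a = φ :=
  Test.ext_of_pos fun x hx => by
    rw [Test.rpMul_apply, Test.rpMul_apply, ← mul_assoc, rp_mul_neg a hx, one_mul]

/-- A functional on test functions that annihilates the range of `A_α` is a multiple of
`x ^ (-α)`. -/
theorem exists_eq_const_mul_integral_rp {α : ℝ} (Λ : Test →ₗ[ℂ] ℂ)
    (h : ∀ φ : Test, Λ (φ.first α) = 0) :
    ∃ c : ℂ, ∀ χ : Test, Λ χ = c * ∫ x in Ioi 0, rp (-α) x * χ x := by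
  obtain ⟨c, hc⟩ := exists_eq_const_mul_integral (Λ ∘ₗ rpMulLin α) (fun η => by
    have e : η.derivative.rpMul α = (Complex.I • η.rpMul α : Test).first α :=
      Test.ext_of_pos fun x hx => by
        have hd : deriv (Complex.I • η.rpMul α : Test) x = Complex.I * deriv (η.rpMul α) x :=
          (((η.rpMul α).hasDerivAt x).const_smul Complex.I).deriv
        rw [Test.first_apply, hd, Test.deriv_rpMul _ _ hx]
        change rp α x * deriv η x = -Complex.I * (Complex.I * (rp α x *
          (deriv η x + α / x * η x))) + Complex.I * (α / x * (Complex.I * (rp α x * η x)))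
        linear_combination (rp α x * deriv η x) * Complex.I_sq
    change Λ (η.derivative.rpMul α) = 0
    rw [e]
    exact h _)
  refine ⟨c, fun χ => ?_⟩
  have := hc (χ.rpMul (-α))
  change Λ ((χ.rpMul (-α)).rpMul α) = _ at this
  rw [Test.rpMul_rpMul_neg] at this
  exact this

/-- For `α ≤ 1/2`, a functional on test functions that is bounded in the graph norm
of `A_{-α}` and annihilates the range of `A_α` vanishes. -/
theorem inner_add_inner_first_eq_zero {α : ℝ} (hα : α ≤ 1 / 2) {f g : L2}
    (h : ∀ φ : Test, (inner ℂ (φ.first α).toL2 f : ℂ)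
      + inner ℂ ((φ.first α).first (-α)).toL2 g = 0) (χ : Test) :
    (inner ℂ χ.toL2 f : ℂ) + inner ℂ (χ.first (-α)).toL2 g = 0 := by
  -- The inner product is antilinear in its first slot; conjugating the test function makes the
  -- functional linear.
  let Λ : Test →ₗ[ℂ] ℂ :=
    { toFun := fun η => inner ℂ η.conj.toL2 f + inner ℂ (η.conj.first (-α)).toL2 g
      map_add' := fun u v => by
        have e : (u + v : Test).conj = u.conj + v.conj := TestFunction.ext fun x =>
          map_add (starRingEnd ℂ) (u x) (v x)
        have e2 : (u.conj + v.conj : Test).first (-α) = u.conj.first (-α) + v.conj.first (-α) :=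
          (firstLin (-α)).map_add _ _
        rw [e, e2, Test.toL2_add, Test.toL2_add, inner_add_left, inner_add_left]; ring
      map_smul' := fun c u => by
        have e : (c • u : Test).conj = starRingEnd ℂ c • u.conj := TestFunction.ext fun x =>
          map_mul (starRingEnd ℂ) c (u x)
        have e2 : (starRingEnd ℂ c • u.conj : Test).first (-α)
            = starRingEnd ℂ c • u.conj.first (-α) := (firstLin (-α)).map_smul _ _
        rw [e, e2, Test.toL2_smul, Test.toL2_smul, inner_smul_left, inner_smul_left,
          Complex.conj_conj, RingHom.id_apply, smul_eq_mul]; ring }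
  obtain ⟨c, hc⟩ := exists_eq_const_mul_integral_rp (α := α) Λ (fun φ => by
    have e : (φ.first α).conj = ((-1 : ℂ) • φ.conj : Test).first α := TestFunction.ext fun x => by
      have hd : deriv ((-1 : ℂ) • φ.conj : Test) x = -1 * deriv φ.conj x :=
        ((φ.conj.hasDerivAt x).const_smul (-1 : ℂ)).deriv
      rw [Test.first_conj, Test.first_apply, hd]
      change _ = _ + Complex.I * (α / x * (-1 * φ.conj x))
      push_cast
      ring
    change (inner ℂ (φ.first α).conj.toL2 f : ℂ) + inner ℂ ((φ.first α).conj.first (-α)).toL2 g = 0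
    rw [e]
    exact h _)
  have hcΛ : ∀ u : Test, (inner ℂ u.toL2 f : ℂ) + inner ℂ (u.first (-α)).toL2 g
      = c * ∫ x in Ioi 0, rp (-α) x * u.conj x := by
    intro u
    have := hc u.conj
    change (inner ℂ u.conj.conj.toL2 f : ℂ) + inner ℂ (u.conj.conj.first (-α)).toL2 g = _ at this
    rwa [Test.conj_conj] at this
  -- The functional is c times integration against x^{-α}. On dilates u(a x), multiplied by √a, the
  -- integral side has size |c| a^{α-1/2}, at least |c| when α ≤ 1/2 and a ≤ 1. The other side tends
  -- to 0: the first term by weak convergence, the second because A_{-α} contributes a factor a.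
  have hc0 : c = 0 := by
    obtain ⟨θ, hθ⟩ := exists_test_integral_one
    set u := (θ.rpMul α).conj with hu
    have hu1 : ∫ x in Ioi 0, rp (-α) x * u.conj x = 1 := by
      rw [← hθ]
      refine integral_halfLine_congr fun x hx => ?_
      rw [hu, Test.conj_conj, Test.rpMul_apply, ← mul_assoc, rp_neg_mul α hx, one_mul]
    by_contra hne
    have hpos : 0 < ‖c‖ := norm_pos_iff.2 hne
    set N := ‖u.toL2‖ with hN
    set N' := ‖g‖ * ‖(u.first (-α)).toL2‖ with hN'
    have hN0 : 0 ≤ N := norm_nonneg _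
    have hN'0 : 0 ≤ N' := by positivity
    obtain ⟨δ, hδ, hδf⟩ := u.exists_norm_inner_dilate_le f (ε := ‖c‖ / (4 * (N + 1))) (by positivity)
    -- The three bounds serve the weak convergence, the comparison a^{α-1/2} ≥ 1, and the smallness
    -- of the derivative term; the two error terms are then at most ‖c‖ / 4 each.
    set a := min (min (δ / 2) 1) (‖c‖ / (4 * (N' + 1))) with ha_def
    have ha : 0 < a := by positivity
    have ha1 : a ≤ 1 := (min_le_left _ _).trans (min_le_right _ _)
    have haδ : a < δ := lt_of_le_of_lt ((min_le_left _ _).trans (min_le_left _ _)) (by linarith)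
    have hac : a ≤ ‖c‖ / (4 * (N' + 1)) := min_le_right _ _
    have hs : ∀ v : Test, √a * ‖(v.dilate a ha).toL2‖ = ‖v.toL2‖ := by
      intro v
      have := v.norm_dilate_sq a ha
      rw [← Real.sqrt_sq (norm_nonneg (v.dilate a ha).toL2), this, ← Real.sqrt_mul ha.le,
        ← mul_assoc, mul_inv_cancel₀ ha.ne', one_mul, Real.sqrt_sq (norm_nonneg _)]
    have h1 := hcΛ (u.dilate a ha)
    have h2 : ∫ x in Ioi 0, rp (-α) x * (u.dilate a ha).conj x = ((a ^ (-(-α) - 1) : ℝ) : ℂ) := by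
      have := u.conj.integral_rp_mul_dilate (-α) a ha
      rw [hu1, mul_one] at this
      exact this
    rw [h2] at h1
    have h3 : ‖c‖ * a ^ (-(-α) - 1) ≤ ‖(inner ℂ (u.dilate a ha).toL2 f : ℂ)‖
        + ‖(inner ℂ ((u.dilate a ha).first (-α)).toL2 g : ℂ)‖ := by
      have := norm_add_le (inner ℂ (u.dilate a ha).toL2 f : ℂ)
        (inner ℂ ((u.dilate a ha).first (-α)).toL2 g)
      rw [h1, norm_mul, Complex.norm_real, Real.norm_of_nonneg (by positivity)] at this
      exact this
    have h4 : √a * ‖(inner ℂ (u.dilate a ha).toL2 f : ℂ)‖ ≤ ‖c‖ / 4 := by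
      calc _ ≤ √a * (‖(u.dilate a ha).toL2‖ * (‖c‖ / (4 * (N + 1)))) := by
            gcongr; exact hδf a ha haδ
        _ = N * (‖c‖ / (4 * (N + 1))) := by rw [← mul_assoc, hs]
        _ ≤ (N + 1) * (‖c‖ / (4 * (N + 1))) := by gcongr; linarith
        _ = ‖c‖ / 4 := by field_simp
    have h5 : √a * ‖(inner ℂ ((u.dilate a ha).first (-α)).toL2 g : ℂ)‖ ≤ ‖c‖ / 4 := by
      calc _ ≤ √a * (‖((u.dilate a ha).first (-α)).toL2‖ * ‖g‖) := by
            gcongr; exact norm_inner_le_norm _ _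
        _ = a * N' := by
            rw [Test.first_dilate, Test.toL2_smul, norm_smul, Complex.norm_real,
              Real.norm_of_nonneg ha.le, hN', ← hs (u.first (-α))]; ring
        _ ≤ ‖c‖ / (4 * (N' + 1)) * (N' + 1) := by gcongr; linarith
        _ = ‖c‖ / 4 := by field_simp
    have h6 : 1 ≤ √a * a ^ (-(-α) - 1) := by
      rw [Real.sqrt_eq_rpow, ← Real.rpow_add ha]
      exact Real.one_le_rpow_of_pos_of_le_one_of_nonpos ha ha1 (by linarith)
    have h7 := mul_le_mul_of_nonneg_left h3 (Real.sqrt_nonneg a)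
    nlinarith [mul_le_mul_of_nonneg_left h6 hpos.le]
  have := hcΛ χ
  rwa [hc0, zero_mul] at this

/-- The image of the test functions under `A_α`. -/
noncomputable def firstRange (α : ℝ) : Submodule ℂ L2 where
  carrier := {g | ∃ φ : Test, (φ.toL2, g) ∈ (Amax α).graph}
  zero_mem' := ⟨0, by
    have h : (0 : Test).toL2 = 0 := MemLp.toLp_zero _
    rw [h]; exact (Amax α).graph.zero_mem⟩
  add_mem' := by
    rintro a b ⟨φ, hφ⟩ ⟨ψ, hψ⟩
    exact ⟨φ + ψ, by rw [Test.toL2_add]; exact (Amax α).graph.add_mem hφ hψ⟩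
  smul_mem' := by
    rintro c a ⟨φ, hφ⟩
    exact ⟨c • φ, by rw [Test.toL2_smul]; exact (Amax α).graph.smul_mem c hφ⟩

theorem first_mem_firstRange (α : ℝ) (φ : Test) : (φ.first α).toL2 ∈ firstRange α :=
  ⟨φ, φ.mem_Amax α⟩

/-- Graph orthogonality to the functions A_α φ extends to all test functions, hence to the whole
graph of `Amin (-α)`, and so (f, g) is orthogonal to itself. -/
theorem Amin_core_firstRange {α : ℝ} (hα : α ≤ 1 / 2) : (Amin (-α)).graph ≤
    ((Amin (-α)).domRestrict (firstRange α)).graph.topologicalClosure := by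
  refine mem_closure_of_orthogonal (fun p hp => (mem_domRestrict_graph.1 hp).2)
    (Amin_isClosed _) fun f g hfg h => ?_
  have h1 := inner_add_inner_first_eq_zero hα (f := f) (g := g) fun φ =>
    h _ _ (mem_domRestrict_graph.2 ⟨first_mem_firstRange α φ, (φ.first α).mem_Amin (-α)⟩)
  have h2 : (inner ℂ f f : ℂ) + inner ℂ g g = 0 := by
    rw [Amin_graph] at hfg
    have hcl : IsClosed {p : L2 × L2 | (inner ℂ p.1 f : ℂ) + inner ℂ p.2 g = 0} :=
      isClosed_eq (by fun_prop) continuous_const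
    exact closure_minimal (s := (((Amax (-α)).domRestrict testSubspace).graph : Set (L2 × L2)))
      (fun p hp => by
        obtain ⟨φ, e1, e2⟩ := mem_restrict_iff.1 (show (p.1, p.2) ∈ _ from hp)
        change (inner ℂ p.1 f : ℂ) + inner ℂ p.2 g = 0
        rw [e1, e2]; exact h1 φ) hcl hfg
  rw [inner_self_ofReal, inner_self_ofReal, ← Complex.ofReal_add, Complex.ofReal_eq_zero] at h2
  have h3 := sq_nonneg ‖f‖
  have h4 := sq_nonneg ‖g‖
  exact ⟨norm_eq_zero.1 (pow_eq_zero_iff two_ne_zero |>.1 (by linarith)),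
    norm_eq_zero.1 (pow_eq_zero_iff two_ne_zero |>.1 (by linarith))⟩

end KreinCore

/-! ### Second order operators as products of first order operators -/

section Second

theorem Test.first_first (β : ℝ) (φ : Test) {x : ℝ} (hx : 0 < x) :
    (φ.first β).first (-β) x = -deriv (deriv φ) x + ((β ^ 2 - β) / x ^ 2 : ℝ) * φ x := by
  have hx' : (x : ℂ) ≠ 0 := by exact_mod_cast hx.ne'
  have h3 : HasDerivAt (fun y : ℝ => (β : ℂ) / y) (-β / (x : ℂ) ^ 2) x := by
    have := (((hasDerivAt_id x).ofReal_comp).fun_inv (by simpa using hx')).const_mul (β : ℂ)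
    simpa [div_eq_mul_inv] using this
  have h4 : deriv (φ.first β) x = -Complex.I * deriv (deriv φ) x
      + Complex.I * (-β / (x : ℂ) ^ 2 * φ x + β / x * deriv φ x) :=
    (((φ.derivative.hasDerivAt x).const_mul (-Complex.I)).add
      ((h3.mul (φ.hasDerivAt x)).const_mul Complex.I)).deriv
  rw [Test.first_apply, h4, Test.first_apply]
  push_cast
  field_simp
  linear_combination (x ^ 2 * deriv (deriv φ) x + β * φ x - β ^ 2 * φ x) * Complex.I_sq

/-- Either root β = 1/2 ± m may be used, so the second order equation can be tested in both factored
forms. -/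
theorem mem_Lmax_graph {β m : ℝ} (hβ : β ^ 2 - β = m ^ 2 - 1 / 4) {f g : L2} :
    (f, g) ∈ (Lmax m).graph ↔
      ∀ φ : Test, ∫ x in Ioi 0, g x * φ x = ∫ x in Ioi 0, f x * (φ.first β).first (-β) x := by
  rw [Lmax, distOp_graph]
  refine forall_congr' fun φ => ?_
  have : ∫ x in Ioi 0, f x * (φ.first β).first (-β) x
      = ∫ x in Ioi 0, f x * (-deriv (deriv φ) x + ((m ^ 2 - 1 / 4) / x ^ 2 : ℝ) * φ x) :=
    integral_halfLine_congr fun x hx => by rw [Test.first_first β φ hx, hβ]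
  rw [this]

theorem Lmax_isClosed (m : ℝ) : (Lmax m).IsClosed := distOp_isClosed _ _

theorem Lmin_le_Lmax (m : ℝ) : Lmin m ≤ Lmax m :=
  closure_le_of_le (Lmax_isClosed m) LinearPMap.domRestrict_le

theorem weakFirst_integral {α : ℝ} {f g : ℝ → ℂ} (h : WeakFirst α f g) (φ : Test) :
    ∫ x in Ioi 0, f x * φ.first (-α) x = -∫ x in Ioi 0, g x * φ x := by
  rw [h φ, ← integral_neg]
  refine integral_halfLine_congr fun x _ => ?_
  rw [Test.first_apply]
  push_cast
  ring

theorem mem_Lmax_of_first {β m : ℝ} (hβ : β ^ 2 - β = m ^ 2 - 1 / 4) {f g k : L2}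
    (h1 : (f, g) ∈ (Amax β).graph) (h2 : (g, k) ∈ (Amax (-β)).graph) : (f, k) ∈ (Lmax m).graph := by
  refine (mem_Lmax_graph hβ).2 fun φ => ?_
  rw [weakFirst_integral (mem_Amax_graph.1 h1)]
  have h := weakFirst_integral (mem_Amax_graph.1 h2) φ
  rw [neg_neg] at h
  rw [h, neg_neg]

theorem adjoint_le_adjoint {S T : L2 →ₗ.[ℂ] L2} (hS : Dense (S.domain : Set L2)) (h : S ≤ T) :
    T.adjoint ≤ S.adjoint :=
  le_of_graph fun _ _ hfg => (mem_adjoint_graph hS).2 fun a b hab =>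
    (mem_adjoint_graph (hS.mono h.1)).1 hfg a b (graph_of_le h hab)

variable {β m : ℝ} {T : L2 →ₗ.[ℂ] L2}

/-- From T ⊇ `Amin β` follows T* ⊆ `Amax (-β)`, so T*T acts as the distributional composition A_{-β}
A_β. -/
theorem adjoint_mul_le_Lmax (hβ : β ^ 2 - β = m ^ 2 - 1 / 4) (h1 : Amin β ≤ T) (h2 : T ≤ Amax β) :
    prodOp T.adjoint T ≤ Lmax m := by
  refine le_of_graph fun f k hfk => ?_
  obtain ⟨g, hg, hk⟩ := mem_prodOp_graph.1 hfk
  have h3 := graph_of_le (adjoint_le_adjoint (dense_Amin β) h1) hk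
  rw [Amin_adjoint] at h3
  exact mem_Lmax_of_first hβ (graph_of_le h2 hg) h3

theorem Test.mem_adjoint_mul (h1 : Amin β ≤ T) (h2 : T ≤ Amax β) (φ : Test) :
    (φ.toL2, ((φ.first β).first (-β)).toL2) ∈ (prodOp T.adjoint T).graph := by
  refine mem_prodOp_graph.2 ⟨_, graph_of_le h1 (φ.mem_Amin β),
    graph_of_le (adjoint_le_adjoint ((dense_Amin β).mono h1.1) h2) ?_⟩
  rw [Amax_adjoint]
  exact (φ.first β).mem_Amin (-β)

theorem IsSelfAdjoint.isClosed {A : L2 →ₗ.[ℂ] L2} (hA : IsSelfAdjoint A) : A.IsClosed := by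
  have h : A.adjoint = A := LinearPMap.isSelfAdjoint_def.1 hA
  have := adjoint_isClosed' hA.dense_domain
  rwa [h] at this

/-- T*T contains L_m on test functions and is closed, being self-adjoint. -/
theorem Lmin_le_adjoint_mul (hβ : β ^ 2 - β = m ^ 2 - 1 / 4) (h1 : Amin β ≤ T) (h2 : T ≤ Amax β)
    (hT : T.IsClosed) : Lmin m ≤ prodOp T.adjoint T := by
  refine closure_le_of_le
    (IsSelfAdjoint.isClosed (isSelfAdjoint_adjoint_mul ((dense_Amin β).mono h1.1) hT)) ?_
  refine le_of_graph fun f g hfg => ?_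
  obtain ⟨hf, hfg⟩ := mem_domRestrict_graph.1 hfg
  obtain ⟨φ, rfl⟩ := mem_testSubspace_iff.1 hf
  have h3 := Test.mem_adjoint_mul h1 h2 φ
  have h4 := LinearPMap.mem_graph_snd_inj _ hfg
    (graph_of_le (adjoint_mul_le_Lmax hβ h1 h2) h3) rfl
  rwa [h4]

theorem sq_sub_half_add (m : ℝ) : (1 / 2 + m) ^ 2 - (1 / 2 + m) = m ^ 2 - 1 / 4 := by ring

theorem sq_sub_half_sub (m : ℝ) : (1 / 2 - m) ^ 2 - (1 / 2 - m) = m ^ 2 - 1 / 4 := by ring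

theorem Test.mem_Lmax (hβ : β ^ 2 - β = m ^ 2 - 1 / 4) (φ : Test) :
    (φ.toL2, ((φ.first β).first (-β)).toL2) ∈ (Lmax m).graph :=
  mem_Lmax_of_first hβ (φ.mem_Amax β) ((φ.first β).mem_Amax (-β))

theorem Lmin_graph (m : ℝ) :
    (Lmin m).graph = ((Lmax m).domRestrict testSubspace).graph.topologicalClosure :=
  closure_graph_of_le (Lmax_isClosed m) LinearPMap.domRestrict_le

theorem Lmin_isClosed (m : ℝ) : (Lmin m).IsClosed := by
  rw [LinearPMap.IsClosed, Lmin_graph]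
  exact Submodule.isClosed_topologicalClosure _

theorem Test.mem_Lmin (hβ : β ^ 2 - β = m ^ 2 - 1 / 4) (φ : Test) :
    (φ.toL2, ((φ.first β).first (-β)).toL2) ∈ (Lmin m).graph := by
  rw [Lmin_graph]
  exact Submodule.le_topologicalClosure _
    (mem_domRestrict_graph.2 ⟨φ.toL2_mem, φ.mem_Lmax hβ⟩)

theorem testSubspace_le_Lmin (m : ℝ) : testSubspace ≤ (Lmin m).domain := fun f hf => by
  obtain ⟨φ, rfl⟩ := mem_testSubspace_iff.1 hf
  exact mem_domain_iff_graph.2 ⟨_, φ.mem_Lmin (sq_sub_half_add m)⟩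

theorem dense_Lmin (m : ℝ) : Dense ((Lmin m).domain : Set L2) :=
  dense_domain_of_test (testSubspace_le_Lmin m)

theorem Lmin_adjoint_le (m : ℝ) : (Lmin m).adjoint ≤ Lmax m := by
  refine le_of_graph fun f g hfg => (mem_Lmax_graph (sq_sub_half_add m)).2 fun φ => ?_
  set β := 1 / 2 + m with hβ
  have h := (mem_adjoint_graph (dense_Lmin m)).1 hfg _ _ (φ.conj.mem_Lmin (sq_sub_half_add m))
  rw [Test.inner_toL2, Test.inner_toL2, Test.conj_conj] at h
  rw [← h]
  refine integral_halfLine_congr fun x hx => ?_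
  have hd : deriv (deriv φ.conj) x = starRingEnd ℂ (deriv (deriv φ) x) := by
    have e : deriv φ.conj = φ.derivative.conj := funext fun y => φ.deriv_conj y
    rw [e, Test.deriv_conj]; rfl
  rw [Test.conj_apply, ← hβ, Test.first_first _ _ hx, Test.first_first _ _ hx, hd, map_add, map_neg,
    map_mul, Complex.conj_conj, Complex.conj_ofReal, Test.conj_apply, Complex.conj_conj]

end Second

/-! ### The operator `H_m` -/

section Hamiltonian

open Filter

variable {ξ : ℝ → ℂ} {m : ℝ}

theorem cutoffElt_mem_adjoint_mul (hξ : IsCutoff ξ) {a : ℝ} (ha : -1 / 2 < a) :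
    (cutoffElt hξ ha, (((-Complex.I) • hξ.derivTest.rpMul a : Test).first (-a)).toL2)
      ∈ (prodOp (Amax a).adjoint (Amax a)).graph := by
  refine mem_prodOp_graph.2 ⟨_, cutoffElt_mem_Amax hξ ha, ?_⟩
  rw [Amax_adjoint]
  exact Test.mem_Amin _ _

/-- H_m and T*T are both restrictions of `Lmax m`, so only domains matter, and D(`Lmin m`) is
already included; the cut-off function is the one thing to check. -/
theorem hamiltonian_le {β : ℝ} {T : L2 →ₗ.[ℂ] L2} (hξ : IsCutoff ξ) (ha : -1 / 2 < 1 / 2 + m)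
    (hβ : β ^ 2 - β = m ^ 2 - 1 / 4) (h1 : Amin β ≤ T) (h2 : T ≤ Amax β) (hT : T.IsClosed)
    (hcut : cutoffElt hξ ha ∈ (prodOp T.adjoint T).domain) :
    hamiltonian m ξ ≤ prodOp T.adjoint T := by
  refine le_of_graph fun f g hfg => ?_
  obtain ⟨hf, hfg⟩ := mem_domRestrict_graph.1 hfg
  have hle : (Lmin m).domain ⊔ cutoffLine m ξ ≤ (prodOp T.adjoint T).domain := by
    refine sup_le (Lmin_le_adjoint_mul hβ h1 h2 hT).1 fun u hu => ?_
    obtain ⟨c, rfl⟩ := (mem_cutoffLine_iff hξ ha).1 hu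
    exact Submodule.smul_mem _ _ hcut
  obtain ⟨k, hk⟩ := mem_domain_iff_graph.1 (hle hf)
  rwa [LinearPMap.mem_graph_snd_inj _ hfg (graph_of_le (adjoint_mul_le_Lmax hβ h1 h2) hk) rfl]

theorem hamiltonian_le_Amax (hξ : IsCutoff ξ) (hm : -1 < m) :
    hamiltonian m ξ ≤ prodOp (Amax (1 / 2 + m)).adjoint (Amax (1 / 2 + m)) :=
  hamiltonian_le hξ (by linarith) (sq_sub_half_add m) (Amin_le_Amax _) le_rfl (Amax_isClosed _)
    (mem_domain_iff_graph.2 ⟨_, cutoffElt_mem_adjoint_mul hξ (by linarith)⟩)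

theorem Lmin_le_hamiltonian (m : ℝ) (ξ : ℝ → ℂ) : Lmin m ≤ hamiltonian m ξ :=
  le_of_graph fun _ _ hfg => mem_domRestrict_graph.2
    ⟨Submodule.mem_sup_left (mem_domain_iff_graph.2 ⟨_, hfg⟩), graph_of_le (Lmin_le_Lmax m) hfg⟩

theorem dense_hamiltonian (m : ℝ) (ξ : ℝ → ℂ) : Dense ((hamiltonian m ξ).domain : Set L2) :=
  (dense_Lmin m).mono (Lmin_le_hamiltonian m ξ).1

theorem cutoffElt_mem_hamiltonian (hξ : IsCutoff ξ) (ha : -1 / 2 < 1 / 2 + m) :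
    (cutoffElt hξ ha, (((-Complex.I) • hξ.derivTest.rpMul (1 / 2 + m) : Test).first
      (-(1 / 2 + m))).toL2) ∈ (hamiltonian m ξ).graph :=
  mem_domRestrict_graph.2 ⟨Submodule.mem_sup_right (cutoffElt_mem_cutoffLine hξ ha),
    graph_of_le (adjoint_mul_le_Lmax (sq_sub_half_add m) (Amin_le_Amax _) le_rfl)
      (cutoffElt_mem_adjoint_mul hξ ha)⟩

/-- The graph is that of the closed operator `Lmin m` plus a single line. -/
theorem hamiltonian_isClosed (hξ : IsCutoff ξ) (hm : -1 < m) : (hamiltonian m ξ).IsClosed := by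
  have ha : -1 / 2 < 1 / 2 + m := by linarith
  have he := cutoffElt_mem_hamiltonian hξ ha
  set p := (cutoffElt hξ ha, (((-Complex.I) • hξ.derivTest.rpMul (1 / 2 + m) : Test).first
      (-(1 / 2 + m))).toL2) with hp
  have h : (hamiltonian m ξ).graph = (Lmin m).graph ⊔ Submodule.span ℂ {p} := by
    refine le_antisymm ?_ (sup_le (LinearPMap.le_graph_of_le (Lmin_le_hamiltonian m ξ))
      ((Submodule.span_singleton_le_iff_mem _ _).2 he))
    rintro ⟨f, g⟩ hfg
    obtain ⟨hf, hfg'⟩ := mem_domRestrict_graph.1 hfg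
    obtain ⟨u, hu, w, hw, huw⟩ := Submodule.mem_sup.1 hf
    obtain ⟨c, rfl⟩ := (mem_cutoffLine_iff hξ ha).1 hw
    obtain ⟨k, hk⟩ := mem_domain_iff_graph.1 hu
    have h1 : (u, k) + c • p ∈ (Lmin m).graph ⊔ Submodule.span ℂ {p} :=
      Submodule.add_mem_sup hk (Submodule.smul_mem _ _ (Submodule.mem_span_singleton_self p))
    have h2 : (u, k) + c • p ∈ (hamiltonian m ξ).graph :=
      Submodule.add_mem _ (LinearPMap.le_graph_of_le (Lmin_le_hamiltonian m ξ) hk)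
        (Submodule.smul_mem _ c he)
    have h3 : ((u, k) + c • p).1 = f := huw
    have h4 : g = ((u, k) + c • p).2 := LinearPMap.mem_graph_snd_inj _ hfg h2 h3.symm
    have h5 : (f, g) = (u, k) + c • p := Prod.ext h3.symm h4
    rw [h5]
    exact h1
  rw [LinearPMap.IsClosed, h]
  exact Submodule.isClosed_sup_finiteDimensional _ _ (Lmin_isClosed m)

/-- Solutions of the second order equation solve a system of first order equations. -/
theorem exists_system {α : ℝ} (hα : α ^ 2 - α = m ^ 2 - 1 / 4) {u g : L2}
    (h : (u, g) ∈ (Lmax m).graph) :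
    ∃ F K : ℝ → ℂ, IsPrim F (fun x => Complex.I * (rp (-α) x * (rp (-α) x * K x))) ∧
      (u =ᵐ[halfLine] fun x => rp α x * F x) ∧ IsPrim K (fun x => Complex.I * (rp α x * g x)) := by
  have hK₀ := (isPrim_integral (locallyIntegrableOn_rp_mul α (L2.locallyIntegrableOn g))).const_mul
    Complex.I
  set K₀ : ℝ → ℂ := fun x => Complex.I * ∫ t in (1 : ℝ)..x, rp α t * g t with hK₀def
  have hloc : ∀ K : ℝ → ℂ, ContinuousOn K (Ioi 0) →
      LocallyIntegrableOn (fun x => rp (-α) x * K x) (Ioi 0) := fun K hK =>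
    ((continuousOn_rp _).mul hK).locallyIntegrableOn measurableSet_Ioi
  have hv₀ : WeakFirst (-α) (fun x => rp (-α) x * K₀ x) g :=
    weakFirst_of_isPrim (by rwa [neg_neg]) (ae_eq_refl _)
  -- The function v₀ = x^{-α} K₀ satisfies A_{-α} v₀ = g. The distribution v₀ - A_α u is annihilated
  -- by A_{-α}, hence equals c x^{-α}; the constant is absorbed into K = K₀ - c.
  obtain ⟨c, hc⟩ := exists_eq_const_mul_integral_rp (α := α)
    (testPairing u (L2.locallyIntegrableOn u) ∘ₗ firstLin (-α) +
      testPairing _ (hloc K₀ hK₀.continuousOn)) (fun φ => by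
    change (∫ x in Ioi 0, u x * (φ.first α).first (-α) x)
      + ∫ x in Ioi 0, rp (-α) x * K₀ x * φ.first α x = 0
    have h1 := weakFirst_integral hv₀ φ
    rw [neg_neg] at h1
    rw [← (mem_Lmax_graph hα).1 h φ, h1, add_neg_cancel])
  have hK := hK₀.const_add (-c)
  have hw : WeakFirst α u (fun x => rp (-α) x * (-c + K₀ x)) := by
    intro χ
    have h1 := hc χ
    change (∫ x in Ioi 0, u x * χ.first (-α) x) + ∫ x in Ioi 0, rp (-α) x * K₀ x * χ x = _ at h1
    have h2 : ∫ x in Ioi 0, u x * (Complex.I * deriv χ x + Complex.I * (α / x) * χ x)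
        = -∫ x in Ioi 0, u x * χ.first (-α) x := by
      rw [← integral_neg]
      refine integral_halfLine_congr fun x _ => ?_
      rw [Test.first_apply]; push_cast; ring
    have h3 : ∫ x in Ioi 0, rp (-α) x * (-c + K₀ x) * χ x = (∫ x in Ioi 0, rp (-α) x * K₀ x * χ x)
        - c * ∫ x in Ioi 0, rp (-α) x * χ x := by
      rw [← integral_const_mul, ← integral_sub
        (LocallyIntegrableOn.integrable_mul_test (hloc K₀ hK₀.continuousOn) χ)
        ((LocallyIntegrableOn.integrable_mul_test
          ((continuousOn_rp (-α)).locallyIntegrableOn measurableSet_Ioi) χ).const_mul c)]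
      refine integral_halfLine_congr fun x _ => ?_
      ring
    rw [h2, h3]
    linear_combination h1
  obtain ⟨F, hF, hu⟩ := (weakFirst_iff (L2.locallyIntegrableOn u) (hloc _ hK.continuousOn)).1 hw
  exact ⟨F, _, hF, hu, hK⟩

/-- If `u` and `A_{-α} A_α u` are square integrable near infinity, so is `A_α u`. -/
theorem memLp_of_system {α : ℝ} {u g : L2} {F K : ℝ → ℂ} {C : ℝ}
    (hF : IsPrim F (fun x => Complex.I * (rp (-α) x * (rp (-α) x * K x))))
    (hu : u =ᵐ[halfLine] fun x => rp α x * F x) (hK : IsPrim K (fun x => Complex.I * (rp α x * g x)))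
    (hC : ∀ x, 0 < x → x ≤ 1 → ‖rp (-α) x * K x‖ ≤ C) :
    MemLp (fun x => rp (-α) x * K x) 2 halfLine := by
  set v : ℝ → ℂ := fun x => rp (-α) x * K x with hv
  have hvc : ContinuousOn v (Ioi 0) := (continuousOn_rp _).mul hK.continuousOn
  -- With v = A_α u, P' = |v|² - ū g, and the derivative of |F|² is 2 x^{-2α} Re P. If ∫ |v|² became
  -- too large, Re P would be at least 1 from some point on, and |F|² would grow so fast that u
  -- could not be square integrable.
  set P : ℝ → ℂ := fun x => Complex.I * (starRingEnd ℂ (F x) * K x) with hP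
  have hPp : IsPrim P (fun x => ((‖v x‖ ^ 2 : ℝ) : ℂ) - starRingEnd ℂ (u x) * g x) := by
    refine ((hF.conj.mul hK).const_mul Complex.I).congr ?_
    filter_upwards [hu] with x hx
    rw [hx, ← Complex.normSq_eq_norm_sq, Complex.normSq_eq_conj_mul_self, hv]
    simp only [map_mul, Complex.conj_I, conj_rp]
    linear_combination (starRingEnd ℂ (F x) * rp α x * g x
      - rp (-α) x ^ 2 * starRingEnd ℂ (K x) * K x) * Complex.I_sq
  have hPc := hPp.continuousOn
  set W : ℝ → ℝ := fun x => (P x).re with hW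
  have hWc : ContinuousOn W (Ioi 0) := Complex.continuous_re.comp_continuousOn hPc
  have hN : IsPrim (fun x => starRingEnd ℂ (F x) * F x)
      (fun x => ((2 * x ^ (-2 * α) * W x : ℝ) : ℂ)) := by
    refine (hF.conj.mul hF).congr (ae_halfLine_of_forall fun x hx => ?_)
    have h1 : rp (-α) x * rp (-α) x = ((x ^ (-2 * α) : ℝ) : ℂ) := by
      rw [← rp_add _ _ hx, rp]; congr 2; ring
    have h2 : ((2 * W x : ℝ) : ℂ) = P x + starRingEnd ℂ (P x) := by
      rw [Complex.add_conj]
    have h3 : ((2 * x ^ (-2 * α) * W x : ℝ) : ℂ)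
        = rp (-α) x * rp (-α) x * ((2 * W x : ℝ) : ℂ) := by
      rw [h1]; push_cast; ring
    refine Eq.trans ?_ h3.symm
    rw [h2, hP]
    simp only [map_mul, Complex.conj_I, conj_rp, Complex.conj_conj]
    ring
  have hqi := L2.integrable_mul u g
  set B := ∫ x in Ioi 0, ‖starRingEnd ℂ (u x) * g x‖ with hB
  have hsqc : ContinuousOn (fun x => ‖v x‖ ^ 2) (Ioi 0) := hvc.norm.pow 2
  have hii : ∀ {a b : ℝ}, 0 < a → 0 < b → IntervalIntegrable (fun x => ‖v x‖ ^ 2) volume a b :=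
    fun ha hb => (hsqc.mono fun _ hx => pos_of_mem_uIcc ha hb hx).intervalIntegrable
  have hiiC : ∀ {a b : ℝ}, 0 < a → 0 < b →
      IntervalIntegrable (fun x => ((‖v x‖ ^ 2 : ℝ) : ℂ)) volume a b := fun ha hb =>
    intervalIntegrable_of_continuousOn (Complex.continuous_ofReal.comp_continuousOn hsqc) ha hb
  have hWeq : ∀ x, 1 ≤ x → W 1 + (∫ t in (1 : ℝ)..x, ‖v t‖ ^ 2) - B ≤ W x := by
    intro x hx
    have hx0 : 0 < x := one_pos.trans_le hx
    have hgi : IntervalIntegrable (fun t => starRingEnd ℂ (u t) * g t) volume 1 x :=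
      intervalIntegrable_of_locallyIntegrableOn
        (locallyIntegrableOn_of_locallyIntegrable_restrict hqi.locallyIntegrable) one_pos hx0
    have h1 := congrArg Complex.re (hPp.sub_eq one_pos hx0)
    rw [intervalIntegral.integral_sub (hiiC one_pos hx0) hgi,
      intervalIntegral.integral_ofReal, Complex.sub_re, Complex.sub_re, Complex.ofReal_re] at h1
    have h2 : ‖∫ t in (1 : ℝ)..x, starRingEnd ℂ (u t) * g t‖ ≤ B := by
      refine (intervalIntegral.norm_integral_le_integral_norm hx).trans ?_
      rw [intervalIntegral.integral_of_le hx]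
      exact setIntegral_mono_set hqi.norm (Eventually.of_forall fun t => norm_nonneg _)
        (Eventually.of_forall fun t ht => one_pos.trans ht.1)
    have h3 := (Complex.re_le_norm (∫ t in (1 : ℝ)..x, starRingEnd ℂ (u t) * g t)).trans h2
    change W x - W 1 = _ at h1
    linarith
  have hbound : ∀ x, 1 ≤ x → ∫ t in (1 : ℝ)..x, ‖v t‖ ^ 2 ≤ 1 + |W 1| + B := by
    intro x₀ hx₀
    by_contra hcon
    rw [not_le] at hcon
    have hW1 : ∀ x, x₀ ≤ x → 1 ≤ W x := by
      intro x hx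
      have h1 := hWeq x (hx₀.trans hx)
      have h2 : ∫ t in (1 : ℝ)..x₀, ‖v t‖ ^ 2 ≤ ∫ t in (1 : ℝ)..x, ‖v t‖ ^ 2 :=
        intervalIntegral.integral_mono_interval le_rfl hx₀ hx
          (Eventually.of_forall fun t => by positivity) (hii one_pos (by linarith))
      have h3 := neg_abs_le (W 1)
      linarith
    -- The constant k gives k x^{-2α} ≤ t^{-2α} for t in [x/2, x] whatever the sign of α; x > 2 x₀
    -- keeps this interval in the region where W ≥ 1.
    set k := min 1 ((2 : ℝ) ^ (2 * α)) with hk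
    have hk0 : 0 < k := lt_min one_pos (by positivity)
    refine false_of_le_at_top (L2.integrable_sq u) (c := k) (M := 2 * x₀) hk0 ?_
    filter_upwards [hu] with x hx hxM
    have hx0 : 0 < x := by linarith
    have hN1 := hN.sub_eq (a := x / 2) (b := x) (by linarith) hx0
    rw [intervalIntegral.integral_ofReal] at hN1
    have e : ∀ y, starRingEnd ℂ (F y) * F y = ((‖F y‖ ^ 2 : ℝ) : ℂ) := fun y => by
      rw [← Complex.normSq_eq_norm_sq, Complex.normSq_eq_conj_mul_self]
    rw [e, e, ← Complex.ofReal_sub, Complex.ofReal_inj] at hN1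
    have h4 : ∫ _t in (x / 2)..x, 2 * (k * x ^ (-2 * α))
        ≤ ∫ t in (x / 2)..x, 2 * t ^ (-2 * α) * W t := by
      refine intervalIntegral.integral_mono_on (by linarith) (by simp) ?_ fun t ht => ?_
      · refine ContinuousOn.intervalIntegrable fun t ht => ?_
        have ht0 : 0 < t := pos_of_mem_uIcc (by linarith) hx0 ht
        exact ((continuousAt_const.mul (Real.continuousAt_rpow_const t _ (Or.inl ht0.ne'))).mul
          (hWc.continuousAt (isOpen_Ioi.mem_nhds ht0))).continuousWithinAt
      · have ht0 : 0 < t := by linarith [ht.1]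
        have h5 := hW1 t (by linarith [ht.1])
        have h6 : k * x ^ (-2 * α) ≤ t ^ (-2 * α) := by
          rcases le_total 0 α with h0 | h0
          · calc k * x ^ (-2 * α) ≤ 1 * x ^ (-2 * α) := by gcongr; exact min_le_left _ _
              _ = x ^ (-2 * α) := one_mul _
              _ ≤ t ^ (-2 * α) := Real.rpow_le_rpow_of_nonpos ht0 ht.2 (by linarith)
          · calc k * x ^ (-2 * α) ≤ 2 ^ (2 * α) * x ^ (-2 * α) := by
                  gcongr; exact min_le_right _ _
              _ = (x / 2) ^ (-2 * α) := by
                  rw [Real.div_rpow hx0.le (by norm_num), neg_mul, Real.rpow_neg zero_le_two,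
                    div_inv_eq_mul, mul_comm]
              _ ≤ t ^ (-2 * α) := Real.rpow_le_rpow (by linarith) ht.1 (by linarith)
        have h7 : 0 < t ^ (-2 * α) := by positivity
        nlinarith
    rw [← hN1, intervalIntegral.integral_const, smul_eq_mul] at h4
    have h5 : k * x ^ (-2 * α) ≤ ‖F x‖ ^ 2 := by
      have h6 : 0 < k * x ^ (-2 * α) := by positivity
      nlinarith [sq_nonneg ‖F (x / 2)‖, mul_le_mul_of_nonneg_right (show 1 ≤ x by linarith) h6.le]
    rw [hx, norm_mul, mul_pow, norm_rp α hx0]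
    calc k = (x ^ α) ^ 2 * (k * x ^ (-2 * α)) := by
          rw [← Real.rpow_natCast (x ^ α), ← Real.rpow_mul hx0.le, mul_left_comm,
            ← Real.rpow_add hx0]
          rw [show α * ((2 : ℕ) : ℝ) + -2 * α = 0 by push_cast; ring, Real.rpow_zero, mul_one]
      _ ≤ _ := by gcongr
  have hinf : IntegrableOn (fun x => ‖v x‖ ^ 2) (Ioi 1) := by
    refine integrableOn_Ioi_of_intervalIntegral_norm_bounded (1 + |W 1| + B) 1 (b := id)
      (l := atTop) (fun x => ?_) tendsto_id ?_
    · rcases le_total 1 x with hx | hx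
      · exact (intervalIntegrable_iff_integrableOn_Ioc_of_le hx).1
          (hii one_pos (one_pos.trans_le hx))
      · simp [Ioc_eq_empty_of_le hx]
    · filter_upwards [eventually_ge_atTop 1] with x hx
      simpa only [Real.norm_of_nonneg (sq_nonneg _), id] using hbound x hx
  rw [memLp_two_iff_integrable_sq_norm (hvc.aestronglyMeasurable measurableSet_Ioi)]
  have h0 : IntegrableOn (fun x => ‖v x‖ ^ 2) (Ioc 0 1) := by
    refine Integrable.mono' (g := fun _ => C ^ 2) (by simp) ?_ ?_
    · exact (hsqc.mono Ioc_subset_Ioi_self).aestronglyMeasurable measurableSet_Ioc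
    · filter_upwards [ae_restrict_mem measurableSet_Ioc] with x hx
      rw [Real.norm_of_nonneg (sq_nonneg _)]
      have := hC x hx.1 hx.2
      gcongr
  have h1 : IntegrableOn (fun x => ‖v x‖ ^ 2) (Ioi 0) := by
    rw [← Ioc_union_Ioi_eq_Ioi (zero_le_one (α := ℝ))]
    exact h0.union hinf
  exact h1

end Hamiltonian

/-! ### Factorizations of H_m, and its equality with the minimal and maximal operators for m ≥ 1 -/

section Factorization

open Filter

variable {ξ : ℝ → ℂ} {m : ℝ}

/-- When K(0) = 0, Cauchy–Schwarz gives K = O(x^{α+1/2}), so v = x^{-α} K is O(√x). It is then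
square integrable and satisfies the criterion for D(`Amin (-α)`), the domain of the adjoint of `Amax
α`. -/
theorem mem_adjoint_mul_of_tendsto {α : ℝ} (hα : -1 / 2 < α) {u g : L2} {F K : ℝ → ℂ}
    (hF : IsPrim F (fun x => Complex.I * (rp (-α) x * (rp (-α) x * K x))))
    (hu : u =ᵐ[halfLine] fun x => rp α x * F x) (hK : IsPrim K (fun x => Complex.I * (rp α x * g x)))
    (h0 : Tendsto K (𝓝[>] 0) (𝓝 0)) : (u, g) ∈ (prodOp (Amax α).adjoint (Amax α)).graph := by
  obtain ⟨c, hc, hlim⟩ := hK.exists_eq_add_integral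
    ((integral_rp_mul_le hα g one_pos).1.const_mul Complex.I)
  have hc0 : c = 0 := tendsto_nhds_unique hlim h0
  set C := ‖g‖ / √(2 * α + 1) with hC
  have hb : ∀ x, 0 < x → ‖rp (-α) x * K x‖ ≤ C * √x := by
    intro x hx
    have h2 := (integral_rp_mul_le hα g hx).2
    have h3 : ‖∫ t in (0 : ℝ)..x, Complex.I * (rp α t * g t)‖ ≤ ∫ t in Ioc 0 x, ‖rp α t * g t‖ := by
      rw [intervalIntegral.integral_of_le hx.le]
      refine (norm_integral_le_integral_norm _).trans (le_of_eq ?_)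
      congr 1; ext t
      rw [norm_mul, Complex.norm_I, one_mul]
    rw [norm_mul, norm_rp _ hx, hc x hx, hc0, zero_add]
    calc x ^ (-α) * ‖∫ t in (0 : ℝ)..x, Complex.I * (rp α t * g t)‖
        ≤ x ^ (-α) * (C * x ^ (α + 1 / 2)) := by gcongr; exact h3.trans h2
      _ = C * (x ^ (-α) * x ^ (α + 1 / 2)) := by ring
      _ = _ := by
        have e : x ^ (-α) * x ^ (α + 1 / 2) = √x := by
          rw [← Real.rpow_add hx, Real.sqrt_eq_rpow]; congr 1; ring
        rw [e]
  have hv : MemLp (fun x => rp (-α) x * K x) 2 halfLine := by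
    refine memLp_of_system (C := C) hF hu hK fun x hx hx1 => (hb x hx).trans ?_
    have h1 : √x ≤ 1 := Real.sqrt_le_one.2 hx1
    have h2 : 0 ≤ C := by positivity
    nlinarith
  have hvx := hv.coeFn_toLp
  refine mem_prodOp_graph.2 ⟨hv.toLp _, mem_Amax_graph.2 ?_, ?_⟩
  · refine weakFirst_of_isPrim (hF.congr ?_) hu
    filter_upwards [hvx] with x hx
    rw [hx]
  · rw [Amax_adjoint]
    refine mem_Amin_of_bound (C := C) (mem_Amax_graph.2
      (weakFirst_of_isPrim (F := K) (by rwa [neg_neg]) hvx)) ?_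
    filter_upwards [hvx, ae_restrict_mem measurableSet_Ioi] with x hx hx0 _
    rw [hx]
    exact hb x hx0

/-- Pairing u with ξ ζ_m turns the adjoint relation into the vanishing of the integral of (ξ̄ K)'.
Since ξ vanishes beyond 2, this says K(0) = 0, the boundary condition that puts u in D(T*T). -/
theorem hamiltonian_adjoint_le (hξ : IsCutoff ξ) (hm : -1 < m) :
    (hamiltonian m ξ).adjoint ≤ prodOp (Amax (1 / 2 + m)).adjoint (Amax (1 / 2 + m)) := by
  have ha : -1 / 2 < 1 / 2 + m := by linarith
  refine le_of_graph fun u g hug => ?_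
  obtain ⟨F, K, hF, hu, hK⟩ := exists_system (sq_sub_half_add m) (graph_of_le (Lmin_adjoint_le m)
    (graph_of_le (adjoint_le_adjoint (dense_Lmin m) (Lmin_le_hamiltonian m ξ)) hug))
  refine mem_adjoint_mul_of_tendsto ha hF hu hK ?_
  set α := 1 / 2 + m with hαdef
  set w : Test := (-Complex.I) • hξ.derivTest.rpMul α with hw
  have hpair : (inner ℂ (w.first (-α)).toL2 u : ℂ) = inner ℂ (cutoffElt hξ ha) g :=
    (mem_adjoint_graph (dense_hamiltonian m ξ)).1 hug _ _ (cutoffElt_mem_hamiltonian hξ ha)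
  have hwc : ∀ x, w.conj x = Complex.I * (rp α x * starRingEnd ℂ (deriv ξ x)) := fun x => by
    change starRingEnd ℂ (-Complex.I * (rp α x * deriv ξ x)) = _
    rw [map_mul, map_mul, map_neg, Complex.conj_I, neg_neg, conj_rp]
  set q := fun x => starRingEnd ℂ (deriv ξ x) * K x
    + starRingEnd ℂ (ξ x) * (Complex.I * (rp α x * g x)) with hq
  have hprim : IsPrim (fun x => starRingEnd ℂ (ξ x) * K x) q :=
    ((isPrim_of_hasDerivAt (fun x _ => hξ.hasDerivAt x) hξ.continuous_deriv.continuousOn).conj).mul hK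
  have hi1 : Integrable (fun x => starRingEnd ℂ (deriv ξ x) * K x) halfLine := by
    refine (LocallyIntegrableOn.integrable_mul_test
      (hK.continuousOn.locallyIntegrableOn measurableSet_Ioi) hξ.derivTest.conj).congr
      (Eventually.of_forall fun x => ?_)
    exact mul_comm _ _
  have hae : (fun x => Complex.I * (starRingEnd ℂ (cutoffElt hξ ha x) * g x)) =ᵐ[halfLine]
      fun x => starRingEnd ℂ (ξ x) * (Complex.I * (rp α x * g x)) := by
    filter_upwards [coeFn_cutoffElt hξ ha] with x hx
    rw [hx, map_mul, conj_rp]; ring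
  have hi2 : Integrable (fun x => starRingEnd ℂ (ξ x) * (Complex.I * (rp α x * g x))) halfLine :=
    ((L2.integrable_mul (cutoffElt hξ ha) g).const_mul Complex.I).congr hae
  have hq0 : ∫ x in Ioi 0, q x = 0 := by
    rw [hq, integral_add hi1 hi2, ← integral_congr_ae hae, integral_const_mul, ← inner_L2, ← hpair,
      Test.inner_toL2]
    have h1 : ∫ x in Ioi 0, u x * (w.first (-α)).conj x
        = Complex.I * ∫ x in Ioi 0, starRingEnd ℂ (deriv ξ x) * K x := by
      have h2 : ∫ x in Ioi 0, u x * (w.first (-α)).conj x = ∫ x in Ioi 0, u x *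
          (Complex.I * deriv w.conj x + Complex.I * (α / x) * w.conj x) :=
        integral_halfLine_congr fun x _ => by rw [Test.first_conj, neg_neg]
      rw [h2, ← weakFirst_of_isPrim hF hu w.conj, ← integral_const_mul]
      refine integral_halfLine_congr fun x hx => ?_
      rw [hwc]
      linear_combination (Complex.I * K x * starRingEnd ℂ (deriv ξ x)) * rp_neg_mul α hx
    rw [h1]
    linear_combination (∫ x in Ioi 0, starRingEnd ℂ (deriv ξ x) * K x) * Complex.I_sq
  have hqi : Integrable q halfLine := hi1.add hi2
  obtain ⟨c, hc, hlim⟩ := hprim.exists_eq_add_integral (IntegrableOn.mono_set hqi Ioc_subset_Ioi_self)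
  have hc0 : c = 0 := by
    have h1 := (intervalIntegral_tendsto_integral_Ioi 0 hqi tendsto_id).const_add c
    rw [hq0, add_zero] at h1
    refine tendsto_nhds_unique h1 (tendsto_const_nhds.congr' ?_)
    filter_upwards [eventually_ge_atTop 2] with x hx
    rw [id, ← hc x (by linarith), hξ.eq_zero x hx, map_zero, zero_mul]
  rw [hc0] at hlim
  refine hlim.congr' ?_
  filter_upwards [Ioo_mem_nhdsGT one_pos] with x hx
  rw [hξ.eq_one x hx.2.le, map_one, one_mul]

/-- With T = `Amax (1/2 + m)`, both H_m and its adjoint are contained in the self-adjoint operator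
T*T; taking adjoints of the second inclusion gives T*T ⊆ H_m** = H_m, as H_m is closed. -/
theorem hamiltonian_eq (hξ : IsCutoff ξ) (hm : -1 < m) :
    hamiltonian m ξ = prodOp (Amax (1 / 2 + m)).adjoint (Amax (1 / 2 + m)) := by
  refine le_antisymm (hamiltonian_le_Amax hξ hm) (le_of_graph fun f g hfg => ?_)
  refine mem_graph_of_adjoint (dense_hamiltonian m ξ) (hamiltonian_isClosed hξ hm) fun a b hab => ?_
  exact ((IsSelfAdjoint.mem_graph_iff
    (isSelfAdjoint_adjoint_mul (dense_Amax _) (Amax_isClosed _))).1 hfg a b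
      (graph_of_le (hamiltonian_adjoint_le hξ hm) hab))

theorem hamiltonian_isSelfAdjoint (hξ : IsCutoff ξ) (hm : -1 < m) :
    IsSelfAdjoint (hamiltonian m ξ) := by
  rw [hamiltonian_eq hξ hm]
  exact isSelfAdjoint_adjoint_mul (dense_Amax _) (Amax_isClosed _)

theorem hamiltonian_isPositiveOp (hξ : IsCutoff ξ) (hm : -1 < m) :
    IsPositiveOp (hamiltonian m ξ) := by
  rw [hamiltonian_eq hξ hm]
  exact isPositiveOp_adjoint_mul (dense_Amax _)

/-- For m > 0 the function ξ ζ_m is O(√x), so it lies in D(`Amin (1/2 - m)`). Its image is a test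
function plus a multiple of ξ x^{m-1/2}, which lies in D(`Amax (m - 1/2)`), the domain of the
adjoint. Inclusion between self-adjoint operators is equality. -/
theorem hamiltonian_eq_Amin (hξ : IsCutoff ξ) (hm : 0 < m) :
    hamiltonian m ξ = prodOp (Amin (1 / 2 - m)).adjoint (Amin (1 / 2 - m)) := by
  have ha : -1 / 2 < 1 / 2 + m := by linarith
  have ha' : -1 / 2 < 1 / 2 + m - 1 := by linarith
  refine eq_of_le_of_isSelfAdjoint (hamiltonian_isSelfAdjoint hξ (by linarith))
    (isSelfAdjoint_adjoint_mul (dense_Amin _) (Amin_isClosed _))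
    (hamiltonian_le hξ ha (sq_sub_half_sub m) le_rfl (Amin_le_Amax _) (Amin_isClosed _) ?_)
  have h1 := mem_Amin_of_bound (C := 1) (cutoffElt_mem_Amax' hξ ha ha' (1 / 2 - m)) (by
    filter_upwards [coeFn_cutoffElt hξ ha, ae_restrict_mem measurableSet_Ioi] with x hx hx0 hx1
    have hx0 : 0 < x := hx0
    rw [hx, hξ.eq_one x hx1.le, one_mul, norm_rp _ hx0, one_mul, Real.sqrt_eq_rpow]
    exact Real.rpow_le_rpow_of_exponent_ge hx0 hx1.le (by linarith))
  have hA : (Amin (1 / 2 - m)).adjoint = Amax (1 / 2 + m - 1) := by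
    rw [Amin_adjoint]; congr 1; ring
  have h2 := (Amax (1 / 2 + m - 1)).graph.add_mem
    (Test.mem_Amax (1 / 2 + m - 1) ((-Complex.I) • hξ.derivTest.rpMul (1 / 2 + m)))
    ((Amax (1 / 2 + m - 1)).graph.smul_mem (Complex.I * (((1 / 2 - m : ℝ) : ℂ) - (1 / 2 + m : ℝ)))
      (cutoffElt_mem_Amax hξ ha'))
  rw [← hA] at h2
  exact mem_domain_iff_graph.2 ⟨_, mem_prodOp_graph.2 ⟨_, h1, h2⟩⟩

/-- If K(0) = c ≠ 0, then F' ~ i c x^{-2α} at the origin, with α = 1/2 + m, and u would be of size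
x^{1-α} = x^{1/2-m}, which is not square integrable for m ≥ 1. So the boundary condition holds
automatically. -/
theorem Lmax_le_adjoint_mul (hm : 1 ≤ m) :
    Lmax m ≤ prodOp (Amax (1 / 2 + m)).adjoint (Amax (1 / 2 + m)) := by
  refine le_of_graph fun u g hug => ?_
  obtain ⟨F, K, hF, hu, hK⟩ := exists_system (sq_sub_half_add m) hug
  have ha : -1 / 2 < 1 / 2 + m := by linarith
  refine mem_adjoint_mul_of_tendsto ha hF hu hK ?_
  obtain ⟨c, -, hlim⟩ := hK.exists_eq_add_integral
    ((integral_rp_mul_le ha g one_pos).1.const_mul Complex.I)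
  suffices hc0 : c = 0 by rwa [hc0] at hlim
  by_contra hne
  set α := 1 / 2 + m with hα
  have hpos : 0 < ‖c‖ := norm_pos_iff.2 hne
  obtain ⟨δ, hδ, hδK⟩ := mem_nhdsGT_iff_exists_Ioo_subset.1
    (hlim (Metric.ball_mem_nhds c (half_pos hpos)))
  have hδ0 : 0 < δ := hδ
  -- Comparing F at x and 2x eliminates the integration constant: the increment is at least half of
  -- |c| ∫ t^{-2α} dt, because |K - c| ≤ |c| / 2 on the interval.
  have hF' : ∀ x, 0 < x → 2 * x < δ → ‖c‖ / 2 * (x * (2 * x) ^ (-2 * α)) ≤ ‖F (2 * x)‖ + ‖F x‖ := by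
    intro x hx hxδ
    have h2x : 0 < 2 * x := by linarith
    set r : ℝ → ℂ := fun t => rp (-α) t * rp (-α) t with hr
    have hrc : ContinuousOn r (Ioi 0) := (continuousOn_rp _).mul (continuousOn_rp _)
    have hr2 : ∀ t, 0 < t → r t = ((t ^ (-2 * α) : ℝ) : ℂ) := fun t ht => by
      rw [hr]
      change rp (-α) t * rp (-α) t = _
      rw [← rp_add _ _ ht, rp]; congr 2; ring
    have hrI : IntervalIntegrable (fun t : ℝ => t ^ (-2 * α)) volume x (2 * x) := by
      refine ContinuousOn.intervalIntegrable fun t ht => ?_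
      exact (Real.continuousAt_rpow_const t _
        (Or.inl (pos_of_mem_uIcc hx h2x ht).ne')).continuousWithinAt
    set J := ∫ t in x..(2 * x), t ^ (-2 * α) with hJ
    have hJ1 : x * (2 * x) ^ (-2 * α) ≤ J := by
      have h1 : ∫ _t in x..(2 * x), (2 * x) ^ (-2 * α) ≤ J :=
        intervalIntegral.integral_mono_on (by linarith) (by simp) hrI fun t ht =>
          Real.rpow_le_rpow_of_nonpos (by linarith [ht.1]) ht.2 (by linarith)
      rw [intervalIntegral.integral_const, smul_eq_mul] at h1
      linarith
    have h1 : F (2 * x) - F x = Complex.I * (c * J + ∫ t in x..(2 * x), r t * (K t - c)) := by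
      have h2 : (J : ℂ) = ∫ t in x..(2 * x), r t := by
        rw [hJ, ← intervalIntegral.integral_ofReal]
        exact intervalIntegral.integral_congr fun t ht => (hr2 t (pos_of_mem_uIcc hx h2x ht)).symm
      rw [hF.sub_eq hx h2x, h2, ← intervalIntegral.integral_const_mul,
        ← intervalIntegral.integral_add
          ((intervalIntegrable_of_continuousOn hrc hx h2x).const_mul c)
          (show IntervalIntegrable (fun t => r t * (K t - c)) volume x (2 * x) from
            intervalIntegrable_of_continuousOn
              (hrc.mul (hK.continuousOn.sub continuousOn_const)) hx h2x), ← intervalIntegral.integral_const_mul]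
      refine intervalIntegral.integral_congr fun t _ => ?_
      simp only [hr]; ring
    have h3 : ‖∫ t in x..(2 * x), r t * (K t - c)‖ ≤ ‖c‖ / 2 * J := by
      rw [hJ, ← intervalIntegral.integral_const_mul]
      refine intervalIntegral.norm_integral_le_of_norm_le (by linarith)
        (Eventually.of_forall fun t ht => ?_) (hrI.const_mul _)
      have ht0 : 0 < t := hx.trans ht.1
      have h4 : K t ∈ Metric.ball c (‖c‖ / 2) := hδK ⟨ht0, ht.2.trans_lt hxδ⟩
      rw [mem_ball_iff_norm] at h4
      rw [norm_mul, hr2 t ht0, Complex.norm_real, Real.norm_of_nonneg (by positivity), mul_comm]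
      gcongr
    have hJ0 : 0 ≤ J := le_trans (by positivity) hJ1
    have h4 : ‖c‖ * J ≤ ‖F (2 * x) - F x‖ + ‖c‖ / 2 * J := by
      have h5 : c * (J : ℂ) = -Complex.I * (F (2 * x) - F x) - ∫ t in x..(2 * x), r t * (K t - c) := by
        rw [h1]
        linear_combination (c * J + ∫ t in x..(2 * x), r t * (K t - c)) * Complex.I_sq
      have h6 := norm_sub_le (-Complex.I * (F (2 * x) - F x)) (∫ t in x..(2 * x), r t * (K t - c))
      rw [← h5, norm_mul, norm_mul, norm_neg, Complex.norm_I, one_mul, Complex.norm_real,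
        Real.norm_of_nonneg hJ0] at h6
      linarith
    have h7 := norm_sub_le (F (2 * x)) (F x)
    have h8 := mul_le_mul_of_nonneg_left hJ1 (half_pos hpos).le
    linarith
  have h2u : ∀ᵐ x ∂halfLine, u (2 * x) = rp α (2 * x) * F (2 * x) :=
    (quasi_mul two_pos).ae_eq hu
  -- The lower bound only controls |F(x)| + |F(2x)|, so the contradiction is drawn from |u(x)| +
  -- |u(2x)|, which is again in L².
  have hmem : MemLp (fun x => ((‖u x‖ + ‖u (2 * x)‖ : ℝ) : ℂ)) 2 halfLine := by
    have h2 := memLp_dilate (Real.log 2) u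
    rw [Real.exp_log two_pos] at h2
    have h3 := h2.const_mul ((Real.exp (Real.log 2 / 2) : ℂ)⁻¹)
    have h4 : MemLp (fun x => u (2 * x)) 2 halfLine := by
      refine h3.ae_eq (Eventually.of_forall fun x => ?_)
      change ((Real.exp (Real.log 2 / 2) : ℂ)⁻¹) * (_ * u (2 * x)) = _
      rw [← mul_assoc, inv_mul_cancel₀, one_mul]
      exact_mod_cast (Real.exp_pos _).ne'
    exact ((Lp.memLp u).norm.add h4.norm).ofReal
  refine false_of_le_sqrt_mul_norm hmem (c := ‖c‖ / 2 * 2 ^ (-2 * α)) (δ := min 1 (δ / 2))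
    (by positivity) (by positivity) ?_
  filter_upwards [hu, h2u, ae_restrict_mem measurableSet_Ioi] with x h1 h2 hx hxδ
  have hx : 0 < x := hx
  have hx1 : x ≤ 1 := (hxδ.trans_le (min_le_left _ _)).le
  have h3 := hF' x hx (by linarith [hxδ.trans_le (min_le_right _ _)])
  rw [Complex.norm_real, Real.norm_of_nonneg (by positivity), h1, h2, norm_mul, norm_mul,
    norm_rp α hx, norm_rp α (by linarith)]
  have hα0 : 0 ≤ α := by linarith
  have h4 : x ^ α * (‖F (2 * x)‖ + ‖F x‖) ≤ x ^ α * ‖F x‖ + (2 * x) ^ α * ‖F (2 * x)‖ := by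
    have : x ^ α ≤ (2 * x) ^ α := Real.rpow_le_rpow hx.le (by linarith) hα0
    nlinarith [norm_nonneg (F (2 * x))]
  have h5 : 1 ≤ √x * (x ^ α * (x * x ^ (-2 * α))) := by
    have : ∀ b : ℝ, √x * (x ^ b * (x * x ^ (-2 * b))) = x ^ (1 / 2 + (b + (1 + -2 * b))) := by
      intro b
      rw [Real.sqrt_eq_rpow, Real.rpow_add hx (1 / 2) _, Real.rpow_add hx b _,
        Real.rpow_add hx 1 _, Real.rpow_one]
    rw [this]
    exact Real.one_le_rpow_of_pos_of_le_one_of_nonpos hx hx1 (by linarith)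
  calc ‖c‖ / 2 * 2 ^ (-2 * α)
      ≤ ‖c‖ / 2 * 2 ^ (-2 * α) * (√x * (x ^ α * (x * x ^ (-2 * α)))) :=
        le_mul_of_one_le_right (by positivity) h5
    _ = √x * (x ^ α * (‖c‖ / 2 * (x * (2 * x) ^ (-2 * α)))) := by
        rw [Real.mul_rpow zero_le_two hx.le]; ring
    _ ≤ √x * (x ^ α * (‖F (2 * x)‖ + ‖F x‖)) := by gcongr
    _ ≤ _ := by gcongr

theorem hamiltonian_eq_Lmax (hξ : IsCutoff ξ) (hm : 1 ≤ m) : hamiltonian m ξ = Lmax m := by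
  refine le_antisymm LinearPMap.domRestrict_le ?_
  rw [hamiltonian_eq hξ (by linarith)]
  exact Lmax_le_adjoint_mul hm

/-- For m ≥ 1 the adjoint of `Lmin m` lies in `Lmax m` = H_m; by self-adjointness H_m lies in the
double adjoint of the closed operator `Lmin m`. -/
theorem hamiltonian_eq_Lmin (hξ : IsCutoff ξ) (hm : 1 ≤ m) : hamiltonian m ξ = Lmin m := by
  refine le_antisymm (le_of_graph fun f g hfg => ?_) (Lmin_le_hamiltonian m ξ)
  refine mem_graph_of_adjoint (dense_Lmin m) (Lmin_isClosed m) fun a b hab => ?_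
  have h1 := graph_of_le (Lmin_adjoint_le m) hab
  rw [← hamiltonian_eq_Lmax hξ hm] at h1
  exact (IsSelfAdjoint.mem_graph_iff (hamiltonian_isSelfAdjoint hξ (by linarith))).1 hfg a b h1

end Factorization

/-! ### Homogeneity -/

section Homogeneity

variable {ξ : ℝ → ℂ} {m : ℝ}

theorem coeFn_dilation (τ : ℝ) (f : L2) : dilation τ f =ᵐ[halfLine]
    fun x => (Real.exp (τ / 2) : ℂ) * f (Real.exp τ * x) := (memLp_dilate τ f).coeFn_toLp

theorem integral_comp_exp_mul (τ : ℝ) (h : ℝ → ℂ) : ∫ x in Ioi 0, h (Real.exp τ * x)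
    = ((Real.exp (-τ) : ℝ) : ℂ) * ∫ x in Ioi 0, h x := by
  have := integral_comp_mul_left_Ioi h 0 (Real.exp_pos τ)
  rw [mul_zero, Complex.real_smul, ← Real.exp_neg] at this
  exact this

theorem exp_mul_exp_neg (τ : ℝ) :
    ((Real.exp τ : ℝ) : ℂ) * ((Real.exp (-τ) : ℝ) : ℂ) = 1 := by
  rw [← Complex.ofReal_mul, ← Real.exp_add, add_neg_cancel, Real.exp_zero, Complex.ofReal_one]

theorem dilation_dilation_neg (τ : ℝ) (f : L2) : dilation τ (dilation (-τ) f) = f := by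
  refine Lp.ext ?_
  filter_upwards [coeFn_dilation τ (dilation (-τ) f),
    (quasi_mul (Real.exp_pos τ)).ae_eq (coeFn_dilation (-τ) f)] with x h1 h2
  have h2 : dilation (-τ) f (Real.exp τ * x)
    = (Real.exp (-τ / 2) : ℂ) * f (Real.exp (-τ) * (Real.exp τ * x)) := h2
  rw [h1, h2, ← mul_assoc, ← mul_assoc, ← Complex.ofReal_mul, ← Real.exp_add, ← Real.exp_add]
  simp [neg_div]

theorem inner_dilation (τ : ℝ) (f g : L2) :
    (inner ℂ (dilation τ f) g : ℂ) = inner ℂ f (dilation (-τ) g) := by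
  rw [inner_L2, inner_L2]
  have h1 : ∫ x in Ioi 0, starRingEnd ℂ (f x) * dilation (-τ) g x
      = ((Real.exp (-τ / 2) : ℝ) : ℂ) * ∫ x in Ioi 0, starRingEnd ℂ (f x) * g (Real.exp (-τ) * x) := by
    rw [← integral_const_mul]
    refine integral_congr_ae ?_
    filter_upwards [coeFn_dilation (-τ) g] with x hx
    rw [hx]; ring
  have h2 : ∫ x in Ioi 0, starRingEnd ℂ (dilation τ f x) * g x = ((Real.exp (τ / 2) : ℝ) : ℂ) *
      ∫ x in Ioi 0, starRingEnd ℂ (f (Real.exp τ * x)) * g (Real.exp (-τ) * (Real.exp τ * x)) := by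
    rw [← integral_const_mul]
    refine integral_congr_ae ?_
    filter_upwards [coeFn_dilation τ f] with x hx
    have hinv : Real.exp (-τ) * (Real.exp τ * x) = x := by
      rw [← mul_assoc, ← Real.exp_add, neg_add_cancel, Real.exp_zero, one_mul]
    rw [hx, hinv, map_mul, Complex.conj_ofReal, mul_assoc]
  rw [h1, h2, integral_comp_exp_mul τ fun y => starRingEnd ℂ (f y) * g (Real.exp (-τ) * y),
    ← mul_assoc, ← Complex.ofReal_mul, ← Real.exp_add]
  congr 3
  ring

/-- Change of variables in the weak equation, applied to the dilated test function φ(e^{-τ} x). The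
scaling of H_m follows by applying this to each of its two first order factors. -/
theorem dilation_mem_Amax {α : ℝ} (τ : ℝ) {f g : L2} (h : (f, g) ∈ (Amax α).graph) :
    (dilation τ f, ((Real.exp τ : ℝ) : ℂ) • dilation τ g) ∈ (Amax α).graph := by
  refine mem_Amax_graph.2 fun φ => ?_
  have key := mem_Amax_graph.1 h (φ.dilate (Real.exp (-τ)) (Real.exp_pos _))
  have hinv : ∀ x, Real.exp (-τ) * (Real.exp τ * x) = x := fun x => by
    rw [← mul_assoc, ← Real.exp_add, neg_add_cancel, Real.exp_zero, one_mul]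
  have hc := exp_mul_exp_neg τ
  have h1 : ∫ x in Ioi 0, (((Real.exp τ : ℝ) : ℂ) • dilation τ g : L2) x * φ x
      = ((Real.exp (τ / 2) : ℝ) : ℂ) *
        ∫ x in Ioi 0, g x * φ.dilate (Real.exp (-τ)) (Real.exp_pos _) x := by
    have e := integral_comp_exp_mul τ
      fun y => g y * φ.dilate (Real.exp (-τ)) (Real.exp_pos _) y
    have e2 : ∫ x in Ioi 0, (((Real.exp τ : ℝ) : ℂ) • dilation τ g : L2) x * φ x
        = ((Real.exp τ : ℝ) : ℂ) * ((Real.exp (τ / 2) : ℝ) : ℂ) * ∫ x in Ioi 0, g (Real.exp τ * x) *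
          φ.dilate (Real.exp (-τ)) (Real.exp_pos _) (Real.exp τ * x) := by
      rw [← integral_const_mul]
      refine integral_congr_ae ?_
      filter_upwards [Lp.coeFn_smul ((Real.exp τ : ℝ) : ℂ) (dilation τ g), coeFn_dilation τ g]
        with x hx1 hx2
      have : φ.dilate (Real.exp (-τ)) (Real.exp_pos _) (Real.exp τ * x) = φ x :=
        congrArg φ (hinv x)
      rw [hx1, Pi.smul_apply, hx2, this, smul_eq_mul]; ring
    rw [e2, e]
    linear_combination (((Real.exp (τ / 2) : ℝ) : ℂ) *
        ∫ x in Ioi 0, g x * φ.dilate (Real.exp (-τ)) (Real.exp_pos _) x) * hc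
  rw [h1, key]
  have e := integral_comp_exp_mul τ fun y => f y *
    (Complex.I * deriv (φ.dilate (Real.exp (-τ)) (Real.exp_pos _)) y
      + Complex.I * (α / y) * φ.dilate (Real.exp (-τ)) (Real.exp_pos _) y)
  have e2 : ∫ x in Ioi 0, dilation τ f x * (Complex.I * deriv φ x + Complex.I * (α / x) * φ x)
      = ((Real.exp (τ / 2) : ℝ) : ℂ) * ((Real.exp τ : ℝ) : ℂ) * ∫ x in Ioi 0, f (Real.exp τ * x) *
        (Complex.I * deriv (φ.dilate (Real.exp (-τ)) (Real.exp_pos _)) (Real.exp τ * x)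
        + Complex.I * (α / ((Real.exp τ * x : ℝ) : ℂ)) *
          φ.dilate (Real.exp (-τ)) (Real.exp_pos _) (Real.exp τ * x)) := by
    rw [← integral_const_mul]
    refine integral_congr_ae ?_
    filter_upwards [coeFn_dilation τ f, ae_restrict_mem measurableSet_Ioi] with x hx2 hx
    have hx' : (x : ℂ) ≠ 0 := by exact_mod_cast (ne_of_gt hx)
    have hne : ((Real.exp τ : ℝ) : ℂ) ≠ 0 := by exact_mod_cast (Real.exp_pos τ).ne'
    have h3 : φ.dilate (Real.exp (-τ)) (Real.exp_pos _) (Real.exp τ * x) = φ x :=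
      congrArg φ (hinv x)
    rw [hx2, h3, Test.deriv_dilate, hinv]
    have h4 : (α : ℂ) / ((Real.exp τ * x : ℝ) : ℂ) * ((Real.exp τ : ℝ) : ℂ) = α / x := by
      push_cast
      field_simp
    linear_combination (-((Real.exp (τ / 2) : ℝ) : ℂ) * f (Real.exp τ * x) * Complex.I * φ x) * h4
      - ((Real.exp (τ / 2) : ℝ) : ℂ) * f (Real.exp τ * x) * Complex.I * deriv φ x * hc
  rw [e2, e]
  linear_combination (-((Real.exp (τ / 2) : ℝ) : ℂ) * ∫ x in Ioi 0, f x *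
    (Complex.I * deriv (φ.dilate (Real.exp (-τ)) (Real.exp_pos _)) x
      + Complex.I * (α / x) * φ.dilate (Real.exp (-τ)) (Real.exp_pos _) x)) * hc

theorem dilation_mem_adjoint_Amax {α : ℝ} (τ : ℝ) {f g : L2}
    (h : (f, g) ∈ (Amax α).adjoint.graph) :
    (dilation τ f, ((Real.exp τ : ℝ) : ℂ) • dilation τ g) ∈ (Amax α).adjoint.graph := by
  refine (mem_adjoint_graph' (dense_Amax α)).2 fun a b hab => ?_
  have h1 := (mem_adjoint_graph' (dense_Amax α)).1 h _ _ (dilation_mem_Amax (-τ) hab)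
  rw [inner_dilation, inner_smul_left, inner_dilation, ← h1, inner_smul_right, ← mul_assoc,
    Complex.conj_ofReal, exp_mul_exp_neg, one_mul]

theorem dilation_mem_hamiltonian (hξ : IsCutoff ξ) (hm : -1 < m) (τ : ℝ) {f k : L2}
    (h : (f, k) ∈ (hamiltonian m ξ).graph) : (dilation (-τ) f,
      ((Real.exp (-2 * τ) : ℝ) : ℂ) • dilation (-τ) k) ∈ (hamiltonian m ξ).graph := by
  rw [hamiltonian_eq hξ hm] at h ⊢
  obtain ⟨g, h1, h2⟩ := mem_prodOp_graph.1 h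
  refine mem_prodOp_graph.2 ⟨_, dilation_mem_Amax (-τ) h1, ?_⟩
  have h3 := (Amax (1 / 2 + m)).adjoint.graph.smul_mem ((Real.exp (-τ) : ℝ) : ℂ)
    (dilation_mem_adjoint_Amax (-τ) h2)
  have e : ((Real.exp (-2 * τ) : ℝ) : ℂ) = ((Real.exp (-τ) : ℝ) : ℂ) * ((Real.exp (-τ) : ℝ) : ℂ) := by
    rw [← Complex.ofReal_mul, ← Real.exp_add]; congr 2; ring
  rw [e, ← smul_smul]
  exact h3

theorem hamiltonian_isHomogeneousOp (hξ : IsCutoff ξ) (hm : -1 < m) :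
    IsHomogeneousOp dilation (hamiltonian m ξ) (-2) := by
  intro τ f
  have h := dilation_mem_hamiltonian hξ hm τ ((hamiltonian m ξ).mem_graph f)
  obtain ⟨hd, he⟩ := LinearPMap.mem_graph_iff' _ |>.1 h |> fun ⟨y, hy⟩ =>
    (⟨y, congrArg Prod.fst hy, congrArg Prod.snd hy⟩ :
      ∃ y : (hamiltonian m ξ).domain, (y : L2) = dilation (-τ) (f : L2) ∧
        hamiltonian m ξ y = ((Real.exp (-2 * τ) : ℝ) : ℂ) • dilation (-τ) (hamiltonian m ξ f))
  have hmem : dilation (-τ) (f : L2) ∈ (hamiltonian m ξ).domain := he.1 ▸ hd.2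
  refine ⟨hmem, ?_⟩
  have e : (⟨dilation (-τ) (f : L2), hmem⟩ : (hamiltonian m ξ).domain) = hd := Subtype.ext he.1.symm
  rw [e, he.2, map_smul, dilation_dilation_neg]

end Homogeneity

/-! ### The spectrum -/

section Spectrum

variable {ξ : ℝ → ℂ} {m : ℝ}

/-- The product of a plane wave and a test function. -/
noncomputable def Test.expMul (k : ℝ) (φ : Test) : Test :=
  φ.smoothMul (fun x : ℝ => Complex.exp (Complex.I * k * x)) (by
    have : ContDiff ℝ ∞ fun x : ℝ => Complex.exp (Complex.I * k * x) :=
      (contDiff_const.mul Complex.ofRealCLM.contDiff).cexp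
    exact this.contDiffOn)

@[simp] theorem Test.expMul_apply (k : ℝ) (φ : Test) (x : ℝ) :
    φ.expMul k x = Complex.exp (Complex.I * k * x) * φ x := rfl

theorem Test.norm_expMul (k : ℝ) (φ : Test) : ‖(φ.expMul k).toL2‖ = ‖φ.toL2‖ := by
  have h : ‖(φ.expMul k).toL2‖ ^ 2 = ‖φ.toL2‖ ^ 2 := by
    rw [norm_sq_L2, norm_sq_L2]
    refine integral_congr_ae ?_
    filter_upwards [(φ.expMul k).coeFn_toL2, φ.coeFn_toL2] with x h1 h2
    have h3 : ‖Complex.exp (Complex.I * k * x)‖ = 1 := by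
      rw [Complex.norm_exp]; simp
    rw [h1, h2, Test.expMul_apply, norm_mul, h3, one_mul]
  exact (pow_left_inj₀ (norm_nonneg _) (norm_nonneg _) two_ne_zero).1 h

theorem Test.deriv_expMul (k : ℝ) (φ : Test) (x : ℝ) : deriv (φ.expMul k) x
    = Complex.exp (Complex.I * k * x) * (deriv φ x + Complex.I * k * φ x) := by
  have h1 : HasDerivAt (fun y : ℝ => Complex.I * k * (y : ℂ)) (Complex.I * k) x := by
    simpa using ((hasDerivAt_id x).ofReal_comp).const_mul (Complex.I * k)
  refine (h1.cexp.mul (φ.hasDerivAt x)).deriv.trans ?_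
  ring

/-- The error of the quasimode `e^{ikx} u` of the operator `L_m` at the energy `k²`. -/
noncomputable def Test.quasimodeError (m k : ℝ) (u : Test) : Test :=
  (-1 : ℂ) • u.derivative.derivative + ((-2 * Complex.I * k) • u.derivative +
    ((m ^ 2 - 1 / 4 : ℝ) : ℂ) • u.divX.divX)

theorem Test.first_first_expMul (m k : ℝ) (u : Test) :
    ((u.expMul k).first (1 / 2 + m)).first (-(1 / 2 + m))
      = (u.quasimodeError m k).expMul k + ((k ^ 2 : ℝ) : ℂ) • u.expMul k := by
  refine Test.ext_of_pos fun x hx => ?_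
  have hx' : (x : ℂ) ≠ 0 := by exact_mod_cast hx.ne'
  have h1 : deriv (u.expMul k) = (u.derivative + (Complex.I * k) • u : Test).expMul k :=
    funext fun y => u.deriv_expMul k y
  have h2 : deriv (u.derivative + (Complex.I * k) • u : Test) x
      = deriv (deriv u) x + Complex.I * k * deriv u x :=
    ((u.derivative.hasDerivAt x).add ((u.hasDerivAt x).const_smul (Complex.I * k))).deriv
  rw [Test.first_first _ _ hx, h1, Test.deriv_expMul, h2, sq_sub_half_add]
  change -(Complex.exp (Complex.I * k * x) * (deriv (deriv u) x + Complex.I * k * deriv u x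
      + Complex.I * k * (deriv u x + Complex.I * k * u x)))
      + _ * (Complex.exp (Complex.I * k * x) * u x)
    = Complex.exp (Complex.I * k * x) * (-1 * deriv (deriv u) x
      + (-2 * Complex.I * k * deriv u x + ((m ^ 2 - 1 / 4 : ℝ) : ℂ) *
        (((1 : ℝ) : ℂ) / x * (((1 : ℝ) : ℂ) / x * u x))))
      + ((k ^ 2 : ℝ) : ℂ) * (Complex.exp (Complex.I * k * x) * u x)
  push_cast
  field_simp
  linear_combination (-4 * (k : ℂ) ^ 2 * u x * x ^ 2) * Complex.I_sq

theorem Test.derivative_dilate (a : ℝ) (ha : 0 < a) (φ : Test) :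
    (φ.dilate a ha).derivative = (a : ℂ) • φ.derivative.dilate a ha :=
  TestFunction.ext fun x => φ.deriv_dilate a ha x

theorem Test.divX_dilate (a : ℝ) (ha : 0 < a) (φ : Test) :
    (φ.dilate a ha).divX = (a : ℂ) • φ.divX.dilate a ha :=
  Test.ext_of_pos fun x hx => by
    have hx' : (x : ℂ) ≠ 0 := by exact_mod_cast hx.ne'
    have ha' : (a : ℂ) ≠ 0 := by exact_mod_cast ha.ne'
    change ((1 : ℝ) : ℂ) / x * φ (a * x) = a * (((1 : ℝ) : ℂ) / ((a * x : ℝ) : ℂ) * φ (a * x))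
    push_cast
    field_simp

theorem Test.derivative_smul (c : ℂ) (φ : Test) : (c • φ).derivative = c • φ.derivative :=
  TestFunction.ext fun x => ((φ.hasDerivAt x).const_smul c).deriv

theorem Test.divX_smul (c : ℂ) (φ : Test) : (c • φ).divX = c • φ.divX :=
  TestFunction.ext fun x => mul_left_comm _ c (φ x)

theorem Test.norm_dilate (a : ℝ) (ha : 0 < a) (φ : Test) :
    √a * ‖(φ.dilate a ha).toL2‖ = ‖φ.toL2‖ := by
  have := φ.norm_dilate_sq a ha
  rw [← Real.sqrt_sq (norm_nonneg (φ.dilate a ha).toL2), this, ← Real.sqrt_mul ha.le,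
    ← mul_assoc, mul_inv_cancel₀ ha.ne', one_mul, Real.sqrt_sq (norm_nonneg _)]

/-- Every term of the error contains a derivative or a factor 1/x², so a dilation by a gains at
least one power of a; √a normalizes the dilate in L². -/
theorem Test.exists_norm_quasimodeError_le (m k : ℝ) (θ : Test) : ∃ C, ∀ (a : ℝ) (ha : 0 < a), a ≤ 1 →
    √a * ‖((θ.dilate a ha).quasimodeError m k).toL2‖ ≤ a * C := by
  refine ⟨‖θ.derivative.derivative.toL2‖ + (2 * |k| * ‖θ.derivative.toL2‖
    + |m ^ 2 - 1 / 4| * ‖θ.divX.divX.toL2‖), fun a ha ha1 => ?_⟩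
  have h : ‖((θ.dilate a ha).quasimodeError m k).toL2‖
      ≤ a * (a * ‖(θ.derivative.derivative.dilate a ha).toL2‖) +
        (2 * |k| * (a * ‖(θ.derivative.dilate a ha).toL2‖) +
        |m ^ 2 - 1 / 4| * (a * (a * ‖(θ.divX.divX.dilate a ha).toL2‖))) := by
    simp only [Test.quasimodeError, Test.derivative_dilate, Test.divX_dilate, Test.derivative_smul,
      Test.divX_smul, Test.toL2_add, Test.toL2_smul]
    refine (norm_add_le _ _).trans (add_le_add (le_of_eq ?_) ((norm_add_le _ _).trans
      (add_le_add (le_of_eq ?_) (le_of_eq ?_)))) <;>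
    simp only [norm_smul, norm_neg, norm_one, norm_mul, Complex.norm_I, Complex.norm_real,
      Complex.norm_ofNat, Real.norm_eq_abs, abs_of_pos ha] <;> ring
  have hs := Real.sqrt_nonneg a
  calc √a * ‖((θ.dilate a ha).quasimodeError m k).toL2‖
      ≤ √a * (a * (a * ‖(θ.derivative.derivative.dilate a ha).toL2‖) +
        (2 * |k| * (a * ‖(θ.derivative.dilate a ha).toL2‖) +
        |m ^ 2 - 1 / 4| * (a * (a * ‖(θ.divX.divX.dilate a ha).toL2‖)))) := by gcongr
    _ = a * (a * ‖θ.derivative.derivative.toL2‖ + (2 * |k| * ‖θ.derivative.toL2‖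
        + |m ^ 2 - 1 / 4| * (a * ‖θ.divX.divX.toL2‖))) := by
        rw [← θ.derivative.derivative.norm_dilate a ha, ← θ.derivative.norm_dilate a ha,
          ← θ.divX.divX.norm_dilate a ha]
        ring
    _ ≤ a * (1 * ‖θ.derivative.derivative.toL2‖ + (2 * |k| * ‖θ.derivative.toL2‖
        + |m ^ 2 - 1 / 4| * (1 * ‖θ.divX.divX.toL2‖))) := by gcongr
    _ = _ := by ring

/-- A bounded resolvent at t would give ‖f‖ ≤ ‖R‖ ‖(H_m - t) f‖. The functions e^{i√t x} θ(a x) are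
test functions, so they lie in the domain, and they violate this as a → 0. -/
theorem mem_spec_hamiltonian (ξ : ℝ → ℂ) {t : ℝ} (ht : 0 ≤ t) : (t : ℂ) ∈ spec (hamiltonian m ξ) := by
  rintro ⟨R, hR, -⟩
  have hbound : ∀ f g : L2, (f, g) ∈ (hamiltonian m ξ).graph → ‖f‖ ≤ ‖R‖ * ‖g - (t : ℂ) • f‖ := by
    intro f g hfg
    obtain ⟨y, hy⟩ := (LinearPMap.mem_graph_iff' _).1 hfg
    have h1 : (y : L2) = f := congrArg Prod.fst hy
    have h2 : hamiltonian m ξ y = g := congrArg Prod.snd hy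
    have h3 := hR y
    rw [h2, h1] at h3
    calc ‖f‖ = ‖R (g - (t : ℂ) • f)‖ := by rw [h3]
      _ ≤ _ := R.le_opNorm _
  obtain ⟨θ, hθ⟩ := exists_test_integral_one
  have hθ0 : 0 < ‖θ.toL2‖ := by
    rw [norm_pos_iff]
    intro h0
    have h1 : (θ : ℝ → ℂ) =ᵐ[halfLine] 0 := by
      refine θ.coeFn_toL2.symm.trans ?_
      rw [h0]
      exact Lp.coeFn_zero ℂ 2 halfLine
    rw [integral_congr_ae h1] at hθ
    simp at hθ
  obtain ⟨C, hC⟩ := θ.exists_norm_quasimodeError_le m √t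
  have key : ∀ a, 0 < a → a ≤ 1 → ‖θ.toL2‖ ≤ a * (‖R‖ * C) := by
    intro a ha ha1
    set u := θ.dilate a ha with hu
    have h1 := hbound _ _ (graph_of_le (Lmin_le_hamiltonian m ξ)
      ((u.expMul √t).mem_Lmin (sq_sub_half_add m)))
    rw [Test.first_first_expMul, Test.toL2_add, Test.toL2_smul, Real.sq_sqrt ht, add_sub_cancel_right,
      Test.norm_expMul, Test.norm_expMul] at h1
    calc ‖θ.toL2‖ = √a * ‖u.toL2‖ := (θ.norm_dilate a ha).symm
      _ ≤ √a * (‖R‖ * ‖(u.quasimodeError m √t).toL2‖) := by gcongr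
      _ = ‖R‖ * (√a * ‖(u.quasimodeError m √t).toL2‖) := by ring
      _ ≤ ‖R‖ * (a * C) := mul_le_mul_of_nonneg_left (hC a ha ha1) (norm_nonneg R)
      _ = _ := by ring
  set D := |‖R‖ * C| + 1 with hD
  have hDpos : 0 < D := by positivity
  -- This value of a makes the right-hand side at most ‖θ‖ / 2.
  have h1 := key (min 1 (‖θ.toL2‖ / (2 * D))) (by positivity) (min_le_left _ _)
  have h2 : min 1 (‖θ.toL2‖ / (2 * D)) * (‖R‖ * C) ≤ ‖θ.toL2‖ / (2 * D) * D := by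
    have h3 : ‖R‖ * C ≤ D := by linarith [le_abs_self (‖R‖ * C)]
    have h4 : 0 < min 1 (‖θ.toL2‖ / (2 * D)) := by positivity
    calc _ ≤ min 1 (‖θ.toL2‖ / (2 * D)) * D := by gcongr
      _ ≤ _ := by gcongr; exact min_le_right _ _
  have h5 : ‖θ.toL2‖ / (2 * D) * D = ‖θ.toL2‖ / 2 := by field_simp
  linarith

theorem spec_hamiltonian (hξ : IsCutoff ξ) (hm : -1 < m) :
    spec (hamiltonian m ξ) = {z : ℂ | ∃ t : ℝ, 0 ≤ t ∧ z = t} := by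
  ext z
  constructor
  · intro hz
    by_contra hcon
    exact hz (inResolventSet_of_not_nonneg (hamiltonian_isSelfAdjoint hξ hm)
      (hamiltonian_isPositiveOp hξ hm) hcon)
  · rintro ⟨t, ht, rfl⟩
    exact mem_spec_hamiltonian ξ ht

end Spectrum

/-! ### Extensions and form domains -/

section Extensions

variable {ξ : ℝ → ℂ} {m : ℝ}

theorem Amin_core (α : ℝ) :
    (Amin α).graph ≤ ((Amin α).domRestrict testSubspace).graph.topologicalClosure := by
  conv_lhs => rw [Amin_graph]
  refine Submodule.topologicalClosure_mono ?_
  rintro ⟨f, g⟩ hfg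
  obtain ⟨φ, rfl, rfl⟩ := mem_restrict_iff.1 hfg
  exact mem_domRestrict_graph.2 ⟨φ.toL2_mem, φ.mem_Amin α⟩

theorem isFriedrichsExt_Amin {β : ℝ} (hβ : β ^ 2 - β = m ^ 2 - 1 / 4) :
    IsFriedrichsExt (Lmin m) (prodOp (Amin β).adjoint (Amin β)) :=
  isFriedrichsExt_adjoint_mul (dense_Amin β) (Amin_isClosed β)
    (Lmin_le_adjoint_mul hβ le_rfl (Amin_le_Amax β) (Amin_isClosed β)) (testSubspace_le_Lmin m)
    (Amin_core β)

theorem isKreinExt_Amax {β : ℝ} (hβ : β ^ 2 - β = m ^ 2 - 1 / 4) (h : β ≤ 1 / 2) :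
    IsKreinExt (Lmin m) (prodOp (Amax β).adjoint (Amax β)) := by
  refine isKreinExt_adjoint_mul (dense_Amax β) (Amax_isClosed β)
    (Lmin_le_adjoint_mul hβ (Amin_le_Amax β) le_rfl (Amax_isClosed β)) (D := testSubspace)
    (testSubspace_le_Lmin m) (K := firstRange β) ?_ ?_
  · rintro b ⟨φ, hφ⟩
    exact ⟨_, φ.toL2_mem, hφ⟩
  · rw [Amax_adjoint]
    exact Amin_core_firstRange h

theorem formDomain_Amax (α : ℝ) :
    formDomain (prodOp (Amax α).adjoint (Amax α)) = ((Amax α).domain : Set L2) :=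
  formDomain_adjoint_mul (dense_Amax α) (Amax_isClosed α)

theorem formDomain_Amin (α : ℝ) :
    formDomain (prodOp (Amin α).adjoint (Amin α)) = ((Amin α).domain : Set L2) :=
  formDomain_adjoint_mul (dense_Amin α) (Amin_isClosed α)

theorem formDomain_hamiltonian_of_pos (hξ : IsCutoff ξ) (hm : 0 < m) :
    formDomain (hamiltonian m ξ) = (H01 : Set L2) := by
  rw [hamiltonian_eq_Amin hξ hm, formDomain_Amin, ← H01_eq_Amin (by linarith)]

theorem testSubspace_le_H01 : testSubspace ≤ H01 := by
  rw [H01_eq_Amin_zero]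
  exact testSubspace_le_Amin 0

/-- At the critical exponent `Amin` and `Amax` agree, so the test functions alone already form a
core; any larger subspace of the domain is one too. -/
theorem isDenseInFormDomain_Amax_half (hξ : IsCutoff ξ) :
    IsDenseInFormDomain (H01 ⊔ cutoffLine 0 ξ) (prodOp (Amax (1 / 2)).adjoint (Amax (1 / 2))) := by
  have ha : -1 / 2 < 1 / 2 + (0 : ℝ) := by norm_num
  refine isDenseInFormDomain_adjoint_mul (dense_Amax _) (Amax_isClosed _)
    (sup_le ((H01_le_Amin _).trans (Amin_le_Amax _).1) fun f hf => ?_) ?_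
  · obtain ⟨c, rfl⟩ := (mem_cutoffLine_iff hξ ha).1 hf
    have h := mem_domain_iff_graph.2 ⟨_, cutoffElt_mem_Amax hξ ha⟩
    have e : Amax (1 / 2 + 0) = Amax (1 / 2) := by rw [add_zero]
    rw [e] at h
    exact Submodule.smul_mem _ _ h
  · rw [← Amin_eq_Amax_of_ge le_rfl]
    refine (Amin_core _).trans (Submodule.topologicalClosure_mono ?_)
    rintro ⟨f, g⟩ hfg
    obtain ⟨h1, h2⟩ := mem_domRestrict_graph.1 hfg
    exact mem_domRestrict_graph.2 ⟨Submodule.mem_sup_left (testSubspace_le_H01 h1), h2⟩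

theorem Amax_domain_not_le (hξ : IsCutoff ξ) (hm : -1 < m) (hm' : m < 0) :
    ¬ (Amax (1 / 2 + m)).domain ≤ (Amax (1 / 2 - m)).domain := fun h =>
  cutoffElt_notMem_Amax hξ (show -1 / 2 < 1 / 2 + m by linarith) (by linarith)
    (show 1 / 2 - m ≠ 1 / 2 + m from fun e => by linarith)
    (h (mem_domain_iff_graph.2 ⟨_, cutoffElt_mem_Amax hξ (by linarith)⟩))

/-- Form domains separate the two: that of the minimal product lies in D(`Amax (1/2 - m)`), while ξ
ζ_m belongs to the form domain of H_m and not to that space. -/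
theorem hamiltonian_ne_Amin (hξ : IsCutoff ξ) (hm : -1 < m) (hm' : m < 0) :
    hamiltonian m ξ ≠ prodOp (Amin (1 / 2 + m)).adjoint (Amin (1 / 2 + m)) := by
  rw [hamiltonian_eq hξ hm]
  intro h
  have h1 := congrArg formDomain h
  rw [formDomain_Amax, formDomain_Amin, SetLike.coe_set_eq] at h1
  refine Amax_domain_not_le hξ hm hm' ?_
  rw [h1]
  exact (Amin_domain_le (by linarith) _).trans (Amin_le_Amax _).1

theorem hamiltonian_ne_Amax (hξ : IsCutoff ξ) (hm : -1 < m) (hm' : m < 0) :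
    hamiltonian m ξ ≠ prodOp (Amax (1 / 2 - m)).adjoint (Amax (1 / 2 - m)) := by
  rw [hamiltonian_eq hξ hm]
  intro h
  have h1 := congrArg formDomain h
  rw [formDomain_Amax, formDomain_Amax, SetLike.coe_set_eq] at h1
  exact Amax_domain_not_le hξ hm hm' h1.le

end Extensions

end BesselOp

/-! ### The main theorem, case by case -/

open BesselOp in
theorem mainTheorem7 (m : ℝ) (hm : -1 < m) (ξ : ℝ → ℂ) (hξ : IsCutoff ξ) :
    -- positivity, self-adjointness, homogeneity and spectrum
    (IsPositiveOp (hamiltonian m ξ) ∧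
      IsSelfAdjoint (hamiltonian m ξ) ∧
      IsHomogeneousOp dilation (hamiltonian m ξ) (-2) ∧
      spec (hamiltonian m ξ) = {z : ℂ | ∃ t : ℝ, 0 ≤ t ∧ z = t}) ∧
    -- the case `m ≥ 1`
    (1 ≤ m →
      Amin (1 / 2 + m) = Amax (1 / 2 + m) ∧
      Amin (1 / 2 - m) = Amax (1 / 2 - m) ∧
      hamiltonian m ξ = prodOp (Amax (1 / 2 + m)).adjoint (Amax (1 / 2 + m)) ∧
      hamiltonian m ξ = prodOp (Amax (1 / 2 - m)).adjoint (Amax (1 / 2 - m)) ∧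
      formDomain (hamiltonian m ξ) = (H01 : Set L2) ∧
      hamiltonian m ξ = Lmin m ∧
      hamiltonian m ξ = Lmax m) ∧
    -- the case `0 < m < 1`
    (0 < m → m < 1 →
      Amin (1 / 2 + m) = Amax (1 / 2 + m) ∧
      hamiltonian m ξ = prodOp (Amax (1 / 2 + m)).adjoint (Amax (1 / 2 + m)) ∧
      hamiltonian m ξ = prodOp (Amin (1 / 2 - m)).adjoint (Amin (1 / 2 - m)) ∧
      formDomain (hamiltonian m ξ) = (H01 : Set L2) ∧
      IsFriedrichsExt (Lmin m) (hamiltonian m ξ)) ∧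
    -- the case `m = 0`
    (m = 0 →
      Amin (1 / 2) = Amax (1 / 2) ∧
      hamiltonian m ξ = prodOp (Amax (1 / 2)).adjoint (Amax (1 / 2)) ∧
      IsDenseInFormDomain (H01 ⊔ cutoffLine 0 ξ) (hamiltonian m ξ) ∧
      IsFriedrichsExt (Lmin m) (hamiltonian m ξ) ∧
      IsKreinExt (Lmin m) (hamiltonian m ξ)) ∧
    -- the case `-1 < m < 0` (the other realizations do not factorize `H_m`)
    (m < 0 →
      hamiltonian m ξ = prodOp (Amax (1 / 2 + m)).adjoint (Amax (1 / 2 + m)) ∧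
      hamiltonian m ξ ≠ prodOp (Amin (1 / 2 + m)).adjoint (Amin (1 / 2 + m)) ∧
      Amin (1 / 2 - m) = Amax (1 / 2 - m) ∧
      hamiltonian m ξ ≠ prodOp (Amax (1 / 2 - m)).adjoint (Amax (1 / 2 - m)) ∧
      formDomain (hamiltonian m ξ) = ((H01 ⊔ cutoffLine m ξ : Submodule ℂ L2) : Set L2) ∧
      IsKreinExt (Lmin m) (hamiltonian m ξ)) := by
  refine ⟨⟨hamiltonian_isPositiveOp hξ hm, hamiltonian_isSelfAdjoint hξ hm,
    hamiltonian_isHomogeneousOp hξ hm, spec_hamiltonian hξ hm⟩, fun h1 => ?_, fun h0 _ => ?_,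
    fun h0 => ?_, fun h0 => ?_⟩
  · have e := Amin_eq_Amax_of_le (α := 1 / 2 - m) (by linarith)
    refine ⟨Amin_eq_Amax_of_ge (by linarith), e, hamiltonian_eq hξ hm, ?_,
      formDomain_hamiltonian_of_pos hξ (by linarith), hamiltonian_eq_Lmin hξ h1,
      hamiltonian_eq_Lmax hξ h1⟩
    rw [← e]
    exact hamiltonian_eq_Amin hξ (by linarith)
  · refine ⟨Amin_eq_Amax_of_ge (by linarith), hamiltonian_eq hξ hm, hamiltonian_eq_Amin hξ h0,
      formDomain_hamiltonian_of_pos hξ h0, ?_⟩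
    rw [hamiltonian_eq_Amin hξ h0]
    exact isFriedrichsExt_Amin (sq_sub_half_sub m)
  · subst h0
    have e := Amin_eq_Amax_of_ge (α := 1 / 2) le_rfl
    have hH := hamiltonian_eq hξ hm
    rw [add_zero] at hH
    refine ⟨e, hH, ?_, ?_, ?_⟩
    · rw [hH]
      exact isDenseInFormDomain_Amax_half hξ
    -- At β = 1/2 minimal and maximal factors agree, so the same product is read once as the
    -- Friedrichs extension and once as the Krein extension.
    · rw [hH, ← e]
      exact isFriedrichsExt_Amin (by norm_num)
    · rw [hH]
      exact isKreinExt_Amax (by norm_num) le_rfl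
  · refine ⟨hamiltonian_eq hξ hm, hamiltonian_ne_Amin hξ hm h0, Amin_eq_Amax_of_ge (by linarith),
      hamiltonian_ne_Amax hξ hm h0, ?_, ?_⟩
    · rw [hamiltonian_eq hξ hm, formDomain_Amax, Amax_domain_eq hξ hm h0, H01_eq_Amin (α := 1 / 2 + m) (by linarith)]
    · rw [hamiltonian_eq hξ hm]
      exact isKreinExt_Amax (sq_sub_half_add m) (by linarith)
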